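/- **Model.** An actively dynamic network has a finite set $V$ of $n$ nodes with distinct UIDs (natural numbers) and, at the beginning of every round $i\ge 1$, a graph $D(i)=(V,E(i))$ of active edges; $D(1)=G_s$ is the initial graph. All nodes run the same deterministic program and initially know only their own UID. In a synchronous round every node sends messages to its neighbours (possibly different ones), receives messages, decides to activate edges with nodes at distance two, decides to deactivate edges with neighbours, and updates its state; contradictory decisions of the two endpoints of an edge have no effect. Let $E_{ac}(i),E_{dac}(i)$ be the sets of edges activated and deactivated in round $i$; then $E(i+1)=(E(i)\cup E_{ac}(i))\setminus E_{dac}(i)$. The running time $T$ is the number of rounds until all nodes have terminated. An algorithm is comparison based if it handles UIDs only through comparisons, i.e. its behaviour commutes with every order-preserving renaming of the UIDs. A *complete binary tree* is a rooted tree in which every node has at most two children and all levels except possibly the last are full. A *wreath* on a set of nodes is the union of a spanning ring (a single edge for two nodes, no edge for one node) and a spanning complete binary tree. **GraphToWreath** is the following strategy. The nodes are partitioned into committees. A committee $C(u)$ is led by its node $u$ of greatest UID, which is also the UID of the committee. Initially every node is a committee, in selection mode. Two committees are neighbouring if an edge of $G_s$ joins them. The edges of $G_s$ are kept until termination. Every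 committee is in one of four modes, each of which may last several rounds. * *Selection:* $C(u)$ is a wreath whose tree has root $u$ (apart from edges of $G_s$, its internal active edges are exactly those of the wreath). Its candidates are the neighbouring committees with a greater UID that are in neither ring merging nor tree merging mode. If it has candidates, then it may select the one with the greatest UID. A committee that selects, and one that has no candidates and is selected, enters ring merging mode. A selected committee enters that mode together with those that select it. If $C(u)$ has no neighbouring committee, it may enter termination mode. * *Ring merging:* the rings of all committees in a tree of selections are merged into one spanning ring, after which all these committees together enter tree merging mode. * *Tree merging:* the ring is cut at the leader $r$ of the root committee of the tree of selections into a line rooted at $r$, while the ring edges remain active. On this line the nodes run asynchronous LineToCompleteBinaryTree: every node, at its own pace, makes the same sequence of parent changes as in the synchronous routine, in which in every round each node replaces its parent by its grandparent unless that is impossible or the grandparent has two children. When all have finished, the committees of the tree of selections become one committee $C(r)$, in selection mode. * *Termination:* all edges are deactivated except those of the spanning complete binary tree. **Theorem.** There is a deterministic, comparison-based distributed algorithm that implements GraphToWreath, needs no knowledge of $n$ or of a degree bound, and has the following property. For every $\Delta$ there is a constant $C=C(\Delta)$ such that, for every connected graph $G_s$ with $n\ge 1$ nodes and maximum degree at most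 $\Delta$ and every assignment of distinct UIDs, all nodes terminate after some number $T$ of rounds, and the execution solves Depth-$\log n$ Tree: exactly one node, the one with the greatest UID, has status Leader and all others have status Follower, and the final graph is a spanning complete binary tree rooted at the leader, of depth $\lfloor\log_2 n\rfloor$. Moreover, if $n\ge 2$, 1. $T\le C\log_2^2 n$; 2. the total number of edge activations $\sum_{i=1}^{T}|E_{ac}(i)|$ is at most $C\,n\log_2^2 n$; 3. $|E(i)|\le C\,n$ for all $1\le i\le T+1$ (in particular, at most $C\,n$ activated edges $E(i)\setminus E(1)$); 4. the graph $(V,E(i)\setminus E(1))$ has maximum degree at most $C$ for all $1\le i\le T+1$. -/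

import Mathlib

/-! ## Actively dynamic networks and distributed algorithms -/

/-- The value of the output variable of a node in leader election. -/
inductive Status where
  | leader
  | follower

/-- A deterministic distributed algorithm for actively dynamic networks.  All nodes run the same
program; a node initially knows only its own UID (a natural number).  In a round, a node sends a
(possibly different) message to each neighbour, receives a set of pairs (UID of the sender,
message), and, from its state and the received messages, chooses the nodes with which it wants to
activate, respectively deactivate, an edge, and its new state.  Nodes are addressed by their UIDs.
Internal computation is free. -/
structure Algorithm where
  State : Type
  Msg : Type
  init : ℕ → State
  send : State → ℕ → Option Msg
  activate : State → Set (ℕ × Msg) → Set ℕ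
  deactivate : State → Set (ℕ × Msg) → Set ℕ
  update : State → Set (ℕ × Msg) → State
  /-- The states in which a node has terminated. -/
  halted : State → Prop
  status : State → Status

namespace Algorithm

/-- An algorithm is comparison based if it handles UIDs through comparisons only: renaming the UIDs
that occur in states and messages by any order embedding does not change what the algorithm does. -/
def IsComparisonBased (A : Algorithm) : Prop :=
  ∃ (mapState : (ℕ ↪o ℕ) → A.State → A.State) (mapMsg : (ℕ ↪o ℕ) → A.Msg → A.Msg),
    ∀ f : ℕ ↪o ℕ,
      let rename : Set (ℕ × A.Msg) → Set (ℕ × A.Msg) := fun I =>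
        (fun p : ℕ × A.Msg => (f p.1, mapMsg f p.2)) '' I
      (∀ x, A.init (f x) = mapState f (A.init x)) ∧
      (∀ s x, A.send (mapState f s) (f x) = (A.send s x).map (mapMsg f)) ∧
      (∀ s I x, f x ∈ A.activate (mapState f s) (rename I) ↔ x ∈ A.activate s I) ∧
      (∀ s I x, f x ∈ A.deactivate (mapState f s) (rename I) ↔ x ∈ A.deactivate s I) ∧
      (∀ s I, A.update (mapState f s) (rename I) = mapState f (A.update s I)) ∧
      (∀ s, A.halted (mapState f s) ↔ A.halted s) ∧
      (∀ s, A.status (mapState f s) = A.status s)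

/-- A configuration: the graph of active edges and the state of every node. -/
structure Config (A : Algorithm) (V : Type) where
  graph : SimpleGraph V
  state : V → A.State

variable (A : Algorithm) {V : Type} (uid : V → ℕ)

/-- The messages that `v` receives, tagged with the UIDs of the senders. -/
def inbox (c : A.Config V) (v : V) : Set (ℕ × A.Msg) :=
  {p | ∃ w, c.graph.Adj w v ∧ ¬ A.halted (c.state w) ∧ uid w = p.1 ∧
    A.send (c.state w) (uid v) = some p.2}

/-- In this round `u` decides to activate the edge `uv`. -/
def WantsActivate (c : A.Config V) (u v : V) : Prop :=
  ¬ A.halted (c.state u) ∧ uid v ∈ A.activate (c.state u) (A.inbox uid c u)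

/-- In this round `u` decides to deactivate the edge `uv`. -/
def WantsDeactivate (c : A.Config V) (u v : V) : Prop :=
  ¬ A.halted (c.state u) ∧ uid v ∈ A.deactivate (c.state u) (A.inbox uid c u)

/-- The edges activated in the round that starts in `c`.  An edge can be activated only between
potential neighbours (nodes at distance two); contradictory decisions about an edge have no effect. -/
def activated (c : A.Config V) : SimpleGraph V where
  Adj u v := u ≠ v ∧ ¬ c.graph.Adj u v ∧ (∃ w, c.graph.Adj u w ∧ c.graph.Adj w v) ∧
    (A.WantsActivate uid c u v ∨ A.WantsActivate uid c v u) ∧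
    ¬ (A.WantsDeactivate uid c u v ∨ A.WantsDeactivate uid c v u)
  symm := ⟨by
    rintro u v ⟨h1, h2, ⟨w, h3, h4⟩, h5, h6⟩
    exact ⟨h1.symm, fun h => h2 h.symm, ⟨w, h4.symm, h3.symm⟩, h5.symm, fun h => h6 h.symm⟩⟩
  loopless := ⟨fun _ h => h.1 rfl⟩

/-- The edges deactivated in the round that starts in `c`. -/
def deactivated (c : A.Config V) : SimpleGraph V where
  Adj u v := c.graph.Adj u v ∧
    (A.WantsDeactivate uid c u v ∨ A.WantsDeactivate uid c v u) ∧
    ¬ (A.WantsActivate uid c u v ∨ A.WantsActivate uid c v u)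
  symm := ⟨by
    rintro u v ⟨h1, h2, h3⟩
    exact ⟨h1.symm, h2.symm, fun h => h3 h.symm⟩⟩
  loopless := ⟨fun _ h => h.1.ne rfl⟩

open Classical in
/-- One synchronous round.  A node that has terminated does nothing any more. -/
noncomputable def step (c : A.Config V) : A.Config V where
  graph := (c.graph ⊔ A.activated uid c) \ A.deactivated uid c
  state v := if A.halted (c.state v) then c.state v
    else A.update (c.state v) (A.inbox uid c v)

/-- `A.run uid G i` is the configuration after `i` rounds (at the beginning of round `i + 1`), when
the initial graph is `G`. -/
noncomputable def run (G : SimpleGraph V) : ℕ → A.Config V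
  | 0 => ⟨G, fun v => A.init (uid v)⟩
  | i + 1 => A.step uid (run G i)

/-- The running time on the initial graph `G` is `T` rounds: `T` is the first time at which all
nodes have terminated. -/
def HasRunningTime (G : SimpleGraph V) (T : ℕ) : Prop :=
  IsLeast {i | ∀ v, A.halted ((A.run uid G i).state v)} T

/-- After `i` rounds the node `r` is the unique leader. -/
def ElectsLeader (G : SimpleGraph V) (i : ℕ) (r : V) : Prop :=
  ∀ v, A.status ((A.run uid G i).state v) = Status.leader ↔ v = r

/-- The total number of edge activations in the first `T` rounds. -/
noncomputable def totalActivations (G : SimpleGraph V) (T : ℕ) : ℕ :=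
  ∑ i ∈ Finset.range T, (A.activated uid (A.run uid G i)).edgeSet.ncard

end Algorithm

/-! ## Target networks, rings and trees -/

/-- `G` is a tree whose depth, when it is rooted at `r`, is `d`. -/
def IsRootedTreeOfDepth {V : Type} (G : SimpleGraph V) (r : V) (d : ℕ) : Prop :=
  G.IsTree ∧ (∀ v, G.dist r v ≤ d) ∧ ∃ v, G.dist r v = d

/-- `G` is a complete binary tree with root `r`: a tree in which every node has at most two
children and every level, except possibly the last one, is full. -/
def IsCompleteBinaryTree {V : Type} (G : SimpleGraph V) (r : V) : Prop :=
  G.IsTree ∧ (∀ v, {w | G.Adj v w ∧ G.dist r w = G.dist r v + 1}.ncard ≤ 2) ∧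
    ∀ k, (∃ v, k < G.dist r v) → {v | G.dist r v = k}.ncard = 2 ^ k

/-- The graph that joins every `x` to `f x`: the ring of a successor map, or the tree of a parent
map whose root is a fixed point. -/
def graphOfMap {V : Type} (f : V → V) : SimpleGraph V :=
  SimpleGraph.fromRel fun x y => f x = y

/-- One synchronous round of LineToCompleteBinaryTree on parent pointers with root `r`: every node
moves from its parent to its grandparent, unless the grandparent has two children.  (A child of the
root keeps its parent, as the root is its own parent.) -/
noncomputable def lineToTreeStep {V : Type} (r : V) (par : V → V) (x : V) : V :=
  if 2 ≤ {y | y ≠ r ∧ par y = par (par x)}.ncard then par x else par (par x)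

open Classical in
/-- LineToCompleteBinaryTree, after `t` rounds, on the line `r, σ r, σ (σ r), …` rooted at `r` that
is obtained by cutting a ring with successor map `σ` at `r`. -/
noncomputable def lineToTree {V : Type} (r : V) (σ : Equiv.Perm V) (t : ℕ) : V → V :=
  (lineToTreeStep r)^[t] fun x => if x = r then r else σ.symm x

/-! ## The GraphToWreath algorithm -/

/-- The modes of a committee. -/
inductive Mode where
  | selection
  | ringMerging
  | treeMerging
  | termination

/-- The committees at the beginning of a round.  `mode` and `sel` matter only for leaders. -/
structure Committees (V : Type) where
  /-- the leader of the committee of a node -/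
  leader : V → V
  /-- the mode of the committee of a leader -/
  mode : V → Mode
  /-- the committee, given by its leader, that the committee of a leader has selected -/
  sel : V → Option V
  /-- the successor of a node on the (oriented) ring of its committee -/
  succ : Equiv.Perm V
  /-- the parent of a node in the tree of its committee; a root is its own parent -/
  parent : V → V
  /-- the number of moves that a node has made in the current LineToCompleteBinaryTree routine -/
  moves : V → ℕ

namespace Committees

variable {V : Type}

/-- The vertex set of the committee `C(u)`. -/
def committee (s : Committees V) (u : V) : Set V := {x | s.leader x = u}

/-- `C(u)` and `C(z)` are different committees joined by an edge of the initial graph. -/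
def Neighbouring (G : SimpleGraph V) (s : Committees V) (u z : V) : Prop :=
  u ≠ z ∧ ∃ x ∈ s.committee u, ∃ y ∈ s.committee z, G.Adj x y

/-- `C(z)` may be selected by `C(u)`: it is a neighbouring committee with a greater UID that is
neither in ring merging nor in tree merging mode. -/
def Candidate (G : SimpleGraph V) (uid : V → ℕ) (s : Committees V) (u z : V) : Prop :=
  s.Neighbouring G u z ∧ uid u < uid z ∧ s.mode z ≠ Mode.ringMerging ∧ s.mode z ≠ Mode.treeMerging

/-- The selection tree of committees that contains `C(u)` has the root `C(r)`. -/
def HasRoot (s : Committees V) (u r : V) : Prop :=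
  s.sel r = none ∧ Relation.ReflTransGen (fun a b => s.sel a = some b) u r

/-- The nodes of all the committees in the selection tree with root `C(r)`. -/
def group (s : Committees V) (r : V) : Set V := {x | s.HasRoot (s.leader x) r}

/-- On the committee `C(u)` the active graph `D` is, apart from edges of the initial graph `G`, a
wreath: the union of a spanning ring and of a spanning complete binary tree with root `u`.
(A ring on two nodes is an edge, a ring on one node has no edge.) -/
def IsWreath (G D : SimpleGraph V) (s : Committees V) (u : V) : Prop :=
  s.succ.IsCycleOn (s.committee u) ∧
  (∃ hu : u ∈ s.committee u,
    IsCompleteBinaryTree ((graphOfMap s.parent).induce (s.committee u)) ⟨u, hu⟩) ∧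
  D.induce (s.committee u) =
    (graphOfMap s.succ ⊔ graphOfMap s.parent ⊔ G).induce (s.committee u)

/-- The committee structure `s` is realised by the graph `D` of active edges. -/
structure Realised (G D : SimpleGraph V) (uid : V → ℕ) (s : Committees V) : Prop where
  leader_leader : ∀ x, s.leader (s.leader x) = s.leader x
  /-- the leader has the greatest UID in its committee -/
  uid_le_leader : ∀ x, uid x ≤ uid (s.leader x)
  /-- the edges of the initial graph are kept until termination -/
  keeps_initial : (∃ x, s.mode (s.leader x) ≠ Mode.termination) → G ≤ D
  /-- committees that are not merging have not selected, and are wreaths until termination -/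
  sel_selection : ∀ u, s.leader u = u → s.mode u = Mode.selection ∨ s.mode u = Mode.termination →
    s.sel u = none
  wreath : ∀ u, s.leader u = u → s.mode u = Mode.selection → s.IsWreath G D u
  /-- a committee and the committee that it has selected are merging together -/
  sel_merging : ∀ u v, s.leader u = u → s.sel u = some v →
    s.leader v = v ∧ uid u < uid v ∧ s.mode v = s.mode u
  /-- in tree merging mode a ring spans all the committees of the selection tree, and every node
  runs, at its own pace, LineToCompleteBinaryTree on the line obtained from that ring -/
  treeMerging : ∀ r, s.leader r = r → s.mode r = Mode.treeMerging → s.sel r = none →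
    s.succ.IsCycleOn (s.group r) ∧
    ∀ x ∈ s.group r, (s.succ x ≠ x → D.Adj x (s.succ x)) ∧
      s.parent x = lineToTree r s.succ (s.moves x) x ∧ (x ≠ r → D.Adj x (s.parent x))
  termination : ∀ u, s.leader u = u → s.mode u = Mode.termination →
    ∀ x ∈ s.committee u, x ≠ u → D.Adj x (s.parent x)

/-- At the beginning every node is a committee, in selection mode. -/
def initial : Committees V where
  leader := id
  mode _ := Mode.selection
  sel _ := none
  succ := 1
  parent := id
  moves _ := 0

/-- The nodes, the ring and the tree of the committee `C(u)` do not change. -/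
def Unchanged (s s' : Committees V) (u : V) : Prop :=
  ∀ x ∈ s.committee u, s'.leader x = u ∧ s'.succ x = s.succ x ∧ s'.parent x = s.parent x

/-- The committee `C(u)` in selection mode enters ring merging mode.  Either it has candidates, and
then it selects the one with the greatest UID, or it has none and it is selected.  A committee that
is selected enters ring merging mode, too. -/
def EntersRingMerging (G : SimpleGraph V) (uid : V → ℕ) (s s' : Committees V) (u : V) : Prop :=
  s'.mode u = Mode.ringMerging ∧ s.Unchanged s' u ∧
  ((∃ v, s'.sel u = some v ∧ s.Candidate G uid u v ∧ (∀ z, s.Candidate G uid u z → uid z ≤ uid v) ∧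
      s'.mode v = Mode.ringMerging) ∨
    (s'.sel u = none ∧ (∀ z, ¬ s.Candidate G uid u z) ∧
      ∃ k, s.leader k = k ∧ s.mode k = Mode.selection ∧ s'.sel k = some u))

/-- What may happen to the committee `C(u)` in one round.  A phase of a committee may last several
rounds, so that a committee may also stay in its mode. -/
def Evolves (G : SimpleGraph V) (uid : V → ℕ) (s s' : Committees V) (u : V) : Prop :=
  match s.mode u with
  | Mode.selection =>
      (s'.mode u = Mode.selection ∧ s.Unchanged s' u) ∨
      s.EntersRingMerging G uid s' u ∨
      (s'.mode u = Mode.termination ∧ s.Unchanged s' u ∧ ∀ z, ¬ s.Neighbouring G u z)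
  | Mode.ringMerging => s'.sel u = s.sel u ∧
      ((s'.mode u = Mode.ringMerging ∧ s.Unchanged s' u) ∨
        (s'.mode u = Mode.treeMerging ∧
          ∀ x ∈ s.committee u, s'.leader x = u ∧ s'.moves x = 0))
  | Mode.treeMerging =>
      (s'.mode u = Mode.treeMerging ∧ s'.sel u = s.sel u ∧
        ∀ x ∈ s.committee u, s'.leader x = u ∧ s'.succ x = s.succ x ∧
          (s'.moves x = s.moves x ∨ s'.moves x = s.moves x + 1)) ∨
      -- LineToCompleteBinaryTree has terminated at all nodes of the selection tree, and all of its
      -- committees become one committee led by the root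
      (∃ r, s.HasRoot u r ∧ s'.mode r = Mode.selection ∧
        (∀ x ∈ s.group r, ∀ t, s.moves x ≤ t → lineToTree r s.succ t x = s.parent x) ∧
        ∀ x ∈ s.committee u, s'.leader x = r ∧ s'.succ x = s.succ x ∧ s'.parent x = s.parent x)
  | Mode.termination => s'.mode u = Mode.termination ∧ s.Unchanged s' u

end Committees

/-- The execution of `A` on the initial graph `G`, during the first `T` rounds, is an execution of
GraphToWreath: the nodes are organised in committees that evolve by its rules, and at the end there
is a single committee, its tree is the graph of active edges, and its leader is elected. -/
def Algorithm.ExecutesGraphToWreath (A : Algorithm) {V : Type} (uid : V → ℕ) (G : SimpleGraph V)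
    (T : ℕ) : Prop :=
  ∃ s : ℕ → Committees V,
    s 0 = Committees.initial ∧
    (∀ i ≤ T, (s i).Realised G (A.run uid G i).graph uid) ∧
    (∀ i < T, ∀ u, (s i).leader u = u → (s i).Evolves G uid (s (i + 1)) u) ∧
    ∃ r, (∀ x, (s T).leader x = r) ∧ (s T).mode r = Mode.termination ∧
      (A.run uid G T).graph = graphOfMap (s T).parent ∧ A.ElectsLeader uid G T r

/-! A common clock replaces the knowledge of `n`. After one round of introductions, time is cut into
slots `j = 0, 1, 2, …` of `6 * j + 10` rounds. Slot `j` completes only those mergers whose result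
has at most `2 ^ j` nodes; a larger tree of selections stays in ring merging mode (`busy`) and waits
for a later slot. Hence a committee that is free to select in slot `j` has a tree of depth at most
`j`, and `O(j)` rounds of flooding tell its nodes all about the committee and its neighbours.

UIDs increase along selections, so selections have no cycles. The merging committees are joined into
a forest on the nodes: inside a committee each node hangs on its ring predecessor, except for one
port, which hangs on a node of the selected committee along an edge of the initial graph (or is the
leader and a root). The Euler tour of this forest passes every node exactly twice, on entering and
on leaving. Pointer doubling along it therefore costs at most four extra edges per node, and after
`j + 1` doublings every node of a tree with at most `2 ^ j` nodes knows the whole tree. All these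
nodes then compute the same cyclic order, the lexicographically least one in which successive nodes
are at most three forest edges apart; it exists because the cube of a connected graph has a
Hamiltonian cycle (`exists_tour`). One round of shortcuts over two forest edges makes the ring
reachable in the next round. LineToCompleteBinaryTree has a closed form on the ring
(`lineToTree_eq`): after `t` rounds the parent of node `i` is `i - 2 ^ min t (heapExp i)`. It is
stationary after `j` rounds, and the result is a complete binary tree
(`isCompleteBinaryTree_of_heap`).

For the running time, let `2 ^ L ≥ n`. From slot `L` on, every merger ends in its own slot. From
then on two slots double the least size of a committee (`Net.AtLeast.almostTwice`,
`Net.AlmostTwice.atLeast`): a committee left out in one slot has afterwards a neighbour of greater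
UID, and so merges in the next. Thus `3 * L + 2` slots suffice, which is `O(L ^ 2)` rounds
(`exists_finished`). In every round the activated edges have degree at most `(Δ + 3) ^ 2 + 12`
(`Net.degree_mergeGraph_le`); this gives the linear bound on edges, and the number of activations is
at most rounds times edges.

The program is written as a function of the labels of all nodes (`Know`). The lemmas
`Know.Agree.want` and `Know.Agree.label` say that a node acts in the same way on renamed and partial
knowledge, as long as the relevant labels are covered. With full knowledge this is comparison
basedness; with partial knowledge it reduces the execution of a stage (`At.stage`) to two checks,
that enough has been heard and that wanted edges span distance at most two. The rest concerns the
combinatorial object `Net`. -/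

/-! ## The heap order and LineToCompleteBinaryTree -/

/-- The number of times that the `i`-th node of the line moves in LineToCompleteBinaryTree. -/
def heapExp (i : ℕ) : ℕ := Nat.log 2 ((2 * i + 2) / 3)

/-- The index of the parent of the `i`-th node of the line after `t` rounds. -/
def heapParent (t i : ℕ) : ℕ := i - 2 ^ min t (heapExp i)

lemma le_heapExp_iff {e i : ℕ} (hi : 0 < i) : e ≤ heapExp i ↔ 3 * 2 ^ e ≤ 2 * i + 2 := by
  unfold heapExp
  rw [Nat.le_log_iff_pow_le (by norm_num) (by omega)]
  omega

lemma heapExp_bounds {i : ℕ} (hi : 0 < i) :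
    3 * 2 ^ heapExp i ≤ 2 * i + 2 ∧ 2 * i + 2 < 6 * 2 ^ heapExp i := by
  refine ⟨(le_heapExp_iff hi).1 le_rfl, ?_⟩
  have := (le_heapExp_iff (e := heapExp i + 1) hi).not.1 (by omega)
  rw [pow_succ] at this; omega

lemma heapExp_eq {e i : ℕ} (hi : 0 < i) (h1 : 3 * 2 ^ e ≤ 2 * i + 2) (h2 : 2 * i + 2 < 6 * 2 ^ e) :
    heapExp i = e := by
  apply le_antisymm _ ((le_heapExp_iff hi).2 h1)
  by_contra h
  have := (le_heapExp_iff (e := e + 1) hi).1 (by omega)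
  rw [pow_succ] at this; omega

lemma heapExp_le {i j : ℕ} (h : i < 2 ^ j) : heapExp i ≤ j := by
  rcases Nat.eq_zero_or_pos i with rfl | hi
  · simp [heapExp]
  · by_contra hc
    have := (le_heapExp_iff (e := j + 1) hi).1 (by omega)
    rw [pow_succ] at this; omega

lemma heapParent_zero (i : ℕ) : heapParent 0 i = i - 1 := by simp [heapParent]

lemma heapParent_zero_right (t : ℕ) : heapParent t 0 = 0 := by simp [heapParent]

lemma heapParent_le (t i : ℕ) : heapParent t i ≤ i := Nat.sub_le _ _

lemma heapParent_eq_of_le {t i : ℕ} (h : heapExp i ≤ t) : heapParent t i = i - 2 ^ heapExp i := by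
  rw [heapParent, min_eq_right h]

lemma heapParent_lt {t i : ℕ} (hi : 0 < i) : heapParent t i < i := by
  have : 0 < 2 ^ min t (heapExp i) := by positivity
  unfold heapParent; omega

lemma two_pow_min_le {t i : ℕ} (hi : 0 < i) : 2 ^ min t (heapExp i) ≤ i := by
  have h1 : 2 ^ min t (heapExp i) ≤ 2 ^ heapExp i :=
    Nat.pow_le_pow_right (by norm_num) (min_le_right _ _)
  have := (heapExp_bounds hi).1
  omega

/-- The parent of a node that is still moving has itself made `t` moves, so the grandparent lies
another `2 ^ t` ahead on the line. The last inequality gives the grandparent an index of at least `2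
^ t - 1`, as `eq_of_heapParent_eq` requires. -/
lemma heapParent_heapParent_of_lt {t i : ℕ} (hi : 0 < i) (h : t < heapExp i) :
    heapParent t i = i - 2 ^ t ∧ heapParent t (heapParent t i) = i - 2 ^ (t + 1) ∧
      3 * 2 ^ t ≤ i + 1 := by
  have h1 := (le_heapExp_iff (e := t + 1) hi).1 h
  rw [pow_succ] at h1
  have hp : 0 < 2 ^ t := by positivity
  have h2 : heapParent t i = i - 2 ^ t := by rw [heapParent, min_eq_left h.le]
  refine ⟨h2, ?_, by omega⟩
  have h3 : t ≤ heapExp (i - 2 ^ t) := (le_heapExp_iff (by omega)).2 (by omega)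
  rw [h2, heapParent, min_eq_left h3, pow_succ]; omega

/-- The indices of the two children of the `g`-th node in the heap order. -/
lemma heapExp_children (g : ℕ) : heapExp (g + 2 ^ Nat.log 2 (g + 1)) = Nat.log 2 (g + 1) ∧
    heapExp (g + 2 ^ (Nat.log 2 (g + 1) + 1)) = Nat.log 2 (g + 1) + 1 := by
  have h1 := Nat.pow_log_le_self 2 (x := g + 1) (by omega)
  have h2 := Nat.lt_pow_succ_log_self (b := 2) (by norm_num) (g + 1)
  have hp : 0 < 2 ^ Nat.log 2 (g + 1) := by positivity
  rw [pow_succ] at h2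
  constructor
  · apply heapExp_eq <;> omega
  · apply heapExp_eq <;> rw [pow_succ] <;> omega

/-- Converse of `heapExp_children`: a node whose final parent is `g` is one of these two children.
-/
lemma log_le_heapExp {g k : ℕ} (hk : 0 < k) (h : k - 2 ^ heapExp k = g) :
    heapExp k = Nat.log 2 (g + 1) ∨ heapExp k = Nat.log 2 (g + 1) + 1 := by
  have h1 := Nat.pow_log_le_self 2 (x := g + 1) (by omega)
  have h2 := Nat.lt_pow_succ_log_self (b := 2) (by norm_num) (g + 1)
  have h3 := heapExp_bounds hk
  have h4 : Nat.log 2 (g + 1) < heapExp k + 1 := by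
    rw [← Nat.pow_lt_pow_iff_right (a := 2) (by norm_num), pow_succ]; omega
  have h5 : heapExp k < Nat.log 2 (g + 1) + 2 := by
    rw [← Nat.pow_lt_pow_iff_right (a := 2) (by norm_num), pow_succ]; omega
  omega

/-- `Nat.log 2 (i + 1)` is the level of node `i` in the final tree, so this is what makes depths
computable. -/
lemma log_heapParent {i : ℕ} (hi : 0 < i) :
    Nat.log 2 (i - 2 ^ heapExp i + 1) + 1 = Nat.log 2 (i + 1) := by
  have h3 := heapExp_bounds hi
  have h1 := Nat.pow_log_le_self 2 (x := i - 2 ^ heapExp i + 1) (by omega)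
  have h2 := Nat.lt_pow_succ_log_self (b := 2) (by norm_num) (i - 2 ^ heapExp i + 1)
  symm
  rw [Nat.log_eq_iff (by omega)]
  rw [pow_succ] at h2
  rw [pow_succ, pow_succ]
  have h := log_le_heapExp hi rfl
  generalize Nat.log 2 (i - 2 ^ heapExp i + 1) = m at *
  have hq : 0 < 2 ^ m := by positivity
  rcases h with h | h
  · rw [h] at h1 h2 h3
    omega
  · rw [h, pow_succ] at h1 h2 h3
    omega

/-- When the `i`-th node has finished, its grandparent has another child, which is present and has
arrived there. -/
lemma heapParent_full {t i : ℕ} (hi : 0 < i) (h : heapExp i ≤ t) (hp : 0 < heapParent t i) :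
    ∃ g, g = heapParent t (heapParent t i) ∧ ∃ a b, a ≠ b ∧ 0 < a ∧ 0 < b ∧ a ≤ i ∧ b ≤ i ∧
      heapParent t a = g ∧ heapParent t b = g := by
  rw [heapParent_eq_of_le h] at hp ⊢
  set p := i - 2 ^ heapExp i with hpdef
  have hb := heapExp_bounds hi
  have hb' := heapExp_bounds hp
  have he : heapExp p ≤ heapExp i := by
    by_contra hc
    have := Nat.pow_le_pow_right (n := 2) (by norm_num) (show heapExp i + 1 ≤ heapExp p by omega)
    rw [pow_succ] at this; omega
  rw [heapParent_eq_of_le (he.trans h)]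
  refine ⟨_, rfl, ?_⟩
  set g := p - 2 ^ heapExp p with hgdef
  set m := Nat.log 2 (g + 1) with hm
  have h1 : 2 ^ m ≤ g + 1 := Nat.pow_log_le_self 2 (by omega)
  have h2 := Nat.lt_pow_succ_log_self (b := 2) (by norm_num) (g + 1)
  rw [← hm, pow_succ] at h2
  have hq : 0 < 2 ^ m := by positivity
  -- The farther child `g + 2 ^ (m + 1)` of the grandparent is at most `i`, hence present, and its
  -- `m + 1` moves are at most `heapExp i ≤ t`, hence done. The cases are whether the parent of `i`
  -- is the nearer or the farther child of `g`.
  have key : 3 * 2 ^ (m + 1) ≤ 2 * i + 2 ∧ g + 2 ^ (m + 1) ≤ i := by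
    rw [pow_succ]
    rcases log_le_heapExp hp rfl with h' | h'
    · rw [← hgdef, ← hm] at h'
      rw [h'] at hb' hgdef he
      have hlt : m < heapExp i := by
        rw [← Nat.pow_lt_pow_iff_right (a := 2) (by norm_num)]; omega
      have := Nat.pow_le_pow_right (n := 2) (by norm_num) (show m + 1 ≤ heapExp i by omega)
      rw [pow_succ] at this; omega
    · rw [← hgdef, ← hm] at h'
      rw [h', pow_succ] at hb' hgdef
      omega
  have hmt : m + 1 ≤ t := ((le_heapExp_iff hi).2 key.1).trans h
  obtain ⟨e1, e2⟩ := heapExp_children g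
  rw [← hm] at e1 e2
  rw [pow_succ] at key
  refine ⟨g + 2 ^ m, g + 2 ^ (m + 1), ?_, by omega, by rw [pow_succ]; omega, by omega,
    by rw [pow_succ]; omega, ?_, ?_⟩
  · rw [pow_succ]; omega
  · rw [heapParent_eq_of_le (by omega), e1]; omega
  · rw [heapParent_eq_of_le (by omega), e2]; omega

/-- Two nodes below a node that is moving up do not have the same new parent. -/
lemma eq_of_heapParent_eq {t k g : ℕ} (hk : 0 < k) (h : heapParent t k = g) (hg : 2 ^ t < g + 2) :
    k = g + 2 ^ t := by
  have hle := two_pow_min_le (t := t) hk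
  unfold heapParent at h
  rcases le_or_gt t (heapExp k) with h' | h'
  · rw [min_eq_left h'] at h hle; omega
  · rw [min_eq_right h'.le] at h hle
    have := (heapExp_bounds hk).2
    have := Nat.pow_le_pow_right (n := 2) (by norm_num) (show heapExp k + 1 ≤ t by omega)
    rw [pow_succ] at this
    omega

/-- `f 0, …, f (n - 1)` enumerate the set `S`. -/
structure Enumerates {V : Type*} (f : ℕ → V) (n : ℕ) (S : Set V) : Prop where
  pos : 0 < n
  inj : ∀ i < n, ∀ j < n, f i = f j → i = j
  mem : ∀ i < n, f i ∈ S
  surj : ∀ x ∈ S, ∃ i < n, f i = x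

lemma Enumerates.ncard_eq {V : Type*} {f : ℕ → V} {n : ℕ} {S : Set V} (h : Enumerates f n S) :
    S.ncard = n := by
  have : S = f '' (Finset.range n : Set ℕ) := by
    ext x; constructor
    · intro hx; obtain ⟨i, hi, rfl⟩ := h.surj x hx; exact ⟨i, by simpa using hi, rfl⟩
    · rintro ⟨i, hi, rfl⟩; exact h.mem i (by simpa using hi)
  rw [this, Set.InjOn.ncard_image, Set.ncard_coe_finset, Finset.card_range]
  intro i hi j hj hij
  exact h.inj i (by simpa using hi) j (by simpa using hj) hij

lemma Equiv.Perm.IsCycleOn.enumerates {V : Type*} [Finite V] {σ : Equiv.Perm V} {S : Set V}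
    (h : σ.IsCycleOn S) {r : V} (hr : r ∈ S) :
    Enumerates (fun i => (σ ^ i) r) S.ncard S := by
  classical
  obtain ⟨s, rfl⟩ : ∃ s : Finset V, S = s := ⟨S.toFinite.toFinset, by simp⟩
  rw [Set.ncard_coe_finset]
  have hinj : ∀ i < s.card, ∀ j < s.card, i ≤ j → (σ ^ i) r = (σ ^ j) r → i = j := by
    intro i hi j hj hij he
    have : (σ ^ (j - i)) r = r := by
      apply (σ ^ i).injective
      rw [← Equiv.Perm.mul_apply, ← pow_add, Nat.add_sub_cancel' hij, he]
    rw [h.pow_apply_eq hr] at this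
    have := Nat.eq_zero_of_dvd_of_lt this (by omega)
    omega
  refine ⟨Finset.card_pos.2 ⟨r, hr⟩, fun i hi j hj he => ?_, fun i _ => ?_, fun x hx => ?_⟩
  · rcases le_total i j with hij | hij
    · exact hinj i hi j hj hij he
    · exact (hinj j hj i hi hij he.symm).symm
  · exact (h.1.perm_pow i).mapsTo hr
  · exact h.exists_pow_eq hr hx

/-- The closed form of LineToCompleteBinaryTree. -/
lemma lineToTree_eq {V : Type} [Finite V] {σ : Equiv.Perm V} {S : Set V} {f : ℕ → V} {n : ℕ}
    (hf : Enumerates f n S) (hσ : ∀ i, i + 1 < n → σ (f i) = f (i + 1))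
    (hS : ∀ x ∉ S, σ.symm x ∉ S) (t : ℕ) :
    (∀ i < n, lineToTree (f 0) σ t (f i) = f (heapParent t i)) ∧
      ∀ x ∉ S, lineToTree (f 0) σ t x ∉ S := by
  induction t with
  | zero =>
    refine ⟨fun i hi => ?_, fun x hx => ?_⟩
    · rcases i with _ | i
      · simp [lineToTree, heapParent_zero]
      · have : f (i + 1) ≠ f 0 := fun h => by have := hf.inj _ hi _ hf.pos h; omega
        simp only [lineToTree, Function.iterate_zero, id, this, if_false, heapParent_zero]
        rw [Equiv.symm_apply_eq, Nat.add_sub_cancel, hσ i hi]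
    · have : x ≠ f 0 := fun h => hx (h ▸ hf.mem 0 hf.pos)
      simpa [lineToTree, this] using hS x hx
  | succ t ih =>
    obtain ⟨ih1, ih2⟩ := ih
    have hstep : lineToTree (f 0) σ (t + 1) = lineToTreeStep (f 0) (lineToTree (f 0) σ t) := by
      simp only [lineToTree, Function.iterate_succ_apply']
    rw [hstep]
    set par := lineToTree (f 0) σ t
    have hlt : ∀ i < n, heapParent t i < n := fun i hi => (heapParent_le t i).trans_lt hi
    -- Nodes outside `S` keep parents outside `S`, so children are counted on the line only.
    have hkids : ∀ g < n, ∀ y, y ≠ f 0 → par y = f g → ∃ k < n, 0 < k ∧ y = f k ∧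
        heapParent t k = g := by
      intro g hg y hy hpy
      have hyS : y ∈ S := by
        by_contra hyS; exact ih2 y hyS (hpy ▸ hf.mem g hg)
      obtain ⟨k, hk, rfl⟩ := hf.surj y hyS
      refine ⟨k, hk, Nat.pos_of_ne_zero (fun h => hy (by rw [h])), rfl, ?_⟩
      exact hf.inj _ (hlt k hk) _ hg (by rw [← ih1 k hk, hpy])
    refine ⟨fun i hi => ?_, fun x hx => ?_⟩
    · unfold lineToTreeStep
      rw [ih1 i hi, ih1 _ (hlt i hi)]
      rcases Nat.eq_zero_or_pos i with rfl | hi0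
      · simp only [heapParent_zero_right, ite_self]
      rcases lt_or_ge t (heapExp i) with h | h
      · obtain ⟨h1, h2, h3⟩ := heapParent_heapParent_of_lt hi0 h
        have hp : 0 < 2 ^ t := by positivity
        rw [if_neg]
        · rw [h2, heapParent, min_eq_left (by omega)]
        -- Still moving: at time `t` the only possible child of the grandparent is the node `2 ^ t`
        -- behind it, so there is room for a second one.
        · rw [not_le, Nat.lt_succ_iff, Set.ncard_le_one (Set.toFinite _)]
          have : ∀ y ∈ {y | y ≠ f 0 ∧ par y = f (heapParent t (heapParent t i))},
              y = f (heapParent t (heapParent t i) + 2 ^ t) := by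
            rintro y ⟨hy0, hy⟩
            obtain ⟨k, hk, hk0, rfl, hkg⟩ := hkids _ (hlt _ (hlt i hi)) y hy0 hy
            rw [eq_of_heapParent_eq hk0 hkg (by rw [h2, pow_succ]; omega)]
          intro a ha b hb
          rw [this a ha, this b hb]
      · have hnew : heapParent (t + 1) i = heapParent t i := by
          rw [heapParent_eq_of_le h, heapParent_eq_of_le (by omega)]
        -- Finished: either the parent is the root, which is its own parent, or the grandparent is
        -- full by `heapParent_full`.
        rcases Nat.eq_zero_or_pos (heapParent t i) with hp | hp
        · rw [hp, heapParent_zero_right, ite_self, hnew, hp]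
        · obtain ⟨g, hg, a, b, hab, ha, hb, hai, hbi, hag, hbg⟩ := heapParent_full hi0 h hp
          rw [if_pos, hnew]
          rw [← hg]
          have : ({f a, f b} : Set V) ⊆ {y | y ≠ f 0 ∧ par y = f g} := by
            have hin : ∀ k, 0 < k → k ≤ i → heapParent t k = g →
                f k ∈ {y | y ≠ f 0 ∧ par y = f g} := by
              intro k hk hki hkg
              refine ⟨fun h => ?_, by rw [ih1 k (by omega), hkg]⟩
              have := hf.inj k (by omega) 0 hf.pos h
              omega
            exact Set.pair_subset (hin a ha hai hag) (hin b hb hbi hbg)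
          rw [← Set.ncard_pair (fun h => hab (hf.inj a (by omega) b (by omega) h) : f a ≠ f b)]
          exact Set.ncard_le_ncard this (Set.toFinite _)
    · unfold lineToTreeStep
      split_ifs
      · exact ih2 x hx
      · exact ih2 _ (ih2 x hx)

lemma graphOfMap_adj {V : Type} (f : V → V) (x y : V) :
    (graphOfMap f).Adj x y ↔ x ≠ y ∧ (f x = y ∨ f y = x) := by
  simp [graphOfMap]

/-- A graph whose nodes are joined to their parents in the heap order is a complete binary tree. -/
lemma isCompleteBinaryTree_of_heap {W : Type} [Finite W] {H : SimpleGraph W} {f : ℕ → W} {n : ℕ}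
    (hf : Enumerates f n Set.univ) {P : W → W}
    (hP : ∀ i < n, P (f i) = f (i - 2 ^ heapExp i))
    (hH : ∀ x y, H.Adj x y ↔ x ≠ y ∧ (P x = y ∨ P y = x)) :
    IsCompleteBinaryTree H (f 0) ∧ (∀ i < n, H.dist (f 0) (f i) = Nat.log 2 (i + 1)) ∧
      IsRootedTreeOfDepth H (f 0) (Nat.log 2 n) := by
  classical
  have hlt : ∀ i, 0 < i → i - 2 ^ heapExp i < i := fun i hi => by
    have : 0 < 2 ^ heapExp i := by positivity
    omega
  have hup : ∀ i < n, 0 < i → H.Adj (f i) (f (i - 2 ^ heapExp i)) := by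
    intro i hi hi0
    rw [hH]
    refine ⟨fun h => ?_, Or.inl (hP i hi)⟩
    have := hf.inj _ hi _ (by have := hlt i hi0; omega) h
    have := hlt i hi0; omega
  have hwalk : ∀ i < n, ∃ w : H.Walk (f 0) (f i), w.length = Nat.log 2 (i + 1) := by
    intro i
    induction i using Nat.strong_induction_on with
    | _ i ih =>
      intro hi
      rcases Nat.eq_zero_or_pos i with rfl | hi0
      · exact ⟨SimpleGraph.Walk.nil, by simp⟩
      · obtain ⟨w, hw⟩ := ih _ (hlt i hi0) (by have := hlt i hi0; omega)
        refine ⟨w.concat (hup i hi hi0).symm, ?_⟩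
        rw [SimpleGraph.Walk.length_concat, hw, log_heapParent hi0]
  -- The level changes by at most one along an edge, so no walk from the root is shorter than the
  -- level of its end.
  have hadj : ∀ x y, H.Adj x y → ∀ i < n, ∀ j < n, f i = x → f j = y →
      Nat.log 2 (j + 1) ≤ Nat.log 2 (i + 1) + 1 := by
    have aux : ∀ i < n, ∀ j < n, f i ≠ f j → P (f i) = f j →
        Nat.log 2 (j + 1) + 1 = Nat.log 2 (i + 1) := by
      intro i hi j hj hne h
      rw [hP i hi] at h
      have hji := hf.inj _ ((Nat.sub_le _ _).trans_lt hi) _ hj h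
      rcases Nat.eq_zero_or_pos i with rfl | hi0
      · exact absurd (by rw [← hji]; simp) hne
      · rw [← hji]; exact log_heapParent hi0
    rintro x y hxy i hi j hj rfl rfl
    rw [hH] at hxy
    rcases hxy.2 with h | h
    · have := aux i hi j hj hxy.1 h; omega
    · have := aux j hj i hi hxy.1.symm h; omega
  have hlow : ∀ x y, ∀ w : H.Walk x y, ∀ i < n, ∀ j < n, f i = x → f j = y →
      Nat.log 2 (j + 1) ≤ Nat.log 2 (i + 1) + w.length := by
    intro x y w
    induction w with
    | nil =>
      rintro i hi j hj rfl h
      rw [hf.inj _ hj _ hi h]; simp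
    | cons h w ih =>
      rintro i hi j hj hx hy
      obtain ⟨k, hk, hkv⟩ := hf.surj _ (Set.mem_univ _)
      have h1 := ih k hk j hj hkv hy
      have h2 := hadj _ _ h i hi k hk hx hkv
      rw [SimpleGraph.Walk.length_cons]; omega
  have hdist : ∀ i < n, H.dist (f 0) (f i) = Nat.log 2 (i + 1) := by
    intro i hi
    obtain ⟨w, hw⟩ := hwalk i hi
    apply le_antisymm
    · rw [← hw]; exact SimpleGraph.dist_le w
    · obtain ⟨p, hp⟩ := w.reachable.exists_walk_length_eq_dist
      have := hlow _ _ p 0 hf.pos i hi rfl rfl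
      rw [← hp]; simpa using this
  have hconn : H.Connected := by
    have hr : ∀ x, H.Reachable (f 0) x := by
      intro x
      obtain ⟨i, hi, rfl⟩ := hf.surj x (Set.mem_univ _)
      exact (hwalk i hi).choose.reachable
    have : Nonempty W := ⟨f 0⟩
    exact ⟨fun x y => (hr x).symm.trans (hr y)⟩
  have hcard : Nat.card W = n := by rw [← hf.ncard_eq, Set.ncard_univ]
  have htree : H.IsTree := by
    rw [SimpleGraph.isTree_iff_connected_and_card]
    refine ⟨hconn, le_antisymm ?_ hconn.card_vert_le_card_edgeSet_add_one⟩
    -- Every edge is the parent edge of some node other than the root, so there are at most `n - 1`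
    -- edges; with connectedness this gives a tree.
    have hsub : H.edgeSet ⊆
        (fun i => s(f i, f (i - 2 ^ heapExp i))) '' (Finset.Ico 1 n : Set ℕ) := by
      intro e
      induction e using Sym2.ind with
      | _ x y =>
        have aux : ∀ x y, x ≠ y → P x = y → s(x, y) ∈
            (fun i => s(f i, f (i - 2 ^ heapExp i))) '' (Finset.Ico 1 n : Set ℕ) := by
          intro x y hne h
          obtain ⟨i, hi, rfl⟩ := hf.surj x (Set.mem_univ _)
          rw [hP i hi] at h
          refine ⟨i, ?_, by simp only [h]⟩
          have : i ≠ 0 := by rintro rfl; exact hne (by simpa using h)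
          simp only [Finset.coe_Ico, Set.mem_Ico]; omega
        intro h
        rw [SimpleGraph.mem_edgeSet, hH] at h
        rcases h.2 with h' | h'
        · exact aux x y h.1 h'
        · rw [Sym2.eq_swap]; exact aux y x h.1.symm h'
    have h1 := Set.ncard_le_ncard hsub (Set.toFinite _)
    have h2 := Set.ncard_image_le (f := fun i => s(f i, f (i - 2 ^ heapExp i)))
      (Finset.Ico 1 n).finite_toSet
    rw [Set.ncard_coe_finset, Nat.card_Ico] at h2
    have h3 : Nat.card H.edgeSet = H.edgeSet.ncard := rfl
    rw [h3, hcard]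
    have := hf.pos
    omega
  refine ⟨⟨htree, fun v => ?_, ?_⟩, hdist, htree, fun v => ?_, ?_⟩
  · obtain ⟨g, hg, rfl⟩ := hf.surj v (Set.mem_univ _)
    have hsub : {w | H.Adj (f g) w ∧ H.dist (f 0) w = H.dist (f 0) (f g) + 1} ⊆
        {f (g + 2 ^ Nat.log 2 (g + 1)), f (g + 2 ^ (Nat.log 2 (g + 1) + 1))} := by
      rintro w ⟨hw1, hw2⟩
      obtain ⟨k, hk, rfl⟩ := hf.surj w (Set.mem_univ _)
      rw [hdist k hk, hdist g hg] at hw2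
      have hk0 : 0 < k := Nat.pos_of_ne_zero (by rintro rfl; simp at hw2)
      rw [hH, hP k hk, hP g hg] at hw1
      rcases hw1.2 with h | h
      · have := hf.inj _ ((Nat.sub_le _ _).trans_lt hg) _ hk h
        have h7 := Nat.sub_le g (2 ^ heapExp g)
        have h4 := Nat.log_mono_right (b := 2) (show k + 1 ≤ g + 1 by omega)
        omega
      · have h5 := hf.inj _ ((Nat.sub_le _ _).trans_lt hk) _ hg h
        have h6 := (heapExp_bounds hk0).1
        rcases log_le_heapExp hk0 h5 with h' | h'
        · left; rw [← h']; congr 1; omega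
        · right; rw [Set.mem_singleton_iff, ← h']; congr 1; omega
    refine (Set.ncard_le_ncard hsub (Set.toFinite _)).trans ?_
    exact (Set.ncard_insert_le _ _).trans (by simp)
  · rintro k ⟨v, hv⟩
    obtain ⟨i, hi, rfl⟩ := hf.surj v (Set.mem_univ _)
    rw [hdist i hi] at hv
    have hbig : 2 ^ (k + 1) ≤ i + 1 := by
      rw [← Nat.le_log_iff_pow_le (by norm_num) (by omega)]; omega
    -- Level `k` consists of the indices with `2 ^ k ≤ i + 1 < 2 ^ (k + 1)`. All of them occur as
    -- soon as a deeper node exists.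
    have hset : {v | H.dist (f 0) v = k} = f '' (Finset.Ico (2 ^ k - 1) (2 ^ (k + 1) - 1) : Set ℕ) := by
      have hp : 0 < 2 ^ k := by positivity
      ext v; constructor
      · intro hvk
        obtain ⟨j, hj, rfl⟩ := hf.surj v (Set.mem_univ _)
        rw [Set.mem_ofPred_eq, hdist j hj, Nat.log_eq_iff (by omega)] at hvk
        refine ⟨j, ?_, rfl⟩
        simp only [Finset.coe_Ico, Set.mem_Ico]; omega
      · rintro ⟨j, hj, rfl⟩
        simp only [Finset.coe_Ico, Set.mem_Ico] at hj
        rw [Set.mem_ofPred_eq, hdist j (by omega), Nat.log_eq_iff (by omega)]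
        omega
    rw [hset, Set.InjOn.ncard_image, Set.ncard_coe_finset, Nat.card_Ico, pow_succ]
    · omega
    · intro a ha b hb hab
      simp only [Finset.coe_Ico, Set.mem_Ico] at ha hb
      exact hf.inj a (by omega) b (by omega) hab
  · obtain ⟨i, hi, rfl⟩ := hf.surj v (Set.mem_univ _)
    rw [hdist i hi]
    exact Nat.log_mono_right (by omega)
  · have := hf.pos
    refine ⟨f (n - 1), ?_⟩
    rw [hdist _ (by omega), Nat.sub_add_cancel (by omega)]

/-! ## Cyclic tours of connected graphs in which successive nodes have distance at most three -/

/-- `y` follows `x` in the cyclic order of the list `l`. -/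
def listNext {α : Type*} (l : List α) (x y : α) : Prop :=
  ∃ i, l[i]? = some x ∧ l[(i + 1) % l.length]? = some y

/-- `y` is the parent of `x` after `t` rounds of LineToCompleteBinaryTree on the line `l`. -/
def listParent {α : Type*} (t : ℕ) (l : List α) (x y : α) : Prop :=
  ∃ i, l[i]? = some x ∧ l[heapParent t i]? = some y

section Tour

variable {V : Type*} (E : V → V → Prop) (S : Set V)

/-- `x` and `y` are joined by at most two edges through a node of `S`. -/
def Near2 (x y : V) : Prop := ∃ w ∈ S, (x = w ∨ E x w) ∧ (w = y ∨ E w y)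

/-- `x` and `y` are joined by at most three edges through nodes of `S`. -/
def Near3 (x y : V) : Prop := ∃ w ∈ S, Near2 E S x w ∧ (w = y ∨ E w y)

variable {E S}

/-- The cube of a connected graph has a Hamiltonian path from any node `a` to a neighbour of `a`.
Split off the component `B` of a neighbour `b` in the complement of `a`, and apply induction to `B`
from `b` and to the rest from `a`. The path of the rest followed by the reverse of the path of `B`
starts at `a` and ends at `b`. -/
lemma exists_hamiltonian_path (hE : ∀ x y, E x y → E y x) (n : ℕ) :
    ∀ (s : Finset V), s.card = n → (s : Set V) ⊆ S → ∀ a ∈ s,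
      (∀ x ∈ s, Relation.ReflTransGen (fun x y => E x y ∧ x ∈ s ∧ y ∈ s) a x) →
      ∃ l : List V, l.Nodup ∧ (∀ y, y ∈ l ↔ y ∈ s) ∧ l.head? = some a ∧
        (∃ z, l.getLast? = some z ∧ (z = a ∨ E z a)) ∧ l.IsChain (Near3 E S) := by
  classical
  induction n using Nat.strong_induction_on with
  | _ n ih =>
    intro s hs hsS a ha hreach
    by_cases hb : ∃ b ∈ s, b ≠ a ∧ E a b
    swap
    · have hone : ∀ x ∈ s, x = a := by
        intro x hx
        induction hreach x hx with
        | refl => rfl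
        | tail h1 h2 ih' =>
          rw [ih' h2.2.1] at h2
          by_contra hne
          exact hb ⟨_, h2.2.2, hne, h2.1⟩
      refine ⟨[a], by simp, fun y => ?_, rfl, ⟨a, rfl, Or.inl rfl⟩, by simp⟩
      rw [List.mem_singleton]
      exact ⟨fun h => h ▸ ha, hone y⟩
    obtain ⟨b, hbs, hba, hab⟩ := hb
    -- The component of `b` after removal of `a`. The remaining set `A` is still connected, since a
    -- path from `a` that has entered `B` can leave it only through `a`.
    set B := s.filter fun x =>
      Relation.ReflTransGen (fun x y => E x y ∧ x ∈ s.erase a ∧ y ∈ s.erase a) b x with hB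
    set A := s \ B with hA
    have hbB : b ∈ B := Finset.mem_filter.2 ⟨hbs, .refl⟩
    have haB : a ∉ B := by
      intro h
      rcases Relation.ReflTransGen.cases_tail (Finset.mem_filter.1 h).2 with h | ⟨_, _, h⟩
      · exact hba h.symm
      · exact absurd h.2.2 (Finset.notMem_erase a s)
    have haA : a ∈ A := Finset.mem_sdiff.2 ⟨ha, haB⟩
    have hBs : B ⊆ s := Finset.filter_subset _ _
    have hAs : A ⊆ s := Finset.sdiff_subset
    have hBreach : ∀ x ∈ B, Relation.ReflTransGen (fun x y => E x y ∧ x ∈ B ∧ y ∈ B) b x := by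
      intro x hx
      have hx2 := (Finset.mem_filter.1 hx).2
      clear hx
      induction hx2 with
      | refl => exact .refl
      | tail h1 h2 ih' =>
        refine ih'.tail ⟨h2.1, Finset.mem_filter.2 ⟨Finset.mem_of_mem_erase h2.2.1, h1⟩,
          Finset.mem_filter.2 ⟨Finset.mem_of_mem_erase h2.2.2, h1.tail h2⟩⟩
    have hAreach : ∀ x ∈ A, Relation.ReflTransGen (fun x y => E x y ∧ x ∈ A ∧ y ∈ A) a x := by
      have : ∀ x ∈ s, x ∈ B ∨
          Relation.ReflTransGen (fun x y => E x y ∧ x ∈ A ∧ y ∈ A) a x ∧ x ∈ A := by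
        intro x hx
        induction hreach x hx with
        | refl => exact Or.inr ⟨.refl, haA⟩
        | @tail y z h1 h2 ih' =>
          by_cases hzB : z ∈ B
          · exact Or.inl hzB
          have hzA : z ∈ A := Finset.mem_sdiff.2 ⟨h2.2.2, hzB⟩
          rcases ih' h2.2.1 with hy | ⟨hy, hyA⟩
          · have hza : z = a := by
              by_contra hza
              apply hzB
              refine Finset.mem_filter.2 ⟨h2.2.2, (Finset.mem_filter.1 hy).2.tail ⟨h2.1, ?_, ?_⟩⟩
              · exact Finset.mem_erase.2 ⟨fun h => haB (h ▸ hy), h2.2.1⟩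
              · exact Finset.mem_erase.2 ⟨hza, h2.2.2⟩
            rw [hza]; exact Or.inr ⟨.refl, haA⟩
          · exact Or.inr ⟨hy.tail ⟨h2.1, hyA, hzA⟩, hzA⟩
      intro x hx
      rcases this x (hAs hx) with h | h
      · exact absurd h (Finset.mem_sdiff.1 hx).2
      · exact h.1
    have hAlt : A.card < n := by
      rw [← hs]; exact Finset.card_lt_card ⟨hAs, fun h => (Finset.mem_sdiff.1 (h hbs)).2 hbB⟩
    have hBlt : B.card < n := by
      rw [← hs]; exact Finset.card_lt_card ⟨hBs, fun h => haB (h ha)⟩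
    obtain ⟨l, hl1, hl2, hl3, ⟨z, hz, hza⟩, hl5⟩ :=
      ih _ hAlt A rfl (fun x hx => hsS (hAs hx)) a haA hAreach
    obtain ⟨m, hm1, hm2, hm3, ⟨w, hw, hwb⟩, hm5⟩ :=
      ih _ hBlt B rfl (fun x hx => hsS (hBs hx)) b hbB hBreach
    have hsymm : ∀ x y, Near3 E S x y → Near3 E S y x := by
      rintro x y ⟨w, hw, ⟨v, hv, h1, h2⟩, h3⟩
      refine ⟨v, hv, ⟨w, hw, ?_, ?_⟩, ?_⟩
      · exact h3.imp Eq.symm (hE _ _)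
      · exact h2.imp Eq.symm (hE _ _)
      · exact h1.imp Eq.symm (hE _ _)
    refine ⟨l ++ m.reverse, ?_, ?_, ?_, ⟨b, ?_, Or.inr (hE _ _ hab)⟩, ?_⟩
    · rw [List.nodup_append]
      refine ⟨hl1, List.nodup_reverse.2 hm1, fun x hx y hy hxy => ?_⟩
      rw [List.mem_reverse, hm2] at hy
      rw [hl2] at hx
      exact (Finset.mem_sdiff.1 hx).2 (hxy ▸ hy)
    · intro y
      rw [List.mem_append, List.mem_reverse, hl2, hm2, hA, Finset.mem_sdiff]
      constructor
      · rintro (h | h)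
        · exact h.1
        · exact hBs h
      · intro h; by_cases hy : y ∈ B
        · exact Or.inr hy
        · exact Or.inl ⟨h, hy⟩
    · rw [List.head?_append, hl3]; rfl
    · rw [List.getLast?_append, List.getLast?_reverse, hm3]; rfl
    · rw [List.isChain_append, List.isChain_reverse]
      refine ⟨hl5, hm5.imp fun x y h => hsymm _ _ h, fun x hx y hy => ?_⟩
      rw [List.head?_reverse, hw] at hy
      rw [hz] at hx
      cases hx; cases hy
      -- At the junction the nodes `z` and `w` are joined by the walk `z, a, b, w`, of at most three
      -- edges.
      exact ⟨b, hsS (hBs hbB), ⟨a, hsS ha, hza.imp id id, Or.inr hab⟩,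
        (hwb.imp Eq.symm (hE _ _))⟩

/-- The Hamiltonian path ends at `a` or next to `a`, so it also closes up to a cycle. -/
lemma exists_tour (hE : ∀ x y, E x y → E y x) (hS : S.Finite) {a : V} (ha : a ∈ S)
    (h : ∀ x ∈ S, Relation.ReflTransGen (fun x y => E x y ∧ x ∈ S ∧ y ∈ S) a x) :
    ∃ l : List V, l.Nodup ∧ (∀ y, y ∈ l ↔ y ∈ S) ∧ l.head? = some a ∧
      ∀ x y, listNext l x y → Near3 E S x y := by
  obtain ⟨l, h1, h2, h3, ⟨z, hz, hza⟩, h5⟩ := exists_hamiltonian_path (S := S) hE _ hS.toFinset rfl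
    (by simp) a (by simpa using ha) (by simpa using h)
  refine ⟨l, h1, by simpa using h2, h3, ?_⟩
  rintro x y ⟨i, hi, hj⟩
  obtain ⟨hil, rfl⟩ := List.getElem?_eq_some_iff.1 hi
  rcases Nat.lt_or_ge (i + 1) l.length with hlt | hge
  · rw [Nat.mod_eq_of_lt hlt, List.getElem?_eq_some_iff] at hj
    obtain ⟨_, rfl⟩ := hj
    exact List.isChain_iff_getElem.1 h5 i hlt
  · have hlen : i + 1 = l.length := by omega
    rw [hlen, Nat.mod_self, ← List.head?_eq_getElem?, h3] at hj
    cases hj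
    have : l[i] = z := by
      rw [List.getLast?_eq_getElem?, List.getElem?_eq_some_iff] at hz
      obtain ⟨_, rfl⟩ := hz
      congr 1; omega
    rw [this]
    have hzS : z ∈ S := by rw [← this]; simpa using (h2 l[i]).1 (List.getElem_mem _)
    exact ⟨z, hzS, ⟨z, hzS, Or.inl rfl, Or.inl rfl⟩, hza⟩

end Tour

/-! ## Euler tours of rooted forests -/

section Euler

variable {V : Type*}

/-- Every node reaches a root, which is its own parent. -/
def IsForest (p : V → V) : Prop := ∀ x, ∃ k, p (p^[k] x) = p^[k] x

/-- The number of steps to the root. -/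
noncomputable def treeDepth (p : V → V) (x : V) : ℕ := sInf {k | p (p^[k] x) = p^[k] x}

/-- The root of the tree of a node. -/
noncomputable def treeRoot (p : V → V) (x : V) : V := p^[treeDepth p x] x

variable {p : V → V}

lemma IsForest.parent_root (hp : IsForest p) (x : V) : p (treeRoot p x) = treeRoot p x :=
  Nat.sInf_mem (hp x)

lemma treeDepth_of_fixed {x : V} (h : p x = x) : treeDepth p x = 0 := by
  have : (0 : ℕ) ∈ {k | p (p^[k] x) = p^[k] x} := h
  exact Nat.le_zero.1 (Nat.sInf_le this)

lemma treeRoot_of_fixed {x : V} (h : p x = x) : treeRoot p x = x := by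
  simp [treeRoot, treeDepth_of_fixed h]

lemma IsForest.depth_parent (hp : IsForest p) {x : V} (h : p x ≠ x) :
    treeDepth p x = treeDepth p (p x) + 1 := by
  have h1 : p (p^[treeDepth p x] x) = p^[treeDepth p x] x := Nat.sInf_mem (hp x)
  have h2 : p (p^[treeDepth p (p x)] (p x)) = p^[treeDepth p (p x)] (p x) :=
    Nat.sInf_mem (hp (p x))
  apply le_antisymm
  · apply Nat.sInf_le
    simpa only [Set.mem_ofPred_eq, Function.iterate_succ_apply] using h2
  · rcases hd : treeDepth p x with _ | k
    · rw [hd] at h1; exact absurd h1 h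
    · rw [hd, Function.iterate_succ_apply] at h1
      have : treeDepth p (p x) ≤ k := Nat.sInf_le h1
      omega

lemma IsForest.root_parent (hp : IsForest p) (x : V) : treeRoot p (p x) = treeRoot p x := by
  by_cases h : p x = x
  · rw [h]
  · unfold treeRoot
    rw [hp.depth_parent h, Function.iterate_succ_apply]

lemma IsForest.root_root (hp : IsForest p) (x : V) : treeRoot p (treeRoot p x) = treeRoot p x :=
  treeRoot_of_fixed (hp.parent_root x)

lemma IsForest.induction (hp : IsForest p) {P : V → Prop} (h0 : ∀ x, p x = x → P x)
    (h1 : ∀ x, p x ≠ x → P (p x) → P x) (x : V) : P x := by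
  induction hd : treeDepth p x generalizing x with
  | zero =>
    apply h0
    have := hp.parent_root x
    rwa [treeRoot, hd] at this
  | succ d ih =>
    have hne : p x ≠ x := fun h => by rw [treeDepth_of_fixed h] at hd; omega
    exact h1 x hne (ih _ (by have := hp.depth_parent hne; omega))

/-- The children of a node. -/
def treeKids (p : V → V) (x : V) : Set V := {c | c ≠ x ∧ p c = x}

variable [LinearOrder V]

/-- The nodes `y` such that the Euler tour that enters (`b = false`) or leaves (`b = true`) the
subtree of `x` next enters (`b' = false`) or leaves (`b' = true`) the subtree of `y`. -/
def eulerNext (p : V → V) (x : V) : Bool → Bool → Set V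
  | false, false => {c | IsLeast (treeKids p x) c}
  | false, true => {y | y = x ∧ treeKids p x = ∅}
  | true, false => {c | (p x ≠ x ∧ IsLeast {c ∈ treeKids p (p x) | x < c} c) ∨ (c = x ∧ p x = x)}
  | true, true => {q | q = p x ∧ p x ≠ x ∧ {c ∈ treeKids p (p x) | x < c} = ∅}

/-- One step of the Euler tour. -/
def EulerStep (p : V → V) (w w' : V × Bool) : Prop := w'.1 ∈ eulerNext p w.1 w.2 w'.2

/-- Each position has one possible predecessor. The subtree of `c` is entered from the parent if `c`
is its least child, otherwise from the preceding sibling; a root is entered after leaving itself.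
The subtree of `c` is left after its greatest child, or after entering `c` if there is none. -/
lemma EulerStep.injective {w₁ w₂ w : V × Bool} (h1 : EulerStep p w₁ w) (h2 : EulerStep p w₂ w) :
    w₁ = w₂ := by
  obtain ⟨x, b⟩ := w₁
  obtain ⟨y, b'⟩ := w₂
  obtain ⟨c, e⟩ := w
  cases e <;> cases b <;> cases b' <;>
    simp only [EulerStep, eulerNext, treeKids, IsLeast, mem_lowerBounds, Set.mem_ofPred_eq,
      Set.eq_empty_iff_forall_notMem, Prod.mk.injEq, and_true, reduceCtorEq, and_false] at h1 h2 ⊢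
  · rw [← h1.1.2, ← h2.1.2]
  · rcases h2 with ⟨hy, ⟨⟨h3, h4⟩, h5⟩, h6⟩ | ⟨h3, h4⟩
    · exact absurd (h1.2 y ⟨by rw [← h1.1.2, h4]; exact Ne.symm hy, by rw [← h1.1.2, h4]⟩)
        (not_le.2 h5)
    · rw [h3] at h1; exact absurd (h4 ▸ h1.1.2) h1.1.1
  · rcases h1 with ⟨hy, ⟨⟨h3, h4⟩, h5⟩, h6⟩ | ⟨h3, h4⟩
    · exact absurd (h2.2 x ⟨by rw [← h2.1.2, h4]; exact Ne.symm hy, by rw [← h2.1.2, h4]⟩)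
        (not_le.2 h5)
    · rw [h3] at h2; exact absurd (h4 ▸ h2.1.2) h2.1.1
  · rcases h1 with ⟨hx, ⟨⟨h3, h4⟩, h5⟩, h6⟩ | ⟨h3, h4⟩ <;>
      rcases h2 with ⟨hy, ⟨⟨h3', h4'⟩, h5'⟩, h6'⟩ | ⟨h3', h4'⟩
    · have hxy : p x = p y := by rw [← h4, ← h4']
      rcases lt_trichotomy x y with h | h | h
      · exact absurd (h6 y ⟨⟨hxy ▸ hy.symm, hxy.symm⟩, h⟩) (not_le.2 h5')
      · exact h
      · exact absurd (h6' x ⟨⟨hxy ▸ hx.symm, hxy⟩, h⟩) (not_le.2 h5)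
    · rw [h3', h4'] at h4; rw [h3'] at h3; exact absurd h4 h3
    · rw [h3, h4] at h4'; rw [h3] at h3'; exact absurd h4' h3'
    · rw [← h3, ← h3']
  · rw [← h1.1, ← h2.1]
  · exact absurd ⟨by rw [h1.1.symm, h2.1]; exact h2.2.1.symm, by rw [← h1.1, h2.1]⟩ (h1.2 y)
  · exact absurd ⟨by rw [h2.1.symm, h1.1]; exact h1.2.1.symm, by rw [← h2.1, h1.1]⟩ (h2.2 x)
  · have hxy : p x = p y := by rw [← h1.1, ← h2.1]
    rcases lt_trichotomy x y with h | h | h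
    · exact absurd ⟨⟨by rw [hxy]; exact h2.2.1.symm, hxy.symm⟩, h⟩ (h1.2.2 y)
    · exact h
    · exact absurd ⟨⟨by rw [← hxy]; exact h1.2.1.symm, hxy⟩, h⟩ (h2.2.2 x)

lemma EulerStep.unique {w w₁ w₂ : V × Bool} (h1 : EulerStep p w w₁) (h2 : EulerStep p w w₂) :
    w₁ = w₂ := by
  obtain ⟨x, b⟩ := w
  obtain ⟨y, e⟩ := w₁
  obtain ⟨z, e'⟩ := w₂
  have hne : ∀ {s : Set V} {c}, IsLeast s c → s ≠ ∅ := fun h => Set.nonempty_iff_ne_empty.1 ⟨_, h.1⟩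
  cases b <;> cases e <;> cases e' <;>
    simp only [EulerStep, eulerNext, Set.mem_ofPred_eq, Prod.mk.injEq, and_true, reduceCtorEq,
      and_false] at h1 h2 ⊢
  · exact h1.unique h2
  · exact hne h1 h2.2
  · exact hne h2 h1.2
  · rw [h1.1, h2.1]
  · rcases h1 with h1 | h1 <;> rcases h2 with h2 | h2
    · exact h1.2.unique h2.2
    · exact absurd h2.2 h1.1
    · exact absurd h1.2 h2.1
    · rw [h1.1, h2.1]
  · rcases h1 with h1 | h1
    · exact hne h1.2 h2.2.2
    · exact h2.2.1 h1.2
  · rcases h2 with h2 | h2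
    · exact hne h2.2 h1.2.2
    · exact h1.2.1 h2.2
  · rw [h1.1, h2.1]

variable [Finite V]

lemma exists_isLeast {s : Set V} (h : s ≠ ∅) : ∃ c, IsLeast s c := by
  obtain ⟨c, hc⟩ := s.toFinite.exists_minimal (Set.nonempty_iff_ne_empty.2 h)
  exact ⟨c, hc.1, fun y hy => (le_total c y).elim id fun h => hc.2 hy h⟩

lemma exists_isGreatest {s : Set V} (h : s ≠ ∅) : ∃ c, IsGreatest s c := by
  obtain ⟨c, hc⟩ := s.toFinite.exists_maximal (Set.nonempty_iff_ne_empty.2 h)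
  exact ⟨c, hc.1, fun y hy => (le_total y c).elim id fun h => hc.2 hy h⟩

lemma exists_eulerStep (p : V → V) (w : V × Bool) : ∃ w', EulerStep p w w' := by
  obtain ⟨x, b⟩ := w
  cases b
  · by_cases h : treeKids p x = ∅
    · exact ⟨(x, true), rfl, h⟩
    · obtain ⟨c, hc⟩ := exists_isLeast h
      exact ⟨(c, false), hc⟩
  · by_cases hx : p x = x
    · exact ⟨(x, false), Or.inr ⟨rfl, hx⟩⟩
    by_cases h : {c ∈ treeKids p (p x) | x < c} = ∅
    · exact ⟨(p x, true), rfl, hx, h⟩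
    · obtain ⟨c, hc⟩ := exists_isLeast h
      exact ⟨(c, false), Or.inl ⟨hx, hc⟩⟩

/-- The Euler tour as a permutation. -/
noncomputable def eulerPerm (p : V → V) : Equiv.Perm (V × Bool) :=
  Equiv.ofBijective (fun w => (exists_eulerStep p w).choose) <| by
    rw [← Finite.injective_iff_bijective]
    intro w₁ w₂ h
    have h1 := (exists_eulerStep p w₁).choose_spec
    have h2 := (exists_eulerStep p w₂).choose_spec
    simp only at h
    rw [← h] at h2
    exact h1.injective h2

lemma eulerStep_iff {w w' : V × Bool} : EulerStep p w w' ↔ eulerPerm p w = w' := by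
  have h : EulerStep p w (eulerPerm p w) := (exists_eulerStep p w).choose_spec
  exact ⟨fun h' => h.unique h', fun h' => h' ▸ h⟩

/-- The tour stays in the subtree of `x` between entering and leaving it, and on the way it enters
and leaves every child. -/
lemma IsForest.euler_kids (hp : IsForest p) (x : V) :
    Relation.ReflTransGen (EulerStep p) (x, false) (x, true) ∧
    ∀ c ∈ treeKids p x, Relation.ReflTransGen (EulerStep p) (x, false) (c, false) ∧
      Relation.ReflTransGen (EulerStep p) (c, true) (x, true) := by
  obtain ⟨N, hN⟩ : ∃ N, ∀ y, treeDepth p y ≤ N := by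
    obtain ⟨N, hN⟩ := (Set.finite_range (treeDepth p)).bddAbove
    exact ⟨N, fun y => hN ⟨y, rfl⟩⟩
  -- Induction from the deepest nodes upwards; `N` bounds all depths.
  induction hm : N - treeDepth p x using Nat.strong_induction_on generalizing x with
  | _ m ih =>
    subst hm
    have hdeep : ∀ c ∈ treeKids p x, Relation.ReflTransGen (EulerStep p) (c, false) (c, true) := by
      rintro c ⟨hcx, hpc⟩
      have := hp.depth_parent (x := c) (by rw [hpc]; exact hcx.symm)
      rw [hpc] at this
      have h2 := hN c
      exact (ih (N - treeDepth p c) (by omega) c rfl).1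
    have hpx : ∀ c ∈ treeKids p x, p c = x ∧ p c ≠ c := fun c hc => ⟨hc.2, by
      rw [hc.2]; exact hc.1.symm⟩
    -- Children are visited in increasing order: `c` is entered directly from `x`, or after its
    -- preceding sibling `d` has been left.
    have hdown : ∀ c, c ∈ treeKids p x →
        Relation.ReflTransGen (EulerStep p) (x, false) (c, false) := by
      intro c
      induction c using WellFoundedLT.induction with
      | _ c ihc =>
        intro hc
        by_cases hl : {d ∈ treeKids p x | d < c} = ∅
        · refine .single (show IsLeast _ _ from ⟨hc, fun d hd => ?_⟩)
          by_contra hlt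
          exact Set.eq_empty_iff_forall_notMem.1 hl d ⟨hd, not_le.1 hlt⟩
        · obtain ⟨d, ⟨hd, hdc⟩, hdmax⟩ := exists_isGreatest hl
          refine ((ihc d hdc hd).trans (hdeep d hd)).tail (Or.inl ⟨(hpx d hd).2, ?_⟩)
          simp only [(hpx d hd).1]
          refine ⟨⟨hc, hdc⟩, fun e he => ?_⟩
          by_contra hlt
          exact absurd (hdmax ⟨he.1, not_le.1 hlt⟩) (not_le.2 he.2)
    have hup : ∀ c, c ∈ treeKids p x →
        Relation.ReflTransGen (EulerStep p) (c, true) (x, true) := by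
      intro c
      induction c using WellFoundedGT.induction with
      | _ c ihc =>
        intro hc
        by_cases hl : {d ∈ treeKids p x | c < d} = ∅
        · refine .single ⟨(hpx c hc).1.symm, (hpx c hc).2, ?_⟩
          simp only [(hpx c hc).1, hl]
        · obtain ⟨d, hd⟩ := exists_isLeast hl
          refine .head (b := (d, false)) (Or.inl ⟨(hpx c hc).2, ?_⟩)
            ((hdeep d hd.1.1).trans (ihc d hd.1.2 hd.1.1))
          simp only [(hpx c hc).1, hd]
    refine ⟨?_, fun c hc => ⟨hdown c hc, hup c hc⟩⟩
    by_cases h : treeKids p x = ∅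
    · exact .single ⟨rfl, h⟩
    · obtain ⟨c, hc⟩ := exists_isLeast h
      exact ((hdown c hc.1).trans (hdeep c hc.1)).trans (hup c hc.1)

/-- A step stays within the tree, and every position is reached from the entry of the root, by
descending along `euler_kids`. -/
lemma IsForest.eulerPerm_isCycleOn (hp : IsForest p) (r : V) :
    (eulerPerm p).IsCycleOn {w | treeRoot p w.1 = r} := by
  have hstep : ∀ w w', EulerStep p w w' → treeRoot p w'.1 = treeRoot p w.1 := by
    have hk : ∀ c x, c ∈ treeKids p x → treeRoot p c = treeRoot p x := fun c x h => by
      rw [← h.2, hp.root_parent]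
    rintro ⟨x, b⟩ ⟨y, e⟩ h
    cases b <;> cases e
    · exact hk _ _ h.1
    · rw [show y = x from h.1]
    · rcases h with h | h
      · rw [hk _ _ h.2.1.1, hp.root_parent]
      · rw [show y = x from h.1]
    · rw [show y = p x from h.1, hp.root_parent]
  have hsc : ∀ w w', Relation.ReflTransGen (EulerStep p) w w' → (eulerPerm p).SameCycle w w' := by
    intro w w' h
    induction h with
    | refl => exact .refl _ _
    | tail _ h ih =>
      rw [eulerStep_iff] at h
      rw [← h, Equiv.Perm.sameCycle_apply_right]; exact ih
  have hroot : ∀ x, Relation.ReflTransGen (EulerStep p) (treeRoot p x, false) (x, false) ∧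
      Relation.ReflTransGen (EulerStep p) (treeRoot p x, false) (x, true) := by
    intro x
    induction x using hp.induction with
    | h0 x h => rw [treeRoot_of_fixed h]; exact ⟨.refl, (hp.euler_kids x).1⟩
    | h1 x h ih =>
      rw [hp.root_parent] at ih
      have := ih.1.trans ((hp.euler_kids (p x)).2 x ⟨h.symm, rfl⟩).1
      exact ⟨this, this.trans (hp.euler_kids x).1⟩
  have hall : ∀ w : V × Bool, (eulerPerm p).SameCycle (treeRoot p w.1, false) w := by
    rintro ⟨x, b⟩
    cases b
    · exact hsc _ _ (hroot x).1
    · exact hsc _ _ (hroot x).2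
  refine ⟨⟨?_, (eulerPerm p).injective.injOn, ?_⟩, ?_⟩
  · intro w hw
    rw [Set.mem_ofPred_eq, hstep w _ (eulerStep_iff.2 rfl)]; exact hw
  · intro w hw
    refine ⟨(eulerPerm p).symm w, ?_, by simp⟩
    rw [Set.mem_ofPred_eq, ← hstep _ w (eulerStep_iff.2 (by simp))]; exact hw
  · intro w hw w' hw'
    have h1 := hall w
    have h2 := hall w'
    rw [show treeRoot p w.1 = r from hw] at h1
    rw [show treeRoot p w'.1 = r from hw'] at h2
    exact h1.symm.trans h2

end Euler

/-! ## The algorithm -/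

/-- The kinds of facts that a node knows about a node. -/
inductive Tag where
  /-- the label of the node is known -/
  | pres
  /-- neighbours in the initial graph -/
  | nbr
  /-- the leader of the committee -/
  | ldr
  /-- the successor on the ring -/
  | succ
  /-- the predecessor on the ring -/
  | pred
  /-- the parent in the tree -/
  | par
  /-- nonempty if the committee is merging -/
  | busy
  /-- the committee that is selected -/
  | tgt
  /-- the parent in the forest that joins the committees that are merging -/
  | up
  /-- nonempty if the node has terminated -/
  | halt
  /-- the next node of the Euler tour of the forest -/
  | next (b b' : Bool)

/-- What is known about every node. -/
abbrev Know (α : Type*) := α → Tag → Set α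

namespace Know

variable {α : Type*}

/-- The committee of `x`, as its ring. -/
def comm (M : Know α) (x : α) : Set α := {y | Relation.ReflTransGen (fun a b => b ∈ M a .succ) x y}

/-- The leaders of the candidates of the committee of `x`. -/
def cand [LT α] (M : Know α) (x : α) : Set α :=
  {u | ∃ z ∈ M.comm x, ∃ y ∈ M z .nbr, M y .busy = ∅ ∧ u ∈ M y .ldr ∧ ∃ w ∈ M x .ldr, w < u}

/-- The candidate with the greatest UID. -/
def target [Preorder α] (M : Know α) (x : α) : Set α := {u | M x .busy = ∅ ∧ IsGreatest (M.cand x) u}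

/-- The committee of `x` has no neighbouring committee. -/
def Alone (M : Know α) (x : α) : Prop :=
  M x .busy = ∅ ∧ ∀ z ∈ M.comm x, ∀ y ∈ M z .nbr, M y .ldr = M x .ldr

/-- The committee of `x` is selected by a neighbouring committee. -/
def Selected (M : Know α) (x : α) : Prop :=
  ∃ z ∈ M.comm x, ∃ y ∈ M z .nbr, ∃ u ∈ M x .ldr, u ∈ M y .tgt

/-- The neighbours of `x` in the committee that its committee has selected. -/
def gates (M : Know α) (x : α) : Set α :=
  {y | y ∈ M x .nbr ∧ M y .busy = ∅ ∧ ∃ v ∈ M x .tgt, v ∈ M y .ldr}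

/-- The committee of `x` is attached to the committee that it has selected by an edge at `x`. -/
def IsPort [LE α] (M : Know α) (x : α) : Prop :=
  IsGreatest {a | a ∈ M.comm x ∧ (M.gates a).Nonempty} x

/-- The parent of `x` in the forest that joins the committees that are merging. -/
def upward [LE α] (M : Know α) (x : α) : Set α :=
  {y | (M.IsPort x ∧ IsGreatest (M.gates x) y) ∨
    (¬ M.IsPort x ∧ (M x .tgt = ∅ ∧ x ∈ M x .ldr) ∧ y = x) ∨
    (¬ M.IsPort x ∧ ¬ (M x .tgt = ∅ ∧ x ∈ M x .ldr) ∧ y ∈ M x .pred)}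

/-- The children of `x` in that forest. -/
def kids (M : Know α) (x : α) : Set α := {c | c ≠ x ∧ (c ∈ M x .nbr ∨ c ∈ M x .succ) ∧ x ∈ M c .up}

/-- The successors of `x` on the Euler tour of that forest. -/
def tourNext [LT α] [LE α] (M : Know α) (x : α) : Bool → Bool → Set α
  | false, false => {c | IsLeast (M.kids x) c}
  | false, true => {y | y = x ∧ M.kids x = ∅}
  | true, false =>
      {c | (∃ p ∈ M x .up, p ≠ x ∧ IsLeast {c | c ∈ M.kids p ∧ x < c} c) ∨ (c = x ∧ x ∈ M x .up)}
  | true, true => {p | p ∈ M x .up ∧ p ≠ x ∧ {c | c ∈ M.kids p ∧ x < c} = ∅}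

/-- One step of the Euler tour, as far as it is known. -/
def TourStep (M : Know α) (w w' : α × Bool) : Prop := w'.1 ∈ M w.1 (.next w.2 w'.2)

/-- `n` steps of the Euler tour. -/
def TourWalk (M : Know α) : ℕ → α × Bool → α × Bool → Prop
  | 0, w, w' => w = w'
  | n + 1, w, w' => ∃ v, M.TourStep w v ∧ M.TourWalk n v w'

/-- The nodes `n` steps away from `x` on the Euler tour. -/
def jumps (M : Know α) (n : ℕ) (x : α) : Set α := {y | ∃ b b', M.TourWalk n (x, b) (y, b')}

/-- The nodes of the Euler tour of `x`. -/
def group (M : Know α) (x : α) : Set α :=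
  {y | ∃ b, Relation.ReflTransGen M.TourStep (x, false) (y, b)}

/-- The Euler tour of `x` is completely known and has at most `2 ^ j` nodes. -/
def Small (M : Know α) (j : ℕ) (x : α) : Prop :=
  -- The middle clause recognises an incomplete view: a node of which nothing has been heard has an
  -- empty label, and the known part of the tour stops there.
  M x .busy ≠ ∅ ∧ (∀ y ∈ M.group x, M y .pres ≠ ∅) ∧ (M.group x).ncard ≤ 2 ^ j

/-- Adjacency in the forest. -/
def Link (M : Know α) (x y : α) : Prop := y ∈ M x .up ∨ x ∈ M y .up

/-- The list `l` is a ring on the nodes of the Euler tour of `x` that starts at the root, such that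
successive nodes have distance at most three in the forest. -/
def IsTour (M : Know α) (x : α) (l : List α) : Prop :=
  l.Nodup ∧ (∀ y, y ∈ l ↔ y ∈ M.group x) ∧ (∃ r, l.head? = some r ∧ r ∈ M r .up) ∧
    ∀ y z, listNext l y z → Near3 M.Link (M.group x) y z

/-- The lexicographically least such list. -/
def LeastTour [LT α] (M : Know α) (x : α) (l : List α) : Prop :=
  M.IsTour x l ∧ ∀ l', M.IsTour x l' → ¬ l' < l

/-- The nodes joined to `x` between two stages. -/
def base (M : Know α) (x : α) : Set α := M x .nbr ∪ M x .succ ∪ M x .par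

end Know

/-- The stages of the schedule. -/
inductive Stage where
  | setup
  | select (j : ℕ)
  | join (j : ℕ)
  | order (j : ℕ)
  | merge (j : ℕ)

namespace Stage

/-- The number of rounds of a stage. -/
def len : Stage → ℕ
  | setup => 1
  -- Two nodes of a committee of depth at most `j` are at most `2 * j` apart, and its neighbours are
  -- one edge farther. A merging stage consists of `j + 1` doublings, one round of shortcuts, and `j
  -- + 2` rounds for the states `t = 0, …, j + 1` of the line.
  | select j => 2 * j + 2
  | join j => 2 * j + 2
  | order _ => 2
  | merge j => 2 * j + 4

/-- The next stage. -/
def following : Stage → Stage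
  | setup => select 0
  | select j => join j
  | join j => order j
  | order j => merge j
  | merge j => select (j + 1)

end Stage

open Classical in
/-- The nodes that `x` wants to be joined to after round `τ` of a stage. -/
def Know.want {α : Type*} [LinearOrder α] (M : Know α) : Stage → ℕ → α → Set α
  | .setup, _, x => {y | y ≠ x ∧ y ∈ M y .pres}
  | .select j, τ, x => if τ + 1 = (Stage.select j).len ∧ M.Alone x then M x .par else M.base x
  | .join _, _, x => M.base x
  | .order _, _, x => M.base x
  -- The rounds `τ ≤ j` double along the Euler tour; round `j + 1` joins nodes two forest edges
  -- apart; from round `j + 2` on only initial edges, the new ring and the current line remain.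
  -- Trees that are not small fall back to their old edges.
  | .merge j, τ, x =>
      if τ < j + 1 then
        if M x .busy = ∅ then M.base x else M.base x ∪ M.jumps (2 ^ τ) x
      else if ¬ M.Small j x then M.base x
      else if τ = j + 1 then M.base x ∪ {y | y ∈ M.group x ∧ Near2 M.Link (M.group x) x y}
      else M x .nbr ∪
        {y | ∃ l, M.LeastTour x l ∧ (listNext l x y ∨ listParent (τ - (j + 2)) l x y)}

open Classical in
/-- The label of `x` after a stage. -/
def Know.label {α : Type*} [LinearOrder α] (M : Know α) : Stage → α → Tag → Set α
  | .setup, x, .nbr => {y | y ≠ x ∧ y ∈ M y .pres}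
  | .setup, x, .pres => {x}
  | .setup, x, .ldr => {x}
  | .setup, x, .succ => {x}
  | .setup, x, .pred => {x}
  | .setup, x, .par => {x}
  | .setup, x, .up => {x}
  | .setup, _, _ => ∅
  | .select _, x, .tgt => M.target x
  | .select _, x, .halt => {y | y = x ∧ M.Alone x}
  | .select _, x, t => M x t
  | .join _, x, .busy =>
      {y | y ∈ M x .busy ∨ (M x .busy = ∅ ∧ y = x ∧ ((M x .tgt).Nonempty ∨ M.Selected x))}
  | .join _, x, .up => if M x .busy = ∅ then M.upward x else M x .up
  | .join _, _, .tgt => ∅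
  | .join _, x, t => M x t
  | .order _, x, .next b b' => M.tourNext x b b'
  | .order _, x, t => M x t
  | .merge _, _, .next _ _ => ∅
  | .merge _, x, .pres => M x .pres
  | .merge _, x, .nbr => M x .nbr
  | .merge _, x, .tgt => M x .tgt
  | .merge _, x, .halt => M x .halt
  | .merge j, x, .ldr =>
      if M.Small j x then {y | ∃ l, M.LeastTour x l ∧ l.head? = some y} else M x .ldr
  | .merge j, x, .succ =>
      if M.Small j x then {y | ∃ l, M.LeastTour x l ∧ listNext l x y} else M x .succ
  | .merge j, x, .pred =>
      if M.Small j x then {y | ∃ l, M.LeastTour x l ∧ listNext l y x} else M x .pred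
  | .merge j, x, .par =>
      if M.Small j x then {y | ∃ l, M.LeastTour x l ∧ listParent (j + 1) l x y} else M x .par
  | .merge j, x, .busy => if M.Small j x then ∅ else M x .busy
  | .merge j, x, .up => if M.Small j x then {x} else M x .up

/-- The state of a node: its UID, the stage, the number of rounds since its beginning, and what the
node knows. -/
structure NodeState where
  me : ℕ
  stage : Stage
  time : ℕ
  know : Know ℕ

/-- What a node knows after having received the messages of a round. -/
def NodeState.merged (s : NodeState) (I : Set (ℕ × Know ℕ)) : Know ℕ :=
  fun z t => {y | y ∈ s.know z t ∨ ∃ p ∈ I, y ∈ p.2 z t}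

open Classical in
/-- The algorithm. -/
noncomputable def graphToWreath : Algorithm where
  State := NodeState
  Msg := Know ℕ
  init x := ⟨x, .setup, 0, fun z t => {y | z = x ∧ t = .pres ∧ y = x}⟩
  send s _ := some s.know
  activate s I := (s.merged I).want s.stage s.time s.me
  deactivate s I := {y | (∃ p ∈ I, p.1 = y) ∧ y ∉ (s.merged I).want s.stage s.time s.me}
  update s I :=
    if s.time + 1 = s.stage.len then
      ⟨s.me, s.stage.following, 0,
        fun z t => {y | z = s.me ∧ y ∈ (s.merged I).label s.stage s.me t}⟩
    else ⟨s.me, s.stage, s.time + 1, s.merged I⟩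
  halted s := s.me ∈ s.know s.me .halt
  status s := if s.me ∈ s.know s.me .ldr then .leader else .follower

/-! ## Renaming and locality -/

section Images

variable {α β : Type*} [LinearOrder α] [LinearOrder β] (ι : α ↪o β)

/-- Agreement of the two relations is needed only at nodes reachable from `x`; this lets committees
and tours be compared when only they are covered. -/
lemma reflTransGen_image {α β : Type*} {f : α → β} {R : α → α → Prop} {R' : β → β → Prop} {x : α}
    (h : ∀ y, Relation.ReflTransGen R x y → ∀ z, R' (f y) z ↔ ∃ y', R y y' ∧ f y' = z) (z : β) :
    Relation.ReflTransGen R' (f x) z ↔ ∃ y, Relation.ReflTransGen R x y ∧ f y = z := by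
  constructor
  · intro hz
    induction hz with
    | refl => exact ⟨x, .refl, rfl⟩
    | tail _ h2 ih =>
      obtain ⟨y, hy, rfl⟩ := ih
      obtain ⟨y', hy', rfl⟩ := (h y hy _).1 h2
      exact ⟨y', hy.tail hy', rfl⟩
  · rintro ⟨y, hy, rfl⟩
    induction hy with
    | refl => exact .refl
    | tail h1 h2 ih => exact ih.tail ((h _ h1 _).2 ⟨_, h2, rfl⟩)

lemma isGreatest_image {s : Set α} {z : β} :
    IsGreatest (ι '' s) z ↔ ∃ y, IsGreatest s y ∧ ι y = z := by
  constructor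
  · rintro ⟨⟨y, hy, rfl⟩, h⟩
    exact ⟨y, ⟨hy, fun w hw => ι.le_iff_le.1 (h ⟨w, hw, rfl⟩)⟩, rfl⟩
  · rintro ⟨y, ⟨hy, h⟩, rfl⟩
    exact ⟨⟨y, hy, rfl⟩, by rintro _ ⟨w, hw, rfl⟩; exact ι.le_iff_le.2 (h hw)⟩

lemma isLeast_image {s : Set α} {z : β} :
    IsLeast (ι '' s) z ↔ ∃ y, IsLeast s y ∧ ι y = z := by
  constructor
  · rintro ⟨⟨y, hy, rfl⟩, h⟩
    exact ⟨y, ⟨hy, fun w hw => ι.le_iff_le.1 (h ⟨w, hw, rfl⟩)⟩, rfl⟩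
  · rintro ⟨y, ⟨hy, h⟩, rfl⟩
    exact ⟨⟨y, hy, rfl⟩, by rintro _ ⟨w, hw, rfl⟩; exact ι.le_iff_le.2 (h hw)⟩

lemma mem_image_iff {s : Set α} {y : α} : ι y ∈ ι '' s ↔ y ∈ s := ι.injective.mem_set_image

/-- This makes the choice of the lexicographically least tour comparison based. -/
lemma list_map_lt_map_iff {l m : List α} : l.map ι < m.map ι ↔ l < m := by
  induction l generalizing m with
  | nil => cases m <;> simp
  | cons a l ih => cases m with
    | nil => simp
    | cons b m => simp [List.cons_lt_cons_iff, ih]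

lemma listNext_map {l : List α} {x : α} {z : β} :
    listNext (l.map ι) (ι x) z ↔ ∃ y, listNext l x y ∧ ι y = z := by
  simp only [listNext, List.getElem?_map, List.length_map, Option.map_eq_some_iff]
  constructor
  · rintro ⟨i, ⟨a, ha, hax⟩, b, hb, rfl⟩
    rw [ι.injective hax] at ha
    exact ⟨b, ⟨i, ha, hb⟩, rfl⟩
  · rintro ⟨b, ⟨i, ha, hb⟩, rfl⟩
    exact ⟨i, ⟨x, ha, rfl⟩, b, hb, rfl⟩

lemma listNext_map' {l : List α} {x : α} {z : β} :
    listNext (l.map ι) z (ι x) ↔ ∃ y, listNext l y x ∧ ι y = z := by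
  simp only [listNext, List.getElem?_map, List.length_map, Option.map_eq_some_iff]
  constructor
  · rintro ⟨i, ⟨a, ha, rfl⟩, b, hb, hbx⟩
    rw [ι.injective hbx] at hb
    exact ⟨a, ⟨i, ha, hb⟩, rfl⟩
  · rintro ⟨a, ⟨i, ha, hb⟩, rfl⟩
    exact ⟨i, ⟨a, ha, rfl⟩, x, hb, rfl⟩

lemma listParent_map {t : ℕ} {l : List α} {x : α} {z : β} :
    listParent t (l.map ι) (ι x) z ↔ ∃ y, listParent t l x y ∧ ι y = z := by
  simp only [listParent, List.getElem?_map, Option.map_eq_some_iff]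
  constructor
  · rintro ⟨i, ⟨a, ha, hax⟩, b, hb, rfl⟩
    rw [ι.injective hax] at ha
    exact ⟨b, ⟨i, ha, hb⟩, rfl⟩
  · rintro ⟨b, ⟨i, ha, hb⟩, rfl⟩
    exact ⟨i, ⟨x, ha, rfl⟩, b, hb, rfl⟩

end Images

/-! ### Locality: the actions of a node depend only on the labels that it needs -/

namespace Know

variable {α β : Type*}

/-- `M'` is what `M` says about the nodes in `S`, renamed by `ι`. -/
structure Agree (ι : α → β) (S : Set α) (M : Know α) (M' : Know β) : Prop where
  eq : ∀ x ∈ S, ∀ t, M' (ι x) t = ι '' M x t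
  empty : ∀ z, z ∉ ι '' S → ∀ t, M' z t = ∅

/-- The set `S` contains the committee of `x` and all neighbours of its nodes. -/
def CommCovered (M : Know α) (S : Set α) (x : α) : Prop :=
  ∀ z ∈ M.comm x, z ∈ S ∧ ∀ y ∈ M z .nbr, y ∈ S

/-- The set `S` contains `x` and all neighbours of `x` in the forest. -/
def KidsCovered (M : Know α) (S : Set α) (x : α) : Prop :=
  x ∈ S ∧ ∀ y, y ∈ M x .nbr ∨ y ∈ M x .succ → y ∈ S

/-- The labels of the nodes in `S` determine what `x` does after `τ` rounds of a stage. -/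
def Covered (M : Know α) (S : Set α) (x : α) : Stage → ℕ → Prop
  | .setup, _ => S = Set.univ
  | .select j, τ => τ + 1 = (Stage.select j).len → M x .busy = ∅ → M.CommCovered S x
  | .join j, τ => τ + 1 = (Stage.join j).len → M x .busy = ∅ → M.CommCovered S x
  | .order j, τ => τ + 1 = (Stage.order j).len → M.KidsCovered S x ∧
      ∀ p ∈ M x .up, M.KidsCovered S p
  | .merge j, τ => M x .busy ≠ ∅ →
      (τ < j + 1 → ∀ m < 2 ^ τ, ∀ b w, M.TourWalk m (x, b) w → w.1 ∈ S) ∧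
      (j + 1 ≤ τ → S = Set.univ ∨
        (∀ y, M y .pres ≠ ∅) ∧ ((M.group x).ncard ≤ 2 ^ j → M.group x ⊆ S))

/-- The case of full knowledge, used for renaming UIDs. -/
lemma covered_univ (M : Know α) (x : α) (st : Stage) (τ : ℕ) : M.Covered Set.univ x st τ := by
  cases st <;> simp [Covered, CommCovered, KidsCovered]

lemma self_mem_group {M : Know α} {x : α} : x ∈ M.group x := ⟨false, .refl⟩

namespace Agree

variable [LinearOrder α] [LinearOrder β] {ι : α ↪o β} {S : Set α} {M : Know α} {M' : Know β}
  (A : Agree ι S M M') {x : α}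
include A

lemma eq_empty_iff (hx : x ∈ S) (t : Tag) : M' (ι x) t = ∅ ↔ M x t = ∅ := by
  rw [A.eq x hx, Set.image_eq_empty]

lemma mem_iff (hx : x ∈ S) (t : Tag) (y : α) : ι y ∈ M' (ι x) t ↔ y ∈ M x t := by
  rw [A.eq x hx, mem_image_iff]

lemma comm (h : M.comm x ⊆ S) : M'.comm (ι x) = ι '' M.comm x := by
  ext z
  exact reflTransGen_image (fun y hy z => by rw [A.eq y (h hy)]; rfl) z

lemma comm_of_covered (h : M.CommCovered S x) : M'.comm (ι x) = ι '' M.comm x :=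
  A.comm fun z hz => (h z hz).1

lemma cand (hx : x ∈ S) (h : M.CommCovered S x) : M'.cand (ι x) = ι '' M.cand x := by
  ext u
  simp only [Know.cand, A.comm_of_covered h, Set.mem_ofPred_eq, Set.mem_image]
  constructor
  · rintro ⟨_, ⟨z, hz, rfl⟩, _, hy, hb, hu, _, hw, hlt⟩
    rw [A.eq z (h z hz).1] at hy
    obtain ⟨y, hy, rfl⟩ := hy
    have hyS := (h z hz).2 y hy
    rw [A.eq y hyS] at hu
    rw [A.eq x hx] at hw
    obtain ⟨u, hu, rfl⟩ := hu
    obtain ⟨w, hw, rfl⟩ := hw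
    exact ⟨u, ⟨z, hz, y, hy, (A.eq_empty_iff hyS _).1 hb, hu, w, hw, ι.lt_iff_lt.1 hlt⟩, rfl⟩
  · rintro ⟨u, ⟨z, hz, y, hy, hb, hu, w, hw, hlt⟩, rfl⟩
    have hyS := (h z hz).2 y hy
    exact ⟨_, ⟨z, hz, rfl⟩, ι y, (A.mem_iff (h z hz).1 _ _).2 hy, (A.eq_empty_iff hyS _).2 hb,
      (A.mem_iff hyS _ _).2 hu, ι w, (A.mem_iff hx _ _).2 hw, ι.lt_iff_lt.2 hlt⟩

lemma target (hx : x ∈ S) (h : M x .busy = ∅ → M.CommCovered S x) :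
    M'.target (ι x) = ι '' M.target x := by
  ext u
  simp only [Know.target, Set.mem_ofPred_eq, Set.mem_image, A.eq_empty_iff hx]
  constructor
  · rintro ⟨h1, h2⟩
    rw [A.cand hx (h h1), isGreatest_image] at h2
    obtain ⟨y, hy, rfl⟩ := h2
    exact ⟨y, ⟨h1, hy⟩, rfl⟩
  · rintro ⟨y, ⟨h1, h2⟩, rfl⟩
    rw [A.cand hx (h h1), isGreatest_image]
    exact ⟨h1, y, h2, rfl⟩

lemma alone (hx : x ∈ S) (h : M x .busy = ∅ → M.CommCovered S x) :
    M'.Alone (ι x) ↔ M.Alone x := by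
  unfold Know.Alone
  rw [A.eq_empty_iff hx]
  refine and_congr_right fun h1 => ?_
  have h2 := h h1
  rw [A.comm_of_covered h2]
  constructor
  · intro h3 z hz y hy
    have := h3 _ ⟨z, hz, rfl⟩ (ι y) ((A.mem_iff (h2 z hz).1 _ _).2 hy)
    rw [A.eq y ((h2 z hz).2 y hy), A.eq x hx] at this
    exact ι.injective.image_injective this
  · rintro h3 _ ⟨z, hz, rfl⟩ y hy
    rw [A.eq z (h2 z hz).1] at hy
    obtain ⟨y, hy, rfl⟩ := hy
    rw [A.eq y ((h2 z hz).2 y hy), A.eq x hx, h3 z hz y hy]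

lemma selected (hx : x ∈ S) (h : M.CommCovered S x) : M'.Selected (ι x) ↔ M.Selected x := by
  unfold Know.Selected
  rw [A.comm_of_covered h]
  constructor
  · rintro ⟨_, ⟨z, hz, rfl⟩, y, hy, u, hu, hu'⟩
    rw [A.eq z (h z hz).1] at hy
    obtain ⟨y, hy, rfl⟩ := hy
    rw [A.eq x hx] at hu
    obtain ⟨u, hu, rfl⟩ := hu
    exact ⟨z, hz, y, hy, u, hu, (A.mem_iff ((h z hz).2 y hy) _ _).1 hu'⟩
  · rintro ⟨z, hz, y, hy, u, hu, hu'⟩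
    exact ⟨_, ⟨z, hz, rfl⟩, ι y, (A.mem_iff (h z hz).1 _ _).2 hy, ι u, (A.mem_iff hx _ _).2 hu,
      (A.mem_iff ((h z hz).2 y hy) _ _).2 hu'⟩

lemma gates (hx : x ∈ S) (h : ∀ y ∈ M x .nbr, y ∈ S) : M'.gates (ι x) = ι '' M.gates x := by
  ext z
  simp only [Know.gates, Set.mem_ofPred_eq, Set.mem_image]
  constructor
  · rintro ⟨hz, hb, v, hv, hv'⟩
    rw [A.eq x hx] at hz hv
    obtain ⟨y, hy, rfl⟩ := hz
    obtain ⟨v, hv, rfl⟩ := hv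
    exact ⟨y, ⟨hy, (A.eq_empty_iff (h y hy) _).1 hb, v, hv, (A.mem_iff (h y hy) _ _).1 hv'⟩, rfl⟩
  · rintro ⟨y, ⟨hy, hb, v, hv, hv'⟩, rfl⟩
    exact ⟨(A.mem_iff hx _ _).2 hy, (A.eq_empty_iff (h y hy) _).2 hb, ι v,
      (A.mem_iff hx _ _).2 hv, (A.mem_iff (h y hy) _ _).2 hv'⟩

lemma isPort (h : M.CommCovered S x) : M'.IsPort (ι x) ↔ M.IsPort x := by
  have : {a | a ∈ M'.comm (ι x) ∧ (M'.gates a).Nonempty} =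
      ι '' {a | a ∈ M.comm x ∧ (M.gates a).Nonempty} := by
    ext z
    rw [A.comm_of_covered h]
    constructor
    · rintro ⟨⟨a, ha, rfl⟩, hn⟩
      rw [A.gates (h a ha).1 (h a ha).2, Set.image_nonempty] at hn
      exact ⟨a, ⟨ha, hn⟩, rfl⟩
    · rintro ⟨a, ⟨ha, hn⟩, rfl⟩
      refine ⟨⟨a, ha, rfl⟩, ?_⟩
      rwa [A.gates (h a ha).1 (h a ha).2, Set.image_nonempty]
  unfold Know.IsPort
  rw [this, isGreatest_image]
  exact ⟨fun ⟨y, hy, h⟩ => ι.injective h ▸ hy, fun h => ⟨x, h, rfl⟩⟩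

lemma upward (hx : x ∈ S) (h : M.CommCovered S x) : M'.upward (ι x) = ι '' M.upward x := by
  have hx' := h x .refl
  ext z
  simp only [Know.upward, Set.mem_ofPred_eq, A.isPort h, A.gates hx hx'.2, isGreatest_image,
    A.eq_empty_iff hx, A.mem_iff hx, Set.mem_image]
  rw [A.eq x hx]
  constructor
  · rintro (⟨h1, y, h2, rfl⟩ | ⟨h1, h2, rfl⟩ | ⟨h1, h2, y, h3, rfl⟩)
    · exact ⟨y, Or.inl ⟨h1, h2⟩, rfl⟩
    · exact ⟨x, Or.inr (Or.inl ⟨h1, h2, rfl⟩), rfl⟩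
    · exact ⟨y, Or.inr (Or.inr ⟨h1, h2, h3⟩), rfl⟩
  · rintro ⟨y, h1 | ⟨h1, h2, rfl⟩ | ⟨h1, h2, h3⟩, rfl⟩
    · exact Or.inl ⟨h1.1, y, h1.2, rfl⟩
    · exact Or.inr (Or.inl ⟨h1, h2, rfl⟩)
    · exact Or.inr (Or.inr ⟨h1, h2, y, h3, rfl⟩)

lemma kids (h : M.KidsCovered S x) : M'.kids (ι x) = ι '' M.kids x := by
  ext z
  simp only [Know.kids, Set.mem_ofPred_eq, Set.mem_image, A.eq x h.1]
  constructor
  · rintro ⟨h1, h2, h3⟩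
    obtain ⟨c, hc, rfl⟩ : ∃ c, (c ∈ M x .nbr ∨ c ∈ M x .succ) ∧ ι c = z := by
      rcases h2 with ⟨c, hc, rfl⟩ | ⟨c, hc, rfl⟩
      · exact ⟨c, Or.inl hc, rfl⟩
      · exact ⟨c, Or.inr hc, rfl⟩
    exact ⟨c, ⟨fun h => h1 (by rw [h]), hc, (A.mem_iff (h.2 c hc) _ _).1 h3⟩, rfl⟩
  · rintro ⟨c, ⟨h1, h2, h3⟩, rfl⟩
    exact ⟨fun h => h1 (ι.injective h), h2.imp (fun h => ⟨c, h, rfl⟩) (fun h => ⟨c, h, rfl⟩),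
      (A.mem_iff (h.2 c h2) _ _).2 h3⟩

lemma tourNext (h : M.KidsCovered S x) (hup : ∀ p ∈ M x .up, M.KidsCovered S p) (b b' : Bool) :
    M'.tourNext (ι x) b b' = ι '' M.tourNext x b b' := by
  have hlt : ∀ p ∈ M x .up, {c | c ∈ M'.kids (ι p) ∧ ι x < c} =
      ι '' {c | c ∈ M.kids p ∧ x < c} := by
    intro p hp
    rw [A.kids (hup p hp)]
    ext z
    constructor
    · rintro ⟨⟨c, hc, rfl⟩, hlt⟩
      exact ⟨c, ⟨hc, ι.lt_iff_lt.1 hlt⟩, rfl⟩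
    · rintro ⟨c, ⟨hc, hlt⟩, rfl⟩
      exact ⟨⟨c, hc, rfl⟩, ι.lt_iff_lt.2 hlt⟩
  cases b <;> cases b' <;> ext z <;>
    simp only [Know.tourNext, Set.mem_ofPred_eq, Set.mem_image, A.kids h, Set.image_eq_empty,
      isLeast_image, A.eq x h.1]
  · constructor
    · rintro ⟨rfl, h⟩; exact ⟨x, ⟨rfl, h⟩, rfl⟩
    · rintro ⟨y, ⟨rfl, h⟩, rfl⟩; exact ⟨rfl, h⟩
  · constructor
    · rintro (⟨_, ⟨p, hp, rfl⟩, hne, hl⟩ | ⟨rfl, y, hy, he⟩)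
      · rw [hlt p hp, isLeast_image] at hl
        obtain ⟨c, hc, rfl⟩ := hl
        exact ⟨c, Or.inl ⟨p, hp, fun h => hne (by rw [h]), hc⟩, rfl⟩
      · rw [ι.injective he] at hy
        exact ⟨x, Or.inr ⟨rfl, hy⟩, rfl⟩
    · rintro ⟨c, ⟨p, hp, hne, hl⟩ | ⟨rfl, hy⟩, rfl⟩
      · refine Or.inl ⟨ι p, ⟨p, hp, rfl⟩, fun h => hne (ι.injective h), ?_⟩
        rw [hlt p hp, isLeast_image]
        exact ⟨c, hl, rfl⟩
      · exact Or.inr ⟨rfl, c, hy, rfl⟩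
  · constructor
    · rintro ⟨⟨p, hp, rfl⟩, hne, hl⟩
      rw [hlt p hp, Set.image_eq_empty] at hl
      exact ⟨p, ⟨hp, fun h => hne (by rw [h]), hl⟩, rfl⟩
    · rintro ⟨p, ⟨hp, hne, hl⟩, rfl⟩
      refine ⟨⟨p, hp, rfl⟩, fun h => hne (ι.injective h), ?_⟩
      rw [hlt p hp, Set.image_eq_empty]
      exact hl

lemma tourStep {w : α × Bool} (hw : w.1 ∈ S) {z : β × Bool} :
    M'.TourStep (Prod.map ι id w) z ↔ ∃ w', M.TourStep w w' ∧ Prod.map ι id w' = z := by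
  obtain ⟨z, b⟩ := z
  simp only [TourStep, Prod.map, id, A.eq _ hw, Set.mem_image, Prod.exists, Prod.mk.injEq]
  constructor
  · rintro ⟨y, hy, rfl⟩; exact ⟨y, b, hy, rfl, rfl⟩
  · rintro ⟨y, b', hy, rfl, rfl⟩; exact ⟨y, hy, rfl⟩

lemma tourWalk {n : ℕ} {w : α × Bool} (h : ∀ m < n, ∀ v, M.TourWalk m w v → v.1 ∈ S)
    {z : β × Bool} :
    M'.TourWalk n (Prod.map ι id w) z ↔ ∃ w', M.TourWalk n w w' ∧ Prod.map ι id w' = z := by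
  induction n generalizing w with
  | zero => simp [TourWalk]
  | succ n ih =>
    have hw : w.1 ∈ S := h 0 (by omega) w rfl
    have hstep : ∀ v, M.TourStep w v → ∀ m < n, ∀ u, M.TourWalk m v u → u.1 ∈ S :=
      fun v hv m hm u hu => h (m + 1) (by omega) u ⟨v, hv, hu⟩
    simp only [TourWalk]
    constructor
    · rintro ⟨v', hv', hz⟩
      obtain ⟨v, hv, rfl⟩ := (A.tourStep hw).1 hv'
      obtain ⟨u, hu, rfl⟩ := (ih (hstep v hv)).1 hz
      exact ⟨u, ⟨v, hv, hu⟩, rfl⟩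
    · rintro ⟨u, ⟨v, hv, hu⟩, rfl⟩
      exact ⟨_, (A.tourStep hw).2 ⟨v, hv, rfl⟩, (ih (hstep v hv)).2 ⟨u, hu, rfl⟩⟩

lemma jumps {n : ℕ} (h : ∀ m < n, ∀ b w, M.TourWalk m (x, b) w → w.1 ∈ S) :
    M'.jumps n (ι x) = ι '' M.jumps n x := by
  have hw : ∀ b z, M'.TourWalk n (ι x, b) z ↔
      ∃ w', M.TourWalk n (x, b) w' ∧ Prod.map ι id w' = z :=
    fun b z => A.tourWalk (w := (x, b)) (fun m hm v hv => h m hm b v hv)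
  ext z
  simp only [Know.jumps, Set.mem_ofPred_eq, Set.mem_image, hw]
  constructor
  · rintro ⟨b, b', ⟨y, c⟩, h1, h2⟩
    simp only [Prod.map, id, Prod.mk.injEq] at h2
    exact ⟨y, ⟨b, c, h1⟩, h2.1⟩
  · rintro ⟨y, ⟨b, c, h1⟩, rfl⟩
    exact ⟨b, c, (y, c), h1, rfl⟩

lemma group (h : M.group x ⊆ S) : M'.group (ι x) = ι '' M.group x := by
  have hr : ∀ z, Relation.ReflTransGen M'.TourStep (ι x, false) z ↔
      ∃ w, Relation.ReflTransGen M.TourStep (x, false) w ∧ Prod.map ι id w = z :=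
    reflTransGen_image (f := Prod.map ι id) (x := (x, false)) fun w hw z =>
      A.tourStep (h ⟨w.2, hw⟩)
  ext z
  simp only [Know.group, Set.mem_ofPred_eq, Set.mem_image, hr]
  constructor
  · rintro ⟨b, ⟨y, c⟩, h1, h2⟩
    simp only [Prod.map, id, Prod.mk.injEq] at h2
    exact ⟨y, ⟨c, h1⟩, h2.1⟩
  · rintro ⟨y, ⟨c, h1⟩, rfl⟩
    exact ⟨c, (y, c), h1, rfl⟩

/-- If `S` misses a node of the tour, both sides fail. The true tour then has more than `2 ^ j`
nodes, since smaller ones are covered; and the known steps leave `S` at a node without a label,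
against the clause on `pres`. -/
lemma small {j : ℕ} (hx : x ∈ S) (h : M x .busy ≠ ∅ → S = Set.univ ∨
    (∀ y, M y .pres ≠ ∅) ∧ ((M.group x).ncard ≤ 2 ^ j → M.group x ⊆ S)) :
    M'.Small j (ι x) ↔ M.Small j x := by
  have key : M.group x ⊆ S → (M'.Small j (ι x) ↔ M.Small j x) := by
    intro hS
    unfold Know.Small
    rw [A.group hS, Set.ncard_image_of_injective _ ι.injective, ne_eq, A.eq_empty_iff hx,
      Set.forall_mem_image]
    exact and_congr_right fun _ => and_congr_left fun _ => forall₂_congr fun y hy => by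
      rw [ne_eq, A.eq_empty_iff (hS hy)]
  by_cases hb : M x .busy = ∅
  · simp [Know.Small, hb, A.eq_empty_iff hx]
  rcases h hb with rfl | ⟨h1, h2⟩
  · exact key (Set.subset_univ _)
  by_cases hS : M.group x ⊆ S
  · exact key hS
  refine iff_of_false (fun h3 => ?_) (fun h3 => hS (h2 h3.2.2))
  obtain ⟨y, ⟨b, hy⟩, hyS⟩ := Set.not_subset.1 hS
  have hex : ∀ w : α × Bool, Relation.ReflTransGen M.TourStep (x, false) w →
      Relation.ReflTransGen M'.TourStep (ι x, false) (Prod.map ι id w) ∧ w.1 ∈ S := by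
    intro w hw
    induction hw with
    | refl => exact ⟨.refl, hx⟩
    | @tail v u h4 h5 ih =>
      have h6 := ih.1.tail ((A.tourStep ih.2).2 ⟨_, h5, rfl⟩)
      refine ⟨h6, ?_⟩
      by_contra hu
      refine h3.2.1 (ι u.1) ⟨u.2, h6⟩ (A.empty _ ?_ _)
      rwa [mem_image_iff]
  exact hyS (hex _ hy).2

lemma near2 {y : α} (hS : M.group x ⊆ S) (hx : x ∈ M.group x) (hy : y ∈ M.group x) :
    Near2 M'.Link (M'.group (ι x)) (ι x) (ι y) ↔ Near2 M.Link (M.group x) x y := by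
  have hlink : ∀ a ∈ M.group x, ∀ b ∈ M.group x,
      ((ι a = ι b ∨ M'.Link (ι a) (ι b)) ↔ (a = b ∨ M.Link a b)) := fun a ha b hb => by
    rw [ι.injective.eq_iff, Link, Link, A.mem_iff (hS ha), A.mem_iff (hS hb)]
  unfold Near2
  rw [A.group hS, Set.exists_mem_image]
  exact exists_congr fun w => and_congr_right fun hw =>
    and_congr (hlink x hx w hw) (hlink w hw y hy)

lemma near3 {y z : α} (hS : M.group x ⊆ S) (hy : y ∈ M.group x) (hz : z ∈ M.group x) :
    Near3 M'.Link (M'.group (ι x)) (ι y) (ι z) ↔ Near3 M.Link (M.group x) y z := by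
  have hlink : ∀ a ∈ M.group x, ∀ b ∈ M.group x,
      ((ι a = ι b ∨ M'.Link (ι a) (ι b)) ↔ (a = b ∨ M.Link a b)) := fun a ha b hb => by
    rw [ι.injective.eq_iff, Link, Link, A.mem_iff (hS ha), A.mem_iff (hS hb)]
  unfold Near3 Near2
  rw [A.group hS, Set.exists_mem_image]
  refine exists_congr fun w => and_congr_right fun hw => and_congr ?_ (hlink w hw z hz)
  rw [Set.exists_mem_image]
  exact exists_congr fun v => and_congr_right fun hv =>
    and_congr (hlink y hy v hv) (hlink v hv w hw)

lemma isTour {l : List α} (hS : M.group x ⊆ S) : M'.IsTour (ι x) (l.map ι) ↔ M.IsTour x l := by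
  unfold Know.IsTour
  rw [List.nodup_map_iff ι.injective]
  refine and_congr_right fun _ => ?_
  have hmem : (∀ y, y ∈ l.map ι ↔ y ∈ M'.group (ι x)) ↔ ∀ y, y ∈ l ↔ y ∈ M.group x := by
    rw [A.group hS]
    constructor
    · intro h y
      rw [← mem_image_iff ι, ← h (ι y), List.mem_map_of_injective ι.injective]
    · intro h z
      simp only [List.mem_map, h, Set.mem_image]
  rw [hmem]
  refine and_congr_right fun hl => and_congr ?_ ?_
  · rw [List.head?_map]
    constructor
    · rintro ⟨r, hr, hr'⟩
      obtain ⟨r, h, rfl⟩ := Option.map_eq_some_iff.1 hr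
      rw [A.mem_iff (hS ((hl r).1 (List.mem_of_mem_head? h)))] at hr'
      exact ⟨r, h, hr'⟩
    · rintro ⟨r, h, hr'⟩
      refine ⟨ι r, by rw [h]; rfl, ?_⟩
      rwa [A.mem_iff (hS ((hl r).1 (List.mem_of_mem_head? h)))]
  · have hin : ∀ y z, listNext l y z → y ∈ M.group x ∧ z ∈ M.group x := fun y z ⟨i, h1, h2⟩ =>
      ⟨(hl y).1 (List.mem_of_getElem? h1), (hl z).1 (List.mem_of_getElem? h2)⟩
    constructor
    · intro h y z hyz
      rw [← A.near3 hS (hin y z hyz).1 (hin y z hyz).2]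
      exact h _ _ ((listNext_map ι).2 ⟨z, hyz, rfl⟩)
    · rintro h y z hyz
      obtain ⟨i, h1, h2⟩ := id hyz
      rw [List.getElem?_map] at h1
      obtain ⟨y, _, rfl⟩ := Option.map_eq_some_iff.1 h1
      obtain ⟨z, hz, rfl⟩ := (listNext_map ι).1 hyz
      rw [A.near3 hS (hin y z hz).1 (hin y z hz).2]
      exact h y z hz

/-- A tour on the renamed side visits only images of nodes, hence is the image of a list, and
renaming keeps the lexicographic order. -/
lemma leastTour (hS : M.group x ⊆ S) {l : List β} :
    M'.LeastTour (ι x) l ↔ ∃ m, M.LeastTour x m ∧ m.map ι = l := by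
  have hex : ∀ l, M'.IsTour (ι x) l → ∃ m : List α, m.map ι = l := by
    intro l hl
    have : l ∈ Set.range (List.map ι) := by
      rw [Set.range_list_map]
      intro y hy
      have := (hl.2.1 y).1 hy
      rw [A.group hS] at this
      exact Set.image_subset_range _ _ this
    exact this
  constructor
  · rintro ⟨h1, h2⟩
    obtain ⟨m, rfl⟩ := hex l h1
    refine ⟨m, ⟨(A.isTour hS).1 h1, fun m' hm' hlt => ?_⟩, rfl⟩
    exact h2 _ ((A.isTour hS).2 hm') ((list_map_lt_map_iff ι).2 hlt)
  · rintro ⟨m, ⟨h1, h2⟩, rfl⟩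
    refine ⟨(A.isTour hS).2 h1, fun m' hm' hlt => ?_⟩
    obtain ⟨m', rfl⟩ := hex m' hm'
    exact h2 _ ((A.isTour hS).1 hm') ((list_map_lt_map_iff ι).1 hlt)

lemma base (hx : x ∈ S) : M'.base (ι x) = ι '' M.base x := by
  simp only [Know.base, A.eq x hx, Set.image_union]

lemma group_subset {j : ℕ} (h : M x .busy ≠ ∅ → S = Set.univ ∨
    (∀ y, M y .pres ≠ ∅) ∧ ((M.group x).ncard ≤ 2 ^ j → M.group x ⊆ S)) (hs : M.Small j x) :
    M.group x ⊆ S := by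
  rcases h hs.1 with rfl | h
  · exact Set.subset_univ _
  · exact h.2 hs.2.2

lemma pres (h : S = Set.univ) : {y | y ≠ ι x ∧ y ∈ M' y .pres} = ι '' {y | y ≠ x ∧ y ∈ M y .pres} := by
  subst h
  ext z
  constructor
  · rintro ⟨h1, h2⟩
    obtain ⟨y, _, rfl⟩ : z ∈ ι '' Set.univ := by
      by_contra hz; rw [A.empty z hz] at h2; exact h2
    exact ⟨y, ⟨fun h => h1 (by rw [h]), (A.mem_iff (Set.mem_univ y) _ _).1 h2⟩, rfl⟩
  · rintro ⟨y, ⟨h1, h2⟩, rfl⟩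
    exact ⟨fun h => h1 (ι.injective h), (A.mem_iff (Set.mem_univ y) _ _).2 h2⟩

lemma tour_image (hS : M.group x ⊆ S) {R : List α → α → Prop} {R' : List β → β → Prop}
    (h : ∀ l z, R' (l.map ι) z ↔ ∃ y, R l y ∧ ι y = z) :
    {z | ∃ l, M'.LeastTour (ι x) l ∧ R' l z} = ι '' {y | ∃ l, M.LeastTour x l ∧ R l y} := by
  ext z
  simp only [Set.mem_ofPred_eq, Set.mem_image]
  constructor
  · rintro ⟨l, hl, hz⟩
    obtain ⟨m, hm, rfl⟩ := (A.leastTour hS).1 hl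
    obtain ⟨y, hy, rfl⟩ := (h m z).1 hz
    exact ⟨y, ⟨m, hm, hy⟩, rfl⟩
  · rintro ⟨y, ⟨m, hm, hy⟩, rfl⟩
    exact ⟨_, (A.leastTour hS).2 ⟨m, hm, rfl⟩, (h m _).2 ⟨y, hy, rfl⟩⟩

/-- Locality of the wanted edges: every ingredient depends only on labels that `Covered` places in
`S`. -/
lemma want {st : Stage} {τ : ℕ} (hx : x ∈ S) (h : M.Covered S x st τ) :
    M'.want st τ (ι x) = ι '' M.want st τ x := by
  cases st with
  | setup => exact A.pres h
  | select j =>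
    have hc : (τ + 1 = (Stage.select j).len ∧ M'.Alone (ι x)) ↔
        (τ + 1 = (Stage.select j).len ∧ M.Alone x) :=
      and_congr_right fun hτ => A.alone hx (h hτ)
    simp only [Know.want]
    by_cases hc' : τ + 1 = (Stage.select j).len ∧ M.Alone x
    · rw [if_pos (hc.2 hc'), if_pos hc']; exact A.eq x hx _
    · rw [if_neg (hc.not.2 hc'), if_neg hc']; exact A.base hx
  | join j => exact A.base hx
  | order j => exact A.base hx
  | merge j =>
    simp only [Know.want, A.eq_empty_iff hx]
    by_cases hτ : τ < j + 1
    · simp only [hτ, if_true]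
      split_ifs with hb
      · exact A.base hx
      · rw [Set.image_union, A.base hx, A.jumps ((h hb).1 hτ)]
    · simp only [hτ, if_false]
      have h' := fun hb => (h hb).2 (not_lt.1 hτ)
      rw [A.small hx h']
      by_cases hs : M.Small j x
      · have hS := A.group_subset h' hs
        simp only [hs, not_true_eq_false, if_false]
        split_ifs
        · rw [Set.image_union, A.base hx]
          congr 1
          ext z
          constructor
          · rintro ⟨hz, h2⟩
            rw [A.group hS] at hz
            obtain ⟨y, hy, rfl⟩ := hz
            exact ⟨y, ⟨hy, (A.near2 hS self_mem_group hy).1 h2⟩, rfl⟩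
          · rintro ⟨y, ⟨hy, h2⟩, rfl⟩
            exact ⟨by rw [A.group hS]; exact ⟨y, hy, rfl⟩, (A.near2 hS self_mem_group hy).2 h2⟩
        · rw [Set.image_union, A.eq x hx]
          congr 1
          apply A.tour_image hS
          intro l z
          rw [listNext_map, listParent_map]
          simp only [or_and_right, exists_or]
      · simp only [hs, not_false_eq_true, if_true]; exact A.base hx

/-- Locality of the new labels. Only the last round of a stage matters, which is when `Covered`
makes its demands for the first three stages of a slot. -/
lemma label {st : Stage} {τ : ℕ} (hτ : τ + 1 = st.len) (hx : x ∈ S) (h : M.Covered S x st τ)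
    (t : Tag) : M'.label st (ι x) t = ι '' M.label st x t := by
  cases st with
  | setup =>
    cases t <;> simp only [Know.label, Set.image_empty, Set.image_singleton]
    exact A.pres h
  | select j =>
    cases t with
    | tgt => exact A.target hx (h hτ)
    | halt =>
      simp only [Know.label, A.alone hx (h hτ)]
      ext z
      constructor
      · rintro ⟨rfl, h⟩; exact ⟨x, ⟨rfl, h⟩, rfl⟩
      · rintro ⟨y, ⟨rfl, h⟩, rfl⟩; exact ⟨rfl, h⟩
    | _ => exact A.eq x hx _
  | join j =>
    cases t with
    | tgt => simp [Know.label]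
    | busy =>
      ext z
      simp only [Know.label, A.eq x hx, Set.mem_ofPred_eq, Set.image_eq_empty, Set.mem_image,
        Set.image_nonempty]
      constructor
      · rintro (⟨y, hy, rfl⟩ | ⟨h1, rfl, h2⟩)
        · exact ⟨y, Or.inl hy, rfl⟩
        · rw [A.selected hx (h hτ h1)] at h2
          exact ⟨x, Or.inr ⟨h1, rfl, h2⟩, rfl⟩
      · rintro ⟨y, hy | ⟨h1, rfl, h2⟩, rfl⟩
        · exact Or.inl ⟨y, hy, rfl⟩
        · refine Or.inr ⟨h1, rfl, ?_⟩
          rwa [A.selected hx (h hτ h1)]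
    | up =>
      simp only [Know.label, A.eq_empty_iff hx]
      split_ifs with h1
      · exact A.upward hx (h hτ h1)
      · exact A.eq x hx _
    | _ => exact A.eq x hx _
  | order j =>
    cases t with
    | next b b' => exact A.tourNext (h hτ).1 (h hτ).2 b b'
    | _ => exact A.eq x hx _
  | merge j =>
    have h' := fun hb => (h hb).2 (by simp only [Stage.len] at hτ; omega)
    have hs := A.small hx h'
    by_cases hsm : M.Small j x
    · have hS := A.group_subset h' hsm
      cases t <;> simp only [Know.label, hs, hsm, if_true, Set.image_empty, Set.image_singleton] <;>
        try exact A.eq x hx _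
      · refine A.tour_image (R := fun l y => l.head? = some y) (R' := fun l y => l.head? = some y)
          hS fun l z => ?_
        rw [List.head?_map, Option.map_eq_some_iff]
      · exact A.tour_image (R := fun l y => listNext l x y) (R' := fun l y => listNext l (ι x) y)
          hS fun l z => listNext_map ι
      · exact A.tour_image (R := fun l y => listNext l y x) (R' := fun l y => listNext l y (ι x))
          hS fun l z => listNext_map' ι
      · exact A.tour_image (R := fun l y => listParent (j + 1) l x y)
          (R' := fun l y => listParent (j + 1) l (ι x) y) hS fun l z => listParent_map ι
    · cases t <;> simp only [Know.label, hs, hsm, if_false, Set.image_empty] <;>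
        exact A.eq x hx _

end Agree

/-- Renaming the nodes. -/
def rename (ι : α → β) (M : Know α) : Know β := fun z t => {b | ∃ x, ι x = z ∧ b ∈ ι '' M x t}

/-- What is known about the nodes in `S`. -/
def restrict (M : Know α) (S : Set α) : Know α := fun x t => {y | x ∈ S ∧ y ∈ M x t}

lemma agree_rename [LinearOrder α] [LinearOrder β] (ι : α ↪o β) (M : Know α) (S : Set α) :
    Agree ι S M ((M.restrict S).rename ι) := by
  refine ⟨fun x hx t => ?_, fun z hz t => ?_⟩
  · ext b
    constructor
    · rintro ⟨y, hy, w, hw, rfl⟩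
      rw [ι.injective hy] at hw
      exact ⟨w, hw.2, rfl⟩
    · rintro ⟨w, hw, rfl⟩
      exact ⟨x, rfl, w, ⟨hx, hw⟩, rfl⟩
  · rw [Set.eq_empty_iff_forall_notMem]
    rintro _ ⟨x, rfl, w, hw, rfl⟩
    exact hz ⟨x, hw.1, rfl⟩

lemma agree_rename_univ [LinearOrder α] [LinearOrder β] (ι : α ↪o β) (M : Know α) :
    Agree ι Set.univ M (M.rename ι) := by
  have := agree_rename ι M Set.univ
  rwa [show M.restrict Set.univ = M by
    funext x t; ext y; simp [restrict]] at this

end Know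

lemma graphToWreath_status_eq_leader (s : NodeState) :
    graphToWreath.status s = .leader ↔ s.me ∈ s.know s.me .ldr := by
  simp only [graphToWreath]
  split_ifs with h <;> simp [h]

-- States and messages are renamed entrywise, and locality is applied with `S = Set.univ`.
open Know in
theorem graphToWreath_isComparisonBased : graphToWreath.IsComparisonBased := by
  refine ⟨fun f s => (⟨f s.me, s.stage, s.time, s.know.rename f⟩ : NodeState),
    fun f M => Know.rename f M, fun f => ?_⟩
  have hmerged : ∀ (s : NodeState) (I : Set (ℕ × Know ℕ)),
      NodeState.merged ⟨f s.me, s.stage, s.time, s.know.rename f⟩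
        ((fun p : ℕ × Know ℕ => (f p.1, Know.rename f p.2)) '' I) = (s.merged I).rename f := by
    intro s I
    funext z t
    ext b
    constructor
    · rintro (⟨x, rfl, y, hy, rfl⟩ | ⟨_, ⟨p, hp, rfl⟩, x, rfl, y, hy, rfl⟩)
      · exact ⟨x, rfl, y, Or.inl hy, rfl⟩
      · exact ⟨x, rfl, y, Or.inr ⟨p, hp, hy⟩, rfl⟩
    · rintro ⟨x, rfl, y, hy | ⟨p, hp, hy⟩, rfl⟩
      · exact Or.inl ⟨x, rfl, y, hy, rfl⟩
      · exact Or.inr ⟨_, ⟨p, hp, rfl⟩, x, rfl, y, hy, rfl⟩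
  have hwant : ∀ (s : NodeState) (I : Set (ℕ × Know ℕ)),
      ((s.merged I).rename f).want s.stage s.time (f s.me) =
        f '' (s.merged I).want s.stage s.time s.me := fun s I =>
    (agree_rename_univ f _).want (Set.mem_univ _) (covered_univ _ _ _ _)
  have hmem : ∀ (M : Know ℕ) (x y : ℕ) t, f y ∈ M.rename f (f x) t ↔ y ∈ M x t := fun M x y t =>
    (agree_rename_univ f M).mem_iff (Set.mem_univ _) t y
  refine ⟨fun x => ?_, fun s x => rfl, fun (s : NodeState) (I : Set (ℕ × Know ℕ)) x => ?_,
    fun (s : NodeState) (I : Set (ℕ × Know ℕ)) x => ?_,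
    fun (s : NodeState) (I : Set (ℕ × Know ℕ)) => ?_,
    fun s => hmem _ _ _ _, fun s => ?_⟩
  · simp only [graphToWreath, NodeState.mk.injEq, true_and]
    funext z t
    ext b
    constructor
    · rintro ⟨rfl, rfl, rfl⟩; exact ⟨x, rfl, x, ⟨rfl, rfl, rfl⟩, rfl⟩
    · rintro ⟨x, rfl, y, ⟨rfl, rfl, rfl⟩, rfl⟩; exact ⟨rfl, rfl, rfl⟩
  · simp only [graphToWreath]
    rw [hmerged, hwant, mem_image_iff]
  · simp only [graphToWreath, Set.mem_ofPred_eq]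
    rw [hmerged, hwant, mem_image_iff]
    refine and_congr_left fun _ => ?_
    constructor
    · rintro ⟨_, ⟨p, hp, rfl⟩, h⟩; exact ⟨p, hp, f.injective h⟩
    · rintro ⟨p, hp, rfl⟩; exact ⟨_, ⟨p, hp, rfl⟩, rfl⟩
  · simp only [graphToWreath]
    rw [hmerged]
    split_ifs with h
    · simp only [NodeState.mk.injEq, true_and]
      funext z t
      ext b
      constructor
      · rintro ⟨rfl, hb⟩
        rw [(agree_rename_univ f _).label h (Set.mem_univ _) (covered_univ _ _ _ _)] at hb
        obtain ⟨y, hy, rfl⟩ := hb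
        exact ⟨s.me, rfl, y, ⟨rfl, hy⟩, rfl⟩
      · rintro ⟨x, rfl, y, ⟨rfl, hy⟩, rfl⟩
        refine ⟨rfl, ?_⟩
        rw [(agree_rename_univ f _).label h (Set.mem_univ _) (covered_univ _ _ _ _)]
        exact ⟨y, hy, rfl⟩
    · rfl
  · have key : ∀ a b : Status, (a = .leader ↔ b = .leader) → a = b := by
      rintro (_ | _) (_ | _) h <;> simp_all
    refine key _ _ ?_
    exact (graphToWreath_status_eq_leader _).trans
      ((hmem (NodeState.know s) (NodeState.me s) (NodeState.me s) .ldr).trans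
        (graphToWreath_status_eq_leader s).symm)

/-! ## The execution of the algorithm -/

section Execution

variable {V : Type}

/-- What `v` has heard of after a round in the graph `D`. -/
def heard (S : V → Set V) (D : SimpleGraph V) (v : V) : Set V :=
  {x | x ∈ S v ∨ ∃ w, D.Adj v w ∧ x ∈ S w}

variable [LinearOrder V] (ι : V ↪o ℕ) (G : SimpleGraph V)

/-- At the beginning of round `t + 1` of the execution, the graph is `D`, the stage `st` has begun
`τ` rounds ago, and every node `v` knows the labels in `M` of the nodes in `S v`. -/
def At (t : ℕ) (st : Stage) (τ : ℕ) (M : Know V) (S : V → Set V) (D : SimpleGraph V) : Prop :=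
  (graphToWreath.run ι G t).graph = D ∧
    ∀ v, (graphToWreath.run ι G t).state v =
      (⟨ι v, st, τ, (M.restrict (S v)).rename ι⟩ : NodeState)

variable {ι G} {t τ : ℕ} {st : Stage} {M : Know V} {S : V → Set V} {D : SimpleGraph V}

lemma At.halted_iff (h : At ι G t st τ M S D) (hS : ∀ v, v ∈ S v) (v : V) :
    graphToWreath.halted ((graphToWreath.run ι G t).state v) ↔ v ∈ M v .halt := by
  rw [h.2 v]
  exact (Know.agree_rename ι M (S v)).mem_iff (hS v) _ _

lemma At.merged (h : At ι G t st τ M S D) (hS : ∀ v, v ∈ S v) (hM : ∀ v, M v .halt = ∅) (v : V) :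
    NodeState.merged ((graphToWreath.run ι G t).state v)
      (graphToWreath.inbox ι (graphToWreath.run ι G t) v) =
      (M.restrict (heard S D v)).rename ι := by
  have hh : ∀ w, ¬ graphToWreath.halted ((graphToWreath.run ι G t).state w) := fun w => by
    rw [h.halted_iff hS, hM]; exact fun h => h
  funext z tag
  ext b
  simp only [NodeState.merged, Algorithm.inbox, h.1, Set.mem_ofPred_eq]
  constructor
  · rintro (h1 | ⟨⟨_, K⟩, ⟨w, hw, _, rfl, hK⟩, h1⟩)
    · rw [h.2 v] at h1
      obtain ⟨x, rfl, y, hy, rfl⟩ := h1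
      exact ⟨x, rfl, y, ⟨Or.inl hy.1, hy.2⟩, rfl⟩
    · have hK' : NodeState.know ((graphToWreath.run ι G t).state w) = K := Option.some.inj hK
      rw [← hK', h.2 w] at h1
      obtain ⟨x, rfl, y, hy, rfl⟩ := h1
      exact ⟨x, rfl, y, ⟨Or.inr ⟨w, hw.symm, hy.1⟩, hy.2⟩, rfl⟩
  · rintro ⟨x, rfl, y, ⟨h1 | ⟨w, hw, h1⟩, h2⟩, rfl⟩
    · left; rw [h.2 v]; exact ⟨x, rfl, y, ⟨h1, h2⟩, rfl⟩
    · right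
      refine ⟨(ι w, NodeState.know ((graphToWreath.run ι G t).state w)),
        ⟨w, hw.symm, hh w, rfl, rfl⟩, ?_⟩
      rw [h.2 w]
      exact ⟨x, rfl, y, ⟨h1, h2⟩, rfl⟩

/-- The new graph, when every node `v` wants to be joined to the nodes in `W v`. -/
lemma At.graph_succ (h : At ι G t st τ M S D) (hS : ∀ v, v ∈ S v) (hM : ∀ v, M v .halt = ∅)
    {W : V → Set V}
    (hW : ∀ v, ((M.restrict (heard S D v)).rename ι).want st τ (ι v) = ι '' W v)
    (hD : ∀ v, ∀ w ∈ W v, w = v ∨ D.Adj v w ∨ ∃ u, D.Adj v u ∧ D.Adj u w) :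
    (graphToWreath.run ι G (t + 1)).graph = SimpleGraph.fromRel fun v w => w ∈ W v := by
  have hh : ∀ w, ¬ graphToWreath.halted ((graphToWreath.run ι G t).state w) := fun w => by
    rw [h.halted_iff hS, hM]; exact fun h => h
  have hact : ∀ v w, graphToWreath.WantsActivate ι (graphToWreath.run ι G t) v w ↔ w ∈ W v := by
    intro v w
    rw [← mem_image_iff ι, ← hW v]
    simp only [Algorithm.WantsActivate, hh, not_false_eq_true, true_and]
    have := h.merged hS hM v
    change _ ∈ (NodeState.merged _ _).want (NodeState.stage _) (NodeState.time _)
      (NodeState.me _) ↔ _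
    rw [this, h.2 v]
  -- Deactivation is only requested for senders of received messages, that is, for present edges. So
  -- it cannot conflict with the activation of a new edge.
  have hdeact : ∀ v w, graphToWreath.WantsDeactivate ι (graphToWreath.run ι G t) v w ↔
      D.Adj v w ∧ w ∉ W v := by
    intro v w
    rw [← hact]
    simp only [Algorithm.WantsActivate, Algorithm.WantsDeactivate, hh, not_false_eq_true, true_and]
    change (∃ p ∈ graphToWreath.inbox ι (graphToWreath.run ι G t) v, p.1 = ι w) ∧ _ ↔ _
    refine and_congr_left fun _ => ?_
    constructor
    · rintro ⟨p, ⟨u, hu, _, hup, _⟩, hp⟩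
      rw [hp] at hup
      rw [h.1] at hu
      rw [← ι.injective hup]; exact hu.symm
    · intro hvw
      exact ⟨(ι w, NodeState.know ((graphToWreath.run ι G t).state w)),
        ⟨w, by rw [h.1]; exact hvw.symm, hh w, rfl, rfl⟩, rfl⟩
  ext v w
  simp only [Algorithm.run, Algorithm.step, SimpleGraph.sdiff_adj, SimpleGraph.sup_adj,
    Algorithm.activated, Algorithm.deactivated, hact, hdeact, h.1, SimpleGraph.fromRel_adj]
  by_cases hadj : D.Adj v w
  -- A present edge disappears only if neither end wants it: if one end wants it, the decisions are
  -- contradictory and have no effect.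
  · have hadj' := hadj.symm
    simp only [hadj, hadj', hadj.ne, true_or, true_and, ne_eq, not_false_eq_true]
    tauto
  · have hadj' : ¬ D.Adj w v := fun h => hadj h.symm
    simp only [hadj, hadj', false_or, false_and, or_false, not_false_eq_true, true_and, and_true]
    refine and_congr_right fun hne => ⟨fun h => h.2, fun h => ⟨?_, h⟩⟩
    rcases h with h | h
    · rcases hD v w h with h' | h' | h'
      · exact absurd h'.symm hne
      · exact absurd h' hadj
      · exact h'
    · rcases hD w v h with h' | h' | ⟨u, h1, h2⟩
      · exact absurd h' hne
      · exact absurd h' hadj'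
      · exact ⟨u, h2.symm, h1.symm⟩

lemma At.step_mid (h : At ι G t st τ M S D) (hS : ∀ v, v ∈ S v) (hM : ∀ v, M v .halt = ∅)
    {W : V → Set V}
    (hW : ∀ v, ((M.restrict (heard S D v)).rename ι).want st τ (ι v) = ι '' W v)
    (hD : ∀ v, ∀ w ∈ W v, w = v ∨ D.Adj v w ∨ ∃ u, D.Adj v u ∧ D.Adj u w)
    (hτ : τ + 1 ≠ st.len) :
    At ι G (t + 1) st (τ + 1) M (heard S D) (SimpleGraph.fromRel fun v w => w ∈ W v) := by
  refine ⟨h.graph_succ hS hM hW hD, fun v => ?_⟩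
  have hh : ¬ graphToWreath.halted ((graphToWreath.run ι G t).state v) := by
    rw [h.halted_iff hS, hM]; exact fun h => h
  simp only [Algorithm.run, Algorithm.step, hh, if_false]
  have hm := h.merged hS hM v
  have hv := h.2 v
  generalize (graphToWreath.run ι G t).state v = s at hm hv
  simp only [graphToWreath] at hm ⊢
  rw [hm]
  subst hv
  simp only [hτ, if_false]

lemma At.step_end (h : At ι G t st τ M S D) (hS : ∀ v, v ∈ S v) (hM : ∀ v, M v .halt = ∅)
    {W : V → Set V}
    (hW : ∀ v, ((M.restrict (heard S D v)).rename ι).want st τ (ι v) = ι '' W v)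
    (hD : ∀ v, ∀ w ∈ W v, w = v ∨ D.Adj v w ∨ ∃ u, D.Adj v u ∧ D.Adj u w)
    (hτ : τ + 1 = st.len) {N : Know V}
    (hN : ∀ v t, ((M.restrict (heard S D v)).rename ι).label st (ι v) t = ι '' N v t) :
    At ι G (t + 1) st.following 0 N (fun v => {v}) (SimpleGraph.fromRel fun v w => w ∈ W v) := by
  refine ⟨h.graph_succ hS hM hW hD, fun v => ?_⟩
  have hh : ¬ graphToWreath.halted ((graphToWreath.run ι G t).state v) := by
    rw [h.halted_iff hS, hM]; exact fun h => h
  simp only [Algorithm.run, Algorithm.step, hh, if_false]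
  have hm := h.merged hS hM v
  have hv := h.2 v
  generalize (graphToWreath.run ι G t).state v = s at hm hv
  simp only [graphToWreath] at hm ⊢
  rw [hm]
  subst hv
  simp only [hτ, if_true, NodeState.mk.injEq, true_and, hN]
  funext z tag
  ext b
  constructor
  · rintro ⟨rfl, y, hy, rfl⟩; exact ⟨v, rfl, y, ⟨rfl, hy⟩, rfl⟩
  · rintro ⟨x, rfl, y, ⟨rfl, hy⟩, rfl⟩; exact ⟨rfl, y, hy, rfl⟩

/-- The graphs in the rounds of a stage. -/
def stageGraph (M : Know V) (st : Stage) (D : SimpleGraph V) : ℕ → SimpleGraph V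
  | 0 => D
  | τ + 1 => SimpleGraph.fromRel fun v w => w ∈ M.want st τ v

/-- What the nodes have heard of in the rounds of a stage. -/
def stageHeard (M : Know V) (st : Stage) (D : SimpleGraph V) : ℕ → V → Set V
  | 0 => fun v => {v}
  | τ + 1 => heard (stageHeard M st D τ) (stageGraph M st D τ)

lemma mem_stageHeard (τ : ℕ) (v : V) : v ∈ stageHeard M st D τ v := by
  induction τ with
  | zero => rfl
  | succ τ ih => exact Or.inl ih

/-- The execution of a stage is determined by two conditions on the labels: `hC`, each node has
heard enough for its decisions, and `hD`, wanted edges join nodes at distance at most two in the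
current graph. Afterwards each node keeps only its own new label. -/
lemma At.stage (h : At ι G t st 0 M (fun v => {v}) D) (hM : ∀ v, M v .halt = ∅)
    (hC : ∀ τ < st.len, ∀ v, M.Covered (stageHeard M st D (τ + 1) v) v st τ)
    (hD : ∀ τ < st.len, ∀ v, ∀ w ∈ M.want st τ v, w = v ∨ (stageGraph M st D τ).Adj v w ∨
      ∃ u, (stageGraph M st D τ).Adj v u ∧ (stageGraph M st D τ).Adj u w) :
    (∀ τ < st.len, At ι G (t + τ) st τ M (stageHeard M st D τ) (stageGraph M st D τ)) ∧
    At ι G (t + st.len) st.following 0 (M.label st) (fun v => {v}) (stageGraph M st D st.len) := by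
  have hlen : 0 < st.len := by cases st <;> simp [Stage.len]
  have hmid : ∀ τ < st.len,
      At ι G (t + τ) st τ M (stageHeard M st D τ) (stageGraph M st D τ) := by
    intro τ
    induction τ with
    | zero => intro _; exact h
    | succ τ ih =>
      intro hτ
      exact (ih (by omega)).step_mid (mem_stageHeard τ) hM
        (fun v => (Know.agree_rename ι M _).want (mem_stageHeard (τ + 1) v) (hC τ (by omega) v))
        (hD τ (by omega)) (by omega)
  refine ⟨hmid, ?_⟩
  obtain ⟨τ, hτ⟩ : ∃ τ, st.len = τ + 1 := ⟨st.len - 1, by omega⟩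
  rw [hτ]
  exact (hmid τ (by omega)).step_end (mem_stageHeard τ) hM
    (fun v => (Know.agree_rename ι M _).want (mem_stageHeard (τ + 1) v) (hC τ (by omega) v))
    (hD τ (by omega)) hτ.symm
    (fun v tag => (Know.agree_rename ι M _).label hτ.symm (mem_stageHeard (τ + 1) v)
      (hC τ (by omega) v) tag)

end Execution

/-! ## Networks of committees -/

/-- The committees between two stages. -/
structure Net (V : Type) where
  /-- the leader of the committee of a node -/
  ldr : V → V
  /-- the parent of a node in the tree of its committee -/
  par : V → V
  /-- the parent of a node in the forest that joins the merging committees -/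
  up : V → V
  /-- the successor of a node on the ring of its committee -/
  succ : Equiv.Perm V
  /-- the nodes of merging committees -/
  busy : Set V

lemma Equiv.Perm.IsCycleOn.congr_of_eq {V : Type*} [Finite V] {σ τ : Equiv.Perm V} {s : Set V}
    (h : σ.IsCycleOn s) (hs : ∀ x ∈ s, σ x = τ x) : τ.IsCycleOn s := by
  refine ⟨h.1.congr hs, fun x hx y hy => ?_⟩
  obtain ⟨i, rfl⟩ := h.exists_pow_eq' (Set.toFinite _) hx hy
  refine ⟨i, ?_⟩
  rw [zpow_natCast]
  clear hy
  induction i with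
  | zero => rfl
  | succ i ih =>
    rw [pow_succ', Equiv.Perm.mul_apply, ih, pow_succ', Equiv.Perm.mul_apply]
    exact (hs _ ((h.1.perm_pow i).mapsTo hx)).symm

namespace Net

variable {V : Type} (N : Net V) (G : SimpleGraph V)

/-- The committee of the leader `u`. -/
def comm (u : V) : Set V := {x | N.ldr x = u}

/-- The labels of the nodes, with the selected committees `T` and the Euler tour `E`. -/
def know (T : V → Set V) (E : V → Bool → Bool → Set V) : Know V
  | x, .pres => {x}
  | x, .nbr => G.neighborSet x
  | x, .ldr => {N.ldr x}
  | x, .succ => {N.succ x}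
  | x, .pred => {N.succ.symm x}
  | x, .par => {N.par x}
  | x, .busy => {y | y = x ∧ x ∈ N.busy}
  | x, .tgt => T x
  | x, .up => {N.up x}
  | _, .halt => ∅
  | x, .next b b' => E x b b'

/-- The active edges between two stages. -/
def graph : SimpleGraph V := G ⊔ graphOfMap N.succ ⊔ graphOfMap N.par

section Invariants

variable [LinearOrder V]

/-- The invariants of the committees. -/
structure Valid : Prop where
  ldr_ldr : ∀ x, N.ldr (N.ldr x) = N.ldr x
  le_ldr : ∀ x, x ≤ N.ldr x
  cycle : ∀ u, N.ldr u = u → N.succ.IsCycleOn (N.comm u)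
  par_eq : ∀ u, N.ldr u = u → ∀ i < (N.comm u).ncard,
    N.par ((N.succ ^ i) u) = (N.succ ^ (i - 2 ^ heapExp i)) u
  busy_ldr : ∀ x, N.ldr x ∈ N.busy ↔ x ∈ N.busy

/-- Inside a committee in `B` the forest follows the ring up to the port `a`, which is the leader
and a root of the forest or has its parent in a committee of greater UID. -/
def HasForest (B : Set V) : Prop := ∀ u ∈ B, N.ldr u = u → ∃ a, N.ldr a = u ∧
  (∀ x, N.ldr x = u → x ≠ a → N.up x = N.succ.symm x) ∧
  ((a = u ∧ N.up u = u) ∨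
    (u ∈ N.busy ∧ G.Adj a (N.up a) ∧ u < N.ldr (N.up a) ∧ N.up a ∈ N.busy))

end Invariants

open Classical in
/-- The committee that the committee of the leader `u` has selected. -/
noncomputable def sel (u : V) : Option V :=
  if h : u ∈ N.busy ∧ ∃ a, N.ldr a = u ∧ N.ldr (N.up a) ≠ u then some (N.ldr (N.up h.2.choose))
  else none

open Classical in
/-- The committees as required by GraphToWreath. -/
noncomputable def committees : Committees V where
  leader := N.ldr
  mode u := if u ∈ N.busy then .ringMerging else .selection
  sel := N.sel
  succ := N.succ
  parent := N.par
  moves _ := 0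

variable {N G}

lemma sel_eq_none_of_not_busy {u : V} (h : u ∉ N.busy) : N.sel u = none := by
  simp [sel, h]

lemma sel_eq_some_iff {u v : V} : N.sel u = some v → u ∈ N.busy ∧ ∃ a, N.ldr a = u ∧
    N.ldr (N.up a) ≠ u ∧ N.ldr (N.up a) = v := by
  unfold sel
  split_ifs with h
  · intro hv
    exact ⟨h.1, h.2.choose, h.2.choose_spec.1, h.2.choose_spec.2, Option.some.inj hv⟩
  · simp

variable [LinearOrder V]

namespace Valid

variable (hN : N.Valid)
include hN

lemma ldr_succ (x : V) : N.ldr (N.succ x) = N.ldr x :=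
  (hN.cycle _ (hN.ldr_ldr x)).1.mapsTo (show x ∈ N.comm (N.ldr x) from rfl)

lemma ldr_succ_symm (x : V) : N.ldr (N.succ.symm x) = N.ldr x := by
  conv_rhs => rw [← N.succ.apply_symm_apply x, hN.ldr_succ]

lemma enumerates [Finite V] {u : V} (hu : N.ldr u = u) :
    Enumerates (fun i => (N.succ ^ i) u) (N.comm u).ncard (N.comm u) :=
  (hN.cycle u hu).enumerates hu

lemma exists_pow [Finite V] {x y : V} (h : N.ldr x = N.ldr y) : ∃ i : ℕ, (N.succ ^ i) x = y :=
  (hN.cycle _ (hN.ldr_ldr x)).exists_pow_eq' (Set.toFinite _) rfl h.symm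

lemma know_comm [Finite V] (T E) (x : V) : (N.know G T E).comm x = N.comm (N.ldr x) := by
  ext y
  constructor
  · intro h
    induction h with
    | refl => rfl
    | tail _ h ih =>
      rw [show _ = N.succ _ from h]
      exact (hN.ldr_succ _).trans ih
  · intro h
    obtain ⟨i, rfl⟩ := hN.exists_pow (show N.ldr x = N.ldr y from h.symm)
    clear h
    induction i with
    | zero => exact .refl
    | succ i ih => rw [pow_succ']; exact ih.tail rfl

lemma heap_induce [Finite V] {u : V} (hu : N.ldr u = u) :
    IsCompleteBinaryTree ((graphOfMap N.par).induce (N.comm u)) ⟨u, hu⟩ ∧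
    IsRootedTreeOfDepth ((graphOfMap N.par).induce (N.comm u)) ⟨u, hu⟩
      (Nat.log 2 (N.comm u).ncard) := by
  have he := hN.enumerates hu
  have hmem : ∀ i : ℕ, (N.succ ^ i) u ∈ N.comm u := by
    intro i
    induction i with
    | zero => exact hu
    | succ i ih => rw [pow_succ']; exact (hN.ldr_succ _).trans ih
  have hpar : ∀ x ∈ N.comm u, N.par x ∈ N.comm u := by
    intro x hx
    obtain ⟨i, hi, rfl⟩ := he.surj x hx
    simp only [hN.par_eq u hu i hi]; exact hmem _
  have := isCompleteBinaryTree_of_heap (W := N.comm u)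
    (H := (graphOfMap N.par).induce (N.comm u))
    (f := fun i => ⟨(N.succ ^ i) u, hmem i⟩) (n := (N.comm u).ncard)
    (P := fun x => ⟨N.par x, hpar x x.2⟩)
    ⟨he.pos, fun i hi j hj h => he.inj i hi j hj (congrArg Subtype.val h),
      fun _ _ => Set.mem_univ _, fun x _ => by
        obtain ⟨i, hi, h⟩ := he.surj x x.2
        exact ⟨i, hi, Subtype.ext h⟩⟩
    (fun i hi => Subtype.ext (hN.par_eq u hu i hi))
    (fun x y => by
      rw [SimpleGraph.induce_adj, graphOfMap_adj]
      simp [Subtype.ext_iff])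
  exact ⟨this.1, this.2.2⟩

/-- The nodes of a committee are close to its leader. -/
lemma exists_walk [Finite V] (x : V) {j : ℕ} (hj : (N.comm (N.ldr x)).ncard ≤ 2 ^ j) :
    ∃ w : (N.graph G).Walk (N.ldr x) x, w.length ≤ j := by
  obtain ⟨hT, _, hd, _⟩ := hN.heap_induce (hN.ldr_ldr x)
  obtain ⟨w, hw⟩ := hT.1.1.exists_walk_length_eq_dist ⟨N.ldr x, hN.ldr_ldr x⟩ ⟨x, rfl⟩
  let f : (graphOfMap N.par).induce (N.comm (N.ldr x)) →g N.graph G :=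
    ⟨Subtype.val, fun h => Or.inr h⟩
  refine ⟨w.map f, ?_⟩
  rw [SimpleGraph.Walk.length_map, hw]
  exact (hd _).trans ((Nat.log_mono_right hj).trans (by simp))

end Valid

section Forest

variable {B : Set V} (hN : N.Valid) (hF : N.HasForest G B)
include hN hF

/-- The two kinds of committees of a forest. -/
lemma HasForest.sel_cases {u : V} (hu : u ∈ B) (hl : N.ldr u = u) :
    ∃ a, N.ldr a = u ∧ (∀ x, N.ldr x = u → x ≠ a → N.up x = N.succ.symm x) ∧
      ((a = u ∧ N.up u = u ∧ N.sel u = none) ∨ (u ∈ N.busy ∧ G.Adj a (N.up a) ∧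
        u < N.ldr (N.up a) ∧ N.up a ∈ N.busy ∧ N.sel u = some (N.ldr (N.up a)))) := by
  obtain ⟨a, ha, hup, h⟩ := hF u hu hl
  refine ⟨a, ha, hup, ?_⟩
  -- Only the port can have its parent in another committee, so the choice in `sel` is forced.
  have huniq : ∀ b, N.ldr b = u → N.ldr (N.up b) ≠ u → b = a := by
    intro b hb hne
    by_contra hba
    apply hne
    rw [hup b hb hba, hN.ldr_succ_symm, hb]
  have hsel : N.sel u = none ∨ ∃ v, N.sel u = some v := by
    cases N.sel u <;> simp
  rcases h with ⟨rfl, h⟩ | ⟨h1, h2, h3, h4⟩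
  · refine Or.inl ⟨rfl, h, ?_⟩
    rcases hsel with h' | ⟨v, h'⟩
    · exact h'
    · obtain ⟨_, b, hb, hne, _⟩ := sel_eq_some_iff h'
      rw [huniq b hb hne, h, hl] at hne
      exact absurd rfl hne
  · refine Or.inr ⟨h1, h2, h3, h4, ?_⟩
    have hex : u ∈ N.busy ∧ ∃ a, N.ldr a = u ∧ N.ldr (N.up a) ≠ u := ⟨h1, a, ha, h3.ne'⟩
    rw [sel, dif_pos hex, huniq _ hex.2.choose_spec.1 hex.2.choose_spec.2]

lemma HasForest.sel_some {u v : V} (hu : u ∈ B) (hl : N.ldr u = u) (h : N.sel u = some v) :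
    N.ldr v = v ∧ u < v ∧ u ∈ N.busy ∧ v ∈ N.busy := by
  obtain ⟨a, ha, hup, h' | ⟨h1, h2, h3, h4, h5⟩⟩ := hF.sel_cases hN hu hl
  · rw [h'.2.2] at h; cases h
  · rw [h5] at h
    cases h
    exact ⟨hN.ldr_ldr _, h3, h1, (hN.busy_ldr _).2 h4⟩

end Forest

lemma graph_eq (N : Net V) (G : SimpleGraph V) (T E) :
    N.graph G = SimpleGraph.fromRel fun x y => y ∈ (N.know G T E).base x := by
  ext x y
  have h1 : (N.know G T E).base x = G.neighborSet x ∪ {N.succ x} ∪ {N.par x} := rfl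
  have h2 : (N.know G T E).base y = G.neighborSet y ∪ {N.succ y} ∪ {N.par y} := rfl
  simp only [graph, SimpleGraph.sup_adj, graphOfMap_adj, SimpleGraph.fromRel_adj, h1, h2,
    Set.mem_union, SimpleGraph.mem_neighborSet, Set.mem_singleton_iff, @eq_comm _ y, @eq_comm _ x]
  have := G.adj_comm x y
  have h3 : G.Adj x y → x ≠ y := fun h => h.ne
  by_cases hxy : x = y
  · subst hxy; simp
  · have h4 : y ≠ x := Ne.symm hxy
    tauto

/-- Between two stages, the committees are as GraphToWreath wants them. -/
lemma Valid.isWreath [Finite V] (hN : N.Valid) {s : Committees V} {D : SimpleGraph V} {u : V}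
    (hu : N.ldr u = u) (hl : s.leader = N.ldr)
    (hs : ∀ x ∈ N.comm u, s.succ x = N.succ x ∧ s.parent x = N.par x)
    (hD : ∀ x ∈ N.comm u, ∀ y ∈ N.comm u, D.Adj x y ↔ (N.graph G).Adj x y) :
    s.IsWreath G D u := by
  have hc : s.committee u = N.comm u := by simp only [Committees.committee, hl]; rfl
  have hpar : (graphOfMap s.parent).induce (N.comm u) = (graphOfMap N.par).induce (N.comm u) := by
    ext x y
    simp only [SimpleGraph.induce_adj, graphOfMap_adj, (hs x x.2).2, (hs y y.2).2]
  refine ⟨?_, ?_, ?_⟩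
  · rw [hc]
    exact (hN.cycle u hu).congr_of_eq fun x hx => (hs x hx).1.symm
  · rw [hc, hpar]
    exact ⟨hu, (hN.heap_induce hu).1⟩
  · rw [hc]
    ext x y
    simp only [SimpleGraph.induce_adj, hD x x.2 y y.2, graph, SimpleGraph.sup_adj, graphOfMap_adj,
      (hs x x.2).1, (hs y y.2).1, (hs x x.2).2, (hs y y.2).2]
    tauto

/-- Between stages all committees are in selection or ring merging mode, so the clauses on tree
merging and termination are void. -/
lemma realised [Finite V] (hN : N.Valid) (hF : N.HasForest G N.busy) (ι : V ↪o ℕ) :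
    N.committees.Realised G (N.graph G) ι where
  leader_leader := hN.ldr_ldr
  uid_le_leader x := ι.le_iff_le.2 (hN.le_ldr x)
  keeps_initial _ := fun x y h => Or.inl (Or.inl h)
  sel_selection u hu hm := by
    apply sel_eq_none_of_not_busy
    intro hb
    simp [committees, hb] at hm
  wreath u hu hm := hN.isWreath hu rfl (fun x _ => ⟨rfl, rfl⟩) fun x _ y _ => Iff.rfl
  sel_merging u v hu hs := by
    have hb := (sel_eq_some_iff hs).1
    obtain ⟨h1, h2, h3, h4⟩ := hF.sel_some hN hb hu hs
    exact ⟨h1, ι.lt_iff_lt.2 h2, by simp [committees, h3, h4]⟩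
  treeMerging r hr hm := by
    simp only [committees] at hm
    split_ifs at hm
  termination u hu hm := by
    simp only [committees] at hm
    split_ifs at hm

end Net

/-! ## Flooding -/

section Flood

variable {V : Type} [LinearOrder V] {M : Know V} {st : Stage} {D : SimpleGraph V}

/-- As long as the graph is `D`, information travels one edge per round. -/
lemma mem_stageHeard_of_walk {τ : ℕ} (h : ∀ σ < τ, stageGraph M st D σ = D) {v x : V}
    (w : D.Walk v x) (hw : w.length ≤ τ) : x ∈ stageHeard M st D τ v := by
  induction τ generalizing v with
  | zero =>
    cases w with
    | nil => rfl
    | cons _ _ => simp at hw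
  | succ τ ih =>
    cases w with
    | nil => exact mem_stageHeard _ _
    | cons hadj w' =>
      refine Or.inr ⟨_, ?_, ih (fun σ hσ => h σ (by omega)) w' ?_⟩
      · rw [h τ (by omega)]; exact hadj
      · rw [SimpleGraph.Walk.length_cons] at hw; omega

end Flood

/-! ## The forest of the merging committees -/

namespace Net

variable {V : Type} [LinearOrder V] {N : Net V} {G : SimpleGraph V}

/-- The selection is read off from the port alone, so it can be compared before and after a change
of the committees. -/
lemma sel_of_port (hN : N.Valid) {u a : V} (hl : N.ldr u = u) (ha : N.ldr a = u)
    (hup : ∀ x, N.ldr x = u → x ≠ a → N.up x = N.succ.symm x) :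
    (a = u → N.up u = u → N.sel u = none) ∧
    (u ∈ N.busy → u < N.ldr (N.up a) → N.sel u = some (N.ldr (N.up a))) := by
  have huniq : ∀ b, N.ldr b = u → N.ldr (N.up b) ≠ u → b = a := by
    intro b hb hne
    by_contra hba
    apply hne
    rw [hup b hb hba, hN.ldr_succ_symm, hb]
  constructor
  · rintro rfl h
    cases hs : N.sel a with
    | none => rfl
    | some v =>
      obtain ⟨_, b, hb, hne, _⟩ := sel_eq_some_iff hs
      rw [huniq b hb hne, h, hl] at hne
      exact absurd rfl hne
  · intro h1 h3
    have hex : u ∈ N.busy ∧ ∃ a, N.ldr a = u ∧ N.ldr (N.up a) ≠ u := ⟨h1, a, ha, h3.ne'⟩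
    rw [sel, dif_pos hex, huniq _ hex.2.choose_spec.1 hex.2.choose_spec.2]

lemma HasForest.mono {B B' : Set V} (h : N.HasForest G B) (hB : B' ⊆ B) : N.HasForest G B' :=
  fun u hu => h u (hB hu)

/-! ### Roots of the forest and roots of the selection trees -/

section Roots

variable [Finite V] (hN : N.Valid) (hF : N.HasForest G Set.univ)
include hN hF

/-- Every node of a committee reaches the port of its committee. -/
lemma HasForest.port (x : V) : ∃ a, N.ldr a = N.ldr x ∧ (∃ k, N.up^[k] x = a) ∧
    ((a = N.ldr x ∧ N.up a = a ∧ N.sel a = none) ∨ (N.ldr x ∈ N.busy ∧ G.Adj a (N.up a) ∧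
        N.ldr x < N.ldr (N.up a) ∧ N.up a ∈ N.busy ∧
        N.sel (N.ldr x) = some (N.ldr (N.up a)))) := by
  obtain ⟨a, ha, hup, h⟩ := hF.sel_cases hN (Set.mem_univ (N.ldr x)) (hN.ldr_ldr x)
  refine ⟨a, ha, ?_, ?_⟩
  · obtain ⟨i, hi⟩ := hN.exists_pow ha
    clear h
    induction i generalizing x with
    | zero => exact ⟨0, hi.symm⟩
    | succ i ih =>
      by_cases hxa : x = a
      · exact ⟨0, hxa⟩
      · have hux := hup x rfl hxa
        have hl : N.ldr (N.up x) = N.ldr x := by rw [hux, hN.ldr_succ_symm]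
        obtain ⟨k, hk⟩ := ih (N.up x) (by rw [hl, ha]) (by rwa [hl])
          (by rw [hux, ← hi, pow_succ', Equiv.Perm.mul_apply, Equiv.symm_apply_apply])
        exact ⟨k + 1, hk⟩
  · rcases h with ⟨h1, h2, h3⟩ | h
    · exact Or.inl ⟨h1, by rw [h1, h2], by rw [h1, h3]⟩
    · exact Or.inr h

/-- Within a committee the ring leads to the port, and the port leads to a committee with a greater
leader; this stops by induction on UIDs. -/
lemma HasForest.isForest : IsForest N.up := by
  intro x
  induction hu : N.ldr x using WellFoundedGT.induction generalizing x with
  | _ u ih =>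
    subst hu
    obtain ⟨a, ha, ⟨k, hk⟩, h | h⟩ := hF.port hN x
    · exact ⟨k, by rw [hk, h.2.1]⟩
    · obtain ⟨k', hk'⟩ := ih _ h.2.2.1 (N.up a) rfl
      refine ⟨k' + 1 + k, ?_⟩
      rw [Function.iterate_add_apply, hk, Function.iterate_succ_apply, hk']

/-- A committee is a root, or its nodes have the root of the committee that it has selected. -/
lemma HasForest.root_cases (u : V) (hu : N.ldr u = u) :
    ((∀ x, N.ldr x = u → treeRoot N.up x = u) ∧ N.up u = u ∧ N.sel u = none) ∨
    ∃ a, N.ldr a = u ∧ G.Adj a (N.up a) ∧ u ∈ N.busy ∧ u < N.ldr (N.up a) ∧ N.up a ∈ N.busy ∧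
      N.sel u = some (N.ldr (N.up a)) ∧
      ∀ x, N.ldr x = u → treeRoot N.up x = treeRoot N.up (N.up a) := by
  have hp := hF.isForest hN
  obtain ⟨a, ha, hup, h⟩ := hF.sel_cases hN (Set.mem_univ u) hu
  have hroot : ∀ x, N.ldr x = u → treeRoot N.up x = treeRoot N.up a := by
    intro x hx
    obtain ⟨i, rfl⟩ := hN.exists_pow (ha.trans hx.symm)
    clear hx
    induction i with
    | zero => rfl
    | succ i ih =>
      by_cases hxa : (N.succ ^ (i + 1)) a = a
      · rw [hxa]
      · have hl : ∀ i, N.ldr ((N.succ ^ i) a) = u := by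
          intro i
          induction i with
          | zero => exact ha
          | succ i ih => rw [pow_succ', Equiv.Perm.mul_apply, hN.ldr_succ, ih]
        rw [← hp.root_parent, hup _ (hl _) hxa, pow_succ', Equiv.Perm.mul_apply,
          Equiv.symm_apply_apply, ih]
  rcases h with ⟨rfl, h2, h3⟩ | ⟨h1, h2, h3, h4, h5⟩
  · exact Or.inl ⟨fun x hx => (hroot x hx).trans (treeRoot_of_fixed h2), h2, h3⟩
  · exact Or.inr ⟨a, ha, h2, h1, h3, h4, h5, fun x hx => by rw [hroot x hx, hp.root_parent]⟩

lemma HasForest.root_eq_of_ldr {x y : V} (h : N.ldr x = N.ldr y) :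
    treeRoot N.up x = treeRoot N.up y := by
  rcases hF.root_cases hN (N.ldr y) (hN.ldr_ldr y) with h' | ⟨a, h'⟩
  · rw [h'.1 x h, h'.1 y rfl]
  · rw [h'.2.2.2.2.2.2 x h, h'.2.2.2.2.2.2 y rfl]

/-- Hence the root has the greatest UID of its tree and may lead the merged committee. -/
lemma HasForest.ldr_le_root (x : V) : N.ldr x ≤ treeRoot N.up x := by
  induction hu : N.ldr x using WellFoundedGT.induction generalizing x with
  | _ u ih =>
    subst hu
    rcases hF.root_cases hN (N.ldr x) (hN.ldr_ldr x) with h' | ⟨a, h'⟩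
    · rw [h'.1 x rfl]
    · rw [h'.2.2.2.2.2.2 x rfl]
      exact h'.2.2.2.1.le.trans (ih _ h'.2.2.2.1 _ rfl)

lemma HasForest.root_ldr (x : V) : N.ldr (treeRoot N.up x) = treeRoot N.up x ∧
    N.sel (treeRoot N.up x) = none ∧ (treeRoot N.up x ∈ N.busy ↔ x ∈ N.busy) := by
  induction hu : N.ldr x using WellFoundedGT.induction generalizing x with
  | _ u ih =>
    subst hu
    rcases hF.root_cases hN (N.ldr x) (hN.ldr_ldr x) with h' | ⟨a, h'⟩
    · rw [h'.1 x rfl]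
      exact ⟨hN.ldr_ldr x, h'.2.2, hN.busy_ldr x⟩
    · rw [h'.2.2.2.2.2.2 x rfl]
      obtain ⟨h1, h2, h3⟩ := ih _ h'.2.2.2.1 (N.up a) rfl
      refine ⟨h1, h2, h3.trans ?_⟩
      rw [← hN.busy_ldr x]
      exact iff_of_true h'.2.2.2.2.1 h'.2.2.1

lemma HasForest.reflTransGen_root (x : V) :
    Relation.ReflTransGen (fun a b => N.sel a = some b) (N.ldr x) (treeRoot N.up x) := by
  induction hu : N.ldr x using WellFoundedGT.induction generalizing x with
  | _ u ih =>
    subst hu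
    rcases hF.root_cases hN (N.ldr x) (hN.ldr_ldr x) with h' | ⟨a, h'⟩
    · rw [h'.1 x rfl]
    · rw [h'.2.2.2.2.2.2 x rfl]
      exact (ih _ h'.2.2.2.1 (N.up a) rfl).head h'.2.2.2.2.2.1

/-- Translates the selection trees of committees into trees of the node forest `up`. -/
lemma HasForest.hasRoot_iff {s : Committees V} (hs : s.sel = N.sel) (x r : V) :
    s.HasRoot (N.ldr x) r ↔ treeRoot N.up x = r := by
  unfold Committees.HasRoot
  rw [hs]
  constructor
  · rintro ⟨h1, h2⟩
    have : ∀ u v, Relation.ReflTransGen (fun a b => N.sel a = some b) u v → N.ldr u = u →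
        N.ldr v = v ∧ treeRoot N.up u = treeRoot N.up v := by
      intro u v h hu
      induction h with
      | refl => exact ⟨hu, rfl⟩
      | tail _ h ih =>
        rcases hF.root_cases hN _ ih.1 with h' | ⟨a, h'⟩
        · rw [h'.2.2] at h; cases h
        · rw [h'.2.2.2.2.2.1] at h
          cases h
          refine ⟨hN.ldr_ldr _, ?_⟩
          rw [ih.2, h'.2.2.2.2.2.2 _ ih.1]
          exact hF.root_eq_of_ldr hN (hN.ldr_ldr _).symm
    obtain ⟨h3, h4⟩ := this _ _ h2 (hN.ldr_ldr x)
    rw [hF.root_eq_of_ldr hN (hN.ldr_ldr x).symm, h4]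
    rcases hF.root_cases hN r h3 with h' | ⟨a, h'⟩
    · exact h'.1 r h3
    · rw [h'.2.2.2.2.2.1] at h1; cases h1
  · rintro rfl
    exact ⟨(hF.root_ldr hN x).2.1, hF.reflTransGen_root hN x⟩

omit [Finite V] in
/-- The forest consists of ring edges and edges of the initial graph. -/
lemma HasForest.up_cases (x : V) : N.up x = x ∨ N.up x = N.succ.symm x ∨ G.Adj x (N.up x) := by
  obtain ⟨a, ha, hup, h⟩ := hF _ (Set.mem_univ (N.ldr x)) (hN.ldr_ldr x)
  by_cases hx : x = a
  · subst hx
    rcases h with h | h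
    · left; rw [← h.1] at h; exact h.2
    · exact Or.inr (Or.inr h.2.1)
  · exact Or.inr (Or.inl (hup x rfl hx))

omit [Finite V] in
lemma HasForest.up_adj (x : V) : N.up x = x ∨ (N.graph G).Adj x (N.up x) := by
  by_cases hx : N.up x = x
  · exact Or.inl hx
  rcases hF.up_cases hN x with h | h | h
  · exact Or.inl h
  · refine Or.inr (Or.inl (Or.inr ?_))
    rw [graphOfMap_adj]
    exact ⟨Ne.symm hx, Or.inr (by rw [h, Equiv.apply_symm_apply])⟩
  · exact Or.inr (Or.inl (Or.inl h))

end Roots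

end Net

/-! ## Executions of GraphToWreath -/

section Reach

variable {V : Type} [LinearOrder V] (ι : V ↪o ℕ) (G : SimpleGraph V) (K : ℕ)

/-- The first `t` rounds are an execution of GraphToWreath that ends with the committees `s`. -/
inductive Reach : ℕ → Committees V → Prop
  | zero : Committees.initial.Realised G (graphToWreath.run ι G 0).graph ι → Reach 0 .initial
  | succ {t : ℕ} {s s' : Committees V} : Reach t s →
      (∀ v, ¬ graphToWreath.halted ((graphToWreath.run ι G t).state v)) →
      (∀ u, s.leader u = u → s.Evolves G ι s' u) →
      s'.Realised G (graphToWreath.run ι G (t + 1)).graph ι →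
      (∀ v, (((graphToWreath.run ι G (t + 1)).graph \ G).neighborSet v).ncard ≤ K) →
      Reach (t + 1) s'

variable {ι G K}

lemma Reach.exists_seq {t : ℕ} {c : Committees V} (h : Reach ι G K t c) :
    ∃ s : ℕ → Committees V, s 0 = .initial ∧ s t = c ∧
      (∀ i ≤ t, (s i).Realised G (graphToWreath.run ι G i).graph ι) ∧
      (∀ i < t, ∀ u, (s i).leader u = u → (s i).Evolves G ι (s (i + 1)) u) ∧
      (∀ i < t, ∀ v, ¬ graphToWreath.halted ((graphToWreath.run ι G i).state v)) ∧
      (∀ i ≤ t, ∀ v, (((graphToWreath.run ι G i).graph \ G).neighborSet v).ncard ≤ K) := by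
  induction h with
  | zero h =>
    refine ⟨fun _ => .initial, rfl, rfl, ?_, by simp, by simp, ?_⟩
    · intro i hi
      rw [Nat.le_zero.1 hi]; exact h
    · intro i hi v
      rw [Nat.le_zero.1 hi]
      simp [Algorithm.run, SimpleGraph.neighborSet]
  | @succ t s c _ hh hE hR hK ih =>
    obtain ⟨s', h0, h1, h2, h3, h4, h5⟩ := ih
    subst h1
    have hlt : ∀ i ≤ t, (if i ≤ t then s' i else c) = s' i := fun i hi => if_pos hi
    refine ⟨fun i => if i ≤ t then s' i else c, by simpa using h0, by simp, ?_, ?_, ?_, ?_⟩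
    · intro i hi
      rcases Nat.le_succ_iff.1 hi with hi | rfl
      · simpa only [hlt i hi] using h2 i hi
      · simpa using hR
    · intro i hi
      rcases Nat.lt_succ_iff_lt_or_eq.1 hi with hi | rfl
      · simpa only [hlt i hi.le, hlt (i + 1) hi] using h3 i hi
      · simpa using hE
    · intro i hi
      rcases Nat.lt_succ_iff_lt_or_eq.1 hi with hi | rfl
      · exact h4 i hi
      · exact hh
    · intro i hi
      rcases Nat.le_succ_iff.1 hi with hi | rfl
      · exact h5 i hi
      · exact hK

variable {t : ℕ} {st : Stage} {M : Know V} {D : SimpleGraph V}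

lemma Reach.step {τ : ℕ} {s s' : Committees V} {S : V → Set V} {D' : SimpleGraph V}
    (h : Reach ι G K t s) (hA : At ι G t st τ M S D) (hS : ∀ v, v ∈ S v)
    (hM : ∀ v, M v .halt = ∅) (hA' : (graphToWreath.run ι G (t + 1)).graph = D')
    (hE : ∀ u, s.leader u = u → s.Evolves G ι s' u) (hR : s'.Realised G D' ι)
    (hK : ∀ v, ((D' \ G).neighborSet v).ncard ≤ K) : Reach ι G K (t + 1) s' :=
  h.succ (fun v => by rw [hA.halted_iff hS, hM]; exact fun h => h) hE (hA' ▸ hR) (hA' ▸ hK)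

/-- As long as the graph does not change, the committees need not change. -/
lemma Reach.stay {n : ℕ} {s : Committees V} (h : Reach ι G K t s)
    (hA : ∀ τ < n, At ι G (t + τ) st τ M (stageHeard M st D τ) D)
    (hM : ∀ v, M v .halt = ∅) (hE : ∀ u, s.leader u = u → s.Evolves G ι s u)
    (hR : s.Realised G D ι) (hK : ∀ v, ((D \ G).neighborSet v).ncard ≤ K) {τ : ℕ} (hτ : τ < n) :
    Reach ι G K (t + τ) s := by
  induction τ with
  | zero => exact h
  | succ τ ih =>
    exact (ih (by omega)).step (hA τ (by omega)) (mem_stageHeard τ) hM (hA (τ + 1) hτ).1 hE hR hK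

end Reach

/-! ## Degrees -/

/-- A child of `g` either has made all `t` moves so far, and lies `2 ^ t` behind `g`, or has
finished and is one of the two final children. -/
lemma eq_add_of_heapParent_eq {t k g : ℕ} (hk : 0 < k) (h : heapParent t k = g) :
    k = g + 2 ^ t ∨ k = g + 2 ^ Nat.log 2 (g + 1) ∨ k = g + 2 ^ (Nat.log 2 (g + 1) + 1) := by
  have hle := two_pow_min_le (t := t) hk
  unfold heapParent at h
  rcases le_total t (heapExp k) with ht | ht
  · rw [min_eq_left ht] at h hle; omega
  · rw [min_eq_right ht] at h hle
    obtain ⟨h1, h2⟩ := heapExp_bounds hk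
    have hL1 : 2 ^ Nat.log 2 (g + 1) ≤ g + 1 := Nat.pow_log_le_self 2 (by omega)
    have hL2 : g + 1 < 2 ^ (Nat.log 2 (g + 1) + 1) := Nat.lt_pow_succ_log_self (by norm_num) _
    have h3 : Nat.log 2 (g + 1) < heapExp k + 1 := by
      rw [← Nat.pow_lt_pow_iff_right (a := 2) (by norm_num), pow_succ]; omega
    have h4 : heapExp k < Nat.log 2 (g + 1) + 2 := by
      rw [← Nat.pow_lt_pow_iff_right (a := 2) (by norm_num), pow_succ]; omega
    have h5 : heapExp k = Nat.log 2 (g + 1) ∨ heapExp k = Nat.log 2 (g + 1) + 1 := by omega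
    rcases h5 with h5 | h5 <;> rw [h5] at h hle <;> omega

lemma Set.ncard_triple_le {α : Type*} (a b c : α) : ({a, b, c} : Set α).ncard ≤ 3 := by
  have h1 := Set.ncard_insert_le a {b, c}
  have h2 := Set.ncard_insert_le b {c}
  rw [Set.ncard_singleton] at h2
  omega

lemma Set.ncard_pair_le' {α : Type*} (a b : α) : ({a, b} : Set α).ncard ≤ 2 := by
  have h2 := Set.ncard_insert_le a {b}
  rw [Set.ncard_singleton] at h2
  omega

/-- A node has at most three children while LineToCompleteBinaryTree runs. -/
lemma Enumerates.ncard_children_le {V : Type*} [Finite V] {f : ℕ → V} {n : ℕ} {S : Set V}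
    (hf : Enumerates f n S) {P : V → V} {t : ℕ} (hP : ∀ i < n, P (f i) = f (heapParent t i))
    {v : V} (hv : v ∈ S) : {w | w ∈ S ∧ w ≠ v ∧ P w = v}.ncard ≤ 3 := by
  obtain ⟨g, hg, rfl⟩ := hf.surj v hv
  refine le_trans (Set.ncard_le_ncard ?_ (Set.toFinite _)) (Set.ncard_triple_le (f (g + 2 ^ t))
    (f (g + 2 ^ Nat.log 2 (g + 1))) (f (g + 2 ^ (Nat.log 2 (g + 1) + 1))))
  rintro w ⟨hw, hne, hPw⟩
  obtain ⟨k, hk, rfl⟩ := hf.surj w hw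
  rw [hP k hk] at hPw
  have hkg := hf.inj _ ((heapParent_le t k).trans_lt hk) _ hg hPw
  have hk0 : 0 < k := by
    rcases Nat.eq_zero_or_pos k with rfl | h
    · rw [heapParent_zero_right] at hkg; exact absurd (by rw [hkg]) hne
    · exact h
  rcases eq_add_of_heapParent_eq hk0 hkg with h | h | h <;> simp [← h]

namespace Net

variable {V : Type} [LinearOrder V] {N : Net V} {G : SimpleGraph V}

/-- The labels of the nodes at the beginning of a slot. -/
abbrev plain (N : Net V) (G : SimpleGraph V) : Know V := N.know G (fun _ => ∅) fun _ _ _ => ∅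

section Valid

variable [Finite V] (hN : N.Valid)
include hN

omit [Finite V] in
lemma Valid.par_heap {u : V} (hu : N.ldr u = u) {i : ℕ} (hi : i < (N.comm u).ncard) {t : ℕ}
    (ht : heapExp i ≤ t) : N.par ((N.succ ^ i) u) = (N.succ ^ heapParent t i) u := by
  rw [hN.par_eq u hu i hi, heapParent_eq_of_le ht]

lemma Valid.ldr_par (x : V) : N.ldr (N.par x) = N.ldr x := by
  have he := hN.enumerates (hN.ldr_ldr x)
  obtain ⟨i, hi, h⟩ := he.surj x rfl
  have h2 := hN.par_eq _ (hN.ldr_ldr x) i hi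
  have h : (N.succ ^ i) (N.ldr x) = x := h
  rw [h] at h2
  rw [h2]
  exact he.mem _ ((Nat.sub_le _ _).trans_lt hi)

lemma Valid.ncard_children_le (v : V) : {w | w ≠ v ∧ N.par w = v}.ncard ≤ 3 := by
  have he := hN.enumerates (hN.ldr_ldr v)
  refine le_trans (Set.ncard_le_ncard ?_ (Set.toFinite _))
    -- The tree is the state of the line after as many rounds as there are nodes, when every node
    -- has finished.
    (he.ncard_children_le (P := N.par) (t := (N.comm (N.ldr v)).ncard) (fun i hi =>
      hN.par_heap (hN.ldr_ldr v) hi ((heapExp_le (j := i) Nat.lt_two_pow_self).trans hi.le))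
      (v := v) rfl)
  rintro w ⟨h1, h2⟩
  refine ⟨?_, h1, h2⟩
  have := hN.ldr_par w
  rw [h2] at this
  exact this.symm

/-- The degrees of the graph of active edges between two stages. -/
lemma Valid.ncard_base_le (v : V) :
    {w | v ≠ w ∧ (N.succ v = w ∨ N.succ w = v ∨ N.par v = w ∨ N.par w = v)}.ncard ≤ 6 := by
  have h1 := Set.ncard_triple_le (N.succ v) (N.succ.symm v) (N.par v)
  have h2 := hN.ncard_children_le v
  refine le_trans (Set.ncard_le_ncard (t := {N.succ v, N.succ.symm v, N.par v} ∪
    {w | w ≠ v ∧ N.par w = v}) ?_ (Set.toFinite _)) ((Set.ncard_union_le _ _).trans (by omega))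
  rintro w ⟨hne, h | h | h | h⟩
  · exact Or.inl (Or.inl h.symm)
  · exact Or.inl (Or.inr (Or.inl (by rw [← h, Equiv.symm_apply_apply])))
  · exact Or.inl (Or.inr (Or.inr h.symm))
  · exact Or.inr ⟨hne.symm, h⟩

lemma Valid.degree_graph_le (v : V) : (((N.graph G) \ G).neighborSet v).ncard ≤ 6 := by
  refine le_trans (Set.ncard_le_ncard ?_ (Set.toFinite _)) (hN.ncard_base_le v)
  rintro w ⟨h1, h2⟩
  simp only [graph, SimpleGraph.sup_adj, graphOfMap_adj] at h1
  refine ⟨?_, ?_⟩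
  · rcases h1 with (h | h) | h
    · exact h.ne
    · exact h.1
    · exact h.1
  · tauto

lemma Valid.committees_evolves_self (ι : V → ℕ) (u : V) :
    N.committees.Evolves G ι N.committees u := by
  by_cases hb : u ∈ N.busy
  · simp only [Committees.Evolves, committees, hb, if_true]
    exact ⟨trivial, Or.inl ⟨trivial, fun x hx => ⟨hx, rfl, rfl⟩⟩⟩
  · simp only [Committees.Evolves, committees, hb, if_false]
    exact Or.inl ⟨trivial, fun x hx => ⟨hx, rfl, rfl⟩⟩

/-- The graph is large enough for a node to hear of its committee and of the neighbours. -/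
lemma Valid.exists_walk_comm {x z : V} (hz : N.ldr z = N.ldr x) {j : ℕ}
    (hj : (N.comm (N.ldr x)).ncard ≤ 2 ^ j) : ∃ w : (N.graph G).Walk x z, w.length ≤ 2 * j := by
  obtain ⟨w1, h1⟩ := hN.exists_walk (G := G) x hj
  obtain ⟨w2, h2⟩ := hN.exists_walk (G := G) z (by rwa [hz])
  refine ⟨w1.reverse.append (w2.copy (by rw [hz]) rfl), ?_⟩
  simp only [SimpleGraph.Walk.length_append, SimpleGraph.Walk.length_reverse,
    SimpleGraph.Walk.length_copy]
  omega

/-- Any node of the committee is reached through the leader in `2 * j` steps, and one further step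
leads to its neighbours. -/
lemma Valid.commCovered {T E} {st : Stage} {x : V} {j τ : ℕ}
    (hj : (N.comm (N.ldr x)).ncard ≤ 2 ^ j) (hτ : 2 * j + 1 ≤ τ)
    (hD : ∀ σ < τ, stageGraph (N.know G T E) st (N.graph G) σ = N.graph G) :
    (N.know G T E).CommCovered (stageHeard (N.know G T E) st (N.graph G) τ x) x := by
  intro z hz
  rw [hN.know_comm] at hz
  obtain ⟨w, hw⟩ := hN.exists_walk_comm (G := G) hz hj
  refine ⟨mem_stageHeard_of_walk hD w (by omega), fun y hy => ?_⟩
  have hadj : (N.graph G).Adj z y := Or.inl (Or.inl hy)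
  refine mem_stageHeard_of_walk hD (w.concat hadj) ?_
  rw [SimpleGraph.Walk.length_concat]; omega

lemma Valid.mem_know_cand {T E} {x u : V} : u ∈ (N.know G T E).cand x ↔
    ∃ z, N.ldr z = N.ldr x ∧ ∃ y, G.Adj z y ∧ y ∉ N.busy ∧ u = N.ldr y ∧ N.ldr x < u := by
  simp only [Know.cand, hN.know_comm, know, Set.mem_ofPred_eq, comm, SimpleGraph.mem_neighborSet,
    Set.mem_singleton_iff, exists_eq_left, Set.eq_empty_iff_forall_notMem, not_and, forall_eq]

lemma Valid.mem_know_target {T E} {x u : V} : u ∈ (N.know G T E).target x ↔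
    x ∉ N.busy ∧ IsGreatest {u | ∃ z, N.ldr z = N.ldr x ∧ ∃ y, G.Adj z y ∧ y ∉ N.busy ∧
      u = N.ldr y ∧ N.ldr x < u} u := by
  have : (N.know G T E).cand x = {u | ∃ z, N.ldr z = N.ldr x ∧ ∃ y, G.Adj z y ∧ y ∉ N.busy ∧
      u = N.ldr y ∧ N.ldr x < u} := Set.ext fun u => hN.mem_know_cand
  simp only [Know.target, this, know, Set.mem_ofPred_eq, Set.eq_empty_iff_forall_notMem, not_and,
    forall_eq]

lemma Valid.know_alone {T E} {x : V} : (N.know G T E).Alone x ↔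
    x ∉ N.busy ∧ ∀ z, N.ldr z = N.ldr x → ∀ y, G.Adj z y → N.ldr y = N.ldr x := by
  simp only [Know.Alone, hN.know_comm, know, comm, SimpleGraph.mem_neighborSet, Set.mem_ofPred_eq,
    Set.eq_empty_iff_forall_notMem, not_and, forall_eq, Set.singleton_eq_singleton_iff]

/-- A committee of a connected graph that has no neighbouring committee contains all nodes. -/
lemma Valid.alone_univ {T E} {x : V} (hG : G.Connected) (h : (N.know G T E).Alone x) :
    N.busy = ∅ ∧ ∀ y, N.ldr y = N.ldr x := by
  rw [hN.know_alone] at h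
  have hall : ∀ y, N.ldr y = N.ldr x := by
    intro y
    obtain ⟨w⟩ := hG.preconnected y x
    induction w with
    | nil => rfl
    | cons hadj w ih => exact h.2 _ (ih h) _ hadj.symm
  refine ⟨Set.eq_empty_iff_forall_notMem.2 fun y hy => h.1 ?_, hall⟩
  rw [← hN.busy_ldr] at hy ⊢
  rwa [← hall y]

end Valid

end Net

/-! ## The first three stages of a slot -/

/-- After `T` rounds GraphToWreath has terminated. -/
def Finished {V : Type} [LinearOrder V] (ι : V ↪o ℕ) (G : SimpleGraph V) (K T : ℕ) : Prop :=
  ∃ s r, Reach ι G K T s ∧ (∀ x, s.leader x = r) ∧ s.mode r = .termination ∧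
    (graphToWreath.run ι G T).graph = graphOfMap s.parent ∧
    graphToWreath.ElectsLeader ι G T r ∧
    (∀ v, graphToWreath.halted ((graphToWreath.run ι G T).state v)) ∧ (∀ v, v ≤ r) ∧
    IsRootedTreeOfDepth (graphToWreath.run ι G T).graph r (Nat.log 2 (Nat.card V)) ∧
    IsCompleteBinaryTree (graphToWreath.run ι G T).graph r

/-- At the beginning of round `t + 1` a stage begins. -/
structure Ready {V : Type} [LinearOrder V] (ι : V ↪o ℕ) (G : SimpleGraph V) (K t : ℕ) (st : Stage)
    (N : Net V) (T : V → Set V) (E : V → Bool → Bool → Set V) : Prop where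
  start : At ι G t st 0 (N.know G T E) (fun v => {v}) (N.graph G)
  reach : Reach ι G K t N.committees
  valid : N.Valid
  forest : N.HasForest G N.busy

namespace Ready

variable {V : Type} [LinearOrder V] [Finite V] {ι : V ↪o ℕ} {G : SimpleGraph V} {K t j : ℕ}
  {st : Stage} {N : Net V} {T : V → Set V} {E : V → Bool → Bool → Set V}

lemma stay (h : Ready ι G K t st N T E) (hK : 6 ≤ K) {n : ℕ}
    (hA : ∀ τ < n, At ι G (t + τ) st τ (N.know G T E) (stageHeard (N.know G T E) st (N.graph G) τ)
      (N.graph G)) {τ : ℕ} (hτ : τ < n) : Reach ι G K (t + τ) N.committees :=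
  h.reach.stay hA (fun _ => rfl) (fun u _ => h.valid.committees_evolves_self _ u)
    (Net.realised h.valid h.forest ι) (fun v => (h.valid.degree_graph_le v).trans hK) hτ

omit [Finite V] in
lemma base_adj {x y : V} (h : y ∈ (N.know G T E).base x) : y = x ∨ (N.graph G).Adj x y := by
  rw [N.graph_eq G T E, SimpleGraph.fromRel_adj]
  by_cases hyx : y = x
  · exact Or.inl hyx
  · exact Or.inr ⟨Ne.symm hyx, Or.inl h⟩

/-- In a connected graph, a committee without neighbours contains all nodes. So either all nodes
find out in the same round that they are alone and terminate together, or nobody does and only the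
target labels change. -/
theorem select (h : Ready ι G K t (.select j) N (fun _ => ∅) fun _ _ _ => ∅) (hG : G.Connected)
    (hsize : ∀ x ∉ N.busy, (N.comm (N.ldr x)).ncard ≤ 2 ^ j) (hK : 6 ≤ K) :
    Finished ι G K (t + (2 * j + 2)) ∨
    (¬ (N.busy = ∅ ∧ ∀ x y, N.ldr x = N.ldr y)) ∧
      Ready ι G K (t + (2 * j + 2)) (.join j) N (N.plain G).target fun _ _ _ => ∅ := by
  have hN := h.valid
  set M := N.plain G with hM
  have hwant : ∀ τ, τ + 1 ≠ (Stage.select j).len → ∀ x, M.want (.select j) τ x = M.base x :=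
    fun τ hτ x => if_neg fun h => hτ h.1
  have hgraph : ∀ τ < 2 * j + 2, stageGraph M (.select j) (N.graph G) τ = N.graph G := by
    intro τ hτ
    cases τ with
    | zero => rfl
    | succ τ =>
      rw [N.graph_eq G (fun _ => ∅) fun _ _ _ => ∅]
      simp only [stageGraph]
      congr! 4
      rw [hwant τ (by simp only [Stage.len]; omega)]
  have hwb : ∀ τ x, M.want (.select j) τ x ⊆ M.base x := by
    intro τ x y hy
    simp only [Know.want] at hy
    split_ifs at hy
    · exact Or.inr hy
    · exact hy
  obtain ⟨hA, hend⟩ := h.start.stage (fun _ => rfl)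
    (by
      intro τ hτ x hτ' hb
      have hb' : x ∉ N.busy := fun hx => Set.notMem_empty x (hb ▸ (⟨rfl, hx⟩ : x ∈ M x .busy))
      simp only [Stage.len] at hτ'
      exact hN.commCovered (hsize x hb') (by omega) fun σ hσ => hgraph σ (by omega))
    (by
      intro τ hτ v w hw
      rw [hgraph τ hτ]
      rcases base_adj (hwb τ v hw) with h | h
      · exact Or.inl h
      · exact Or.inr (Or.inl h))
  have hstay := h.stay hK (n := 2 * j + 2) (τ := 2 * j + 1)
    (fun τ hτ => by have := hA τ hτ; rwa [hgraph τ hτ] at this) (by omega)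
  have hlast := hA (2 * j + 1) (by simp [Stage.len])
  simp only [Stage.len] at hend
  by_cases hone : N.busy = ∅ ∧ ∀ x y, N.ldr x = N.ldr y
  swap
  · right
    have hal : ∀ x, ¬ M.Alone x := fun x hx => by
      obtain ⟨h1, h2⟩ := hN.alone_univ hG hx
      exact hone ⟨h1, fun a b => (h2 a).trans (h2 b).symm⟩
    have hg : stageGraph M (.select j) (N.graph G) (2 * j + 2) = N.graph G := by
      rw [N.graph_eq G (fun _ => ∅) fun _ _ _ => ∅]
      simp only [stageGraph]
      congr! 4
      exact if_neg fun h => hal _ h.2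
    have hlab : M.label (.select j) = N.know G M.target fun _ _ _ => ∅ := by
      funext x tag
      cases tag <;> simp only [Know.label, Net.know, hM]
      ext y
      simp only [Set.mem_ofPred_eq, Set.mem_empty_iff_false, iff_false, not_and]
      exact fun _ => hal x
    rw [hg, hlab] at hend
    refine ⟨hone, hend, ?_, hN, h.forest⟩
    exact hstay.step hlast (mem_stageHeard _) (fun _ => rfl) hend.1
      (fun u _ => hN.committees_evolves_self _ u) (Net.realised hN h.forest ι)
      (fun v => (hN.degree_graph_le v).trans hK)
  · left
    obtain ⟨x₀⟩ := hG.nonempty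
    obtain ⟨hb, hall⟩ := hone
    set r := N.ldr x₀ with hr
    have hrr : N.ldr r = r := hN.ldr_ldr x₀
    have hcomm : N.comm r = Set.univ := Set.eq_univ_of_forall fun x => hall x x₀
    have hal : ∀ x, M.Alone x := fun x => hN.know_alone.2
      ⟨by simp [hb], fun _ _ y _ => hall y x⟩
    -- In the last round all nodes want only their parent, so the active graph becomes the tree
    -- itself.
    have hg : stageGraph M (.select j) (N.graph G) (2 * j + 2) = graphOfMap N.par := by
      simp only [stageGraph, graphOfMap]
      congr 1
      funext x y
      rw [Know.want, if_pos ⟨rfl, hal x⟩]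
      exact propext eq_comm
    rw [hg] at hend
    have he := hN.enumerates hrr
    have hcard : (N.comm r).ncard = Nat.card V := by rw [hcomm, Set.ncard_univ]
    rw [hcard, hcomm] at he
    have htree := isCompleteBinaryTree_of_heap (H := graphOfMap N.par) he (P := N.par)
      (fun i hi => hN.par_eq r hrr i (by rwa [hcard])) (graphOfMap_adj _)
    let s : Committees V := { N.committees with mode := fun _ => .termination }
    have hsel : ∀ u, N.sel u = none := fun u => Net.sel_eq_none_of_not_busy (by simp [hb])
    have hpar : ∀ x, x ≠ r → N.par x ≠ x := by
      intro x hx hp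
      obtain ⟨i, hi, rfl⟩ := he.surj x trivial
      have h1 := hN.par_eq r hrr i (by rwa [hcard])
      have hp : N.par ((N.succ ^ i) r) = (N.succ ^ i) r := hp
      rw [hp] at h1
      have h0 : 0 < 2 ^ heapExp i := by positivity
      have := he.inj i hi _ ((Nat.sub_le _ _).trans_lt hi) h1
      have : i = 0 := by omega
      subst this
      exact hx rfl
    refine ⟨s, r, ?_, fun x => hall x x₀, rfl, hend.1, ?_, ?_, ?_, ?_, ?_⟩
    · refine hstay.step hlast (mem_stageHeard _) (fun _ => rfl) hend.1 ?_ ?_ ?_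
      · intro u _
        have : N.committees.mode u = .selection := by simp [Net.committees, hb]
        simp only [Committees.Evolves, this]
        exact Or.inr (Or.inr ⟨rfl, fun x hx => ⟨hx, rfl, rfl⟩,
          fun z ⟨hne, x, hx, y, hy, _⟩ => hne (hx.symm.trans ((hall x y).trans hy))⟩)
      · refine ⟨hN.ldr_ldr, fun x => ι.le_iff_le.2 (hN.le_ldr x), fun ⟨x, hx⟩ => absurd rfl hx,
          fun u _ _ => hsel u, fun u _ hm => absurd (show Mode.termination = .selection from hm) (by simp),
          fun u v _ hs => ?_,
          fun u _ hm => absurd (show Mode.termination = .treeMerging from hm) (by simp),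
          fun u hu _ x hx hne => ?_⟩
        · rw [show s.sel u = none from hsel u] at hs; cases hs
        · have hur : u = r := hu.symm.trans (hall u x₀)
          rw [graphOfMap_adj]
          exact ⟨(hpar x (hur ▸ hne)).symm, Or.inl rfl⟩
      · intro v
        refine le_trans (Set.ncard_le_ncard ?_ (Set.toFinite _))
          ((hN.degree_graph_le (G := G) v).trans hK)
        exact fun w hw => ⟨Or.inr hw.1, hw.2⟩
    · intro v
      refine (graphToWreath_status_eq_leader _).trans ?_
      rw [hend.2 v]
      refine ((Know.agree_rename ι (M.label (.select j)) {v}).mem_iff rfl _ _).trans ?_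
      exact ⟨fun h => (show v = N.ldr v from h).trans (hall v x₀), fun h => by
        rw [h]; exact hrr.symm⟩
    · intro v
      rw [hend.halted_iff (fun _ => rfl)]
      exact ⟨rfl, hal v⟩
    · exact fun v => (hN.le_ldr v).trans_eq (hall v x₀)
    · rw [hend.1]; exact htree.2.2
    · rw [hend.1]; exact htree.1

end Ready

/-! ## Selections -/

namespace Net

variable {V : Type} [LinearOrder V] (N : Net V) (G : SimpleGraph V)

/-- The labels when the committees have selected. -/
abbrev selected (N : Net V) (G : SimpleGraph V) : Know V :=
  N.know G (N.plain G).target fun _ _ _ => ∅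

open Classical in
/-- The committees that have selected or are selected join the merging committees. -/
noncomputable def joined : Net V where
  ldr := N.ldr
  par := N.par
  succ := N.succ
  up x := if x ∈ N.busy then N.up x else
    if h : ((N.selected G).upward x).Nonempty then h.choose else x
  busy := {x | x ∈ N.busy ∨
    (x ∉ N.busy ∧ (((N.plain G).target x).Nonempty ∨ (N.selected G).Selected x))}

variable {N G}

lemma joined_up {x : V} (hx : x ∉ N.busy) {y : V} (h : (N.selected G).upward x = {y}) :
    (N.joined G).up x = y := by
  have h' : ((N.selected G).upward x).Nonempty := ⟨y, by rw [h]; rfl⟩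
  have := h.subset h'.choose_spec
  simp only [joined, hx, if_false, dif_pos h']
  exact this

lemma joined_up_of_busy {x : V} (hx : x ∈ N.busy) : (N.joined G).up x = N.up x := if_pos hx

section

variable [Finite V] (hN : N.Valid)
include hN

omit [Finite V] in
lemma Valid.not_busy_of_ldr {x y : V} (h : N.ldr x = N.ldr y) : x ∉ N.busy ↔ y ∉ N.busy := by
  rw [← hN.busy_ldr x, ← hN.busy_ldr y, h]

lemma Valid.target_congr {x y : V} (h : N.ldr x = N.ldr y) :
    (N.plain G).target x = (N.plain G).target y := by
  ext u
  rw [hN.mem_know_target, hN.mem_know_target, hN.not_busy_of_ldr h, h]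

lemma Valid.selected_iff {x : V} : (N.selected G).Selected x ↔
    ∃ z y, N.ldr z = N.ldr x ∧ G.Adj z y ∧ N.ldr x ∈ (N.plain G).target y := by
  simp only [Know.Selected, hN.know_comm, know, comm, SimpleGraph.mem_neighborSet,
    Set.mem_singleton_iff, Set.mem_ofPred_eq, exists_eq_left]
  constructor
  · rintro ⟨z, hz, y, h⟩; exact ⟨z, y, hz, h⟩
  · rintro ⟨z, y, hz, h⟩; exact ⟨z, hz, y, h⟩

lemma Valid.selected_congr {x y : V} (h : N.ldr x = N.ldr y) :
    (N.selected G).Selected x ↔ (N.selected G).Selected y := by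
  rw [hN.selected_iff, hN.selected_iff, h]

lemma Valid.target_eq_singleton {x v : V} (h : v ∈ (N.plain G).target x) :
    (N.plain G).target x = {v} := by
  ext u
  rw [Set.mem_singleton_iff]
  exact ⟨fun h' => h'.2.unique h.2, fun h' => h' ▸ h⟩

/-- How the committees that are not yet merging are joined. -/
lemma Valid.upward_cases {u : V} (hu : N.ldr u = u) : ∃ a, N.ldr a = u ∧
    (∀ x, N.ldr x = u → x ≠ a → (N.selected G).upward x = {N.succ.symm x}) ∧
    ((a = u ∧ (N.selected G).upward u = {u} ∧ (N.plain G).target u = ∅) ∨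
      ∃ y, (N.plain G).target u = {N.ldr y} ∧ (N.selected G).upward a = {y} ∧ G.Adj a y ∧
        y ∉ N.busy ∧ u < N.ldr y) := by
  have hcomm : ∀ x, N.ldr x = u → (N.selected G).comm x = N.comm u := fun x hx => by
    rw [hN.know_comm, hx]
  have hT : ∀ x, N.ldr x = u → N.selected G x .tgt = (N.plain G).target u := fun x hx =>
    hN.target_congr (hx.trans hu.symm)
  have hgates : ∀ x, N.ldr x = u → (N.selected G).gates x =
      {y | G.Adj x y ∧ y ∉ N.busy ∧ N.ldr y ∈ (N.plain G).target u} := by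
    intro x hx
    simp only [Know.gates, hT x hx]
    simp only [know, SimpleGraph.mem_neighborSet, Set.mem_singleton_iff,
      Set.eq_empty_iff_forall_notMem, Set.mem_ofPred_eq, not_and, forall_eq]
    ext y
    simp only [Set.mem_ofPred_eq]
    constructor
    · rintro ⟨h1, h2, v, h3, rfl⟩; exact ⟨h1, h2, h3⟩
    · rintro ⟨h1, h2, h3⟩; exact ⟨h1, h2, _, h3, rfl⟩
  have hport : ∀ x, N.ldr x = u → ((N.selected G).IsPort x ↔
      IsGreatest {a | N.ldr a = u ∧ ∃ y, G.Adj a y ∧ y ∉ N.busy ∧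
        N.ldr y ∈ (N.plain G).target u} x) := by
    intro x hx
    rw [Know.IsPort, hcomm x hx]
    have : {a | a ∈ N.comm u ∧ ((N.selected G).gates a).Nonempty} =
        {a | N.ldr a = u ∧ ∃ y, G.Adj a y ∧ y ∉ N.busy ∧ N.ldr y ∈ (N.plain G).target u} := by
      ext a
      refine and_congr_right fun ha => ?_
      rw [hgates a ha]; rfl
    rw [this]
  have hup : ∀ x, (N.selected G).upward x =
      {y | ((N.selected G).IsPort x ∧ IsGreatest ((N.selected G).gates x) y) ∨
        (¬ (N.selected G).IsPort x ∧ (N.selected G x .tgt = ∅ ∧ x = N.ldr x) ∧ y = x) ∨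
        (¬ (N.selected G).IsPort x ∧ ¬ (N.selected G x .tgt = ∅ ∧ x = N.ldr x) ∧
          y = N.succ.symm x)} := fun x => rfl
  -- Without a target there are no gates, hence no port, and the leader becomes a root.
  by_cases h : (N.plain G).target u = ∅
  · have hnp : ∀ x, N.ldr x = u → ¬ (N.selected G).IsPort x := by
      intro x hx hp
      obtain ⟨_, y, _, _, hy⟩ := ((hport x hx).1 hp).1
      rw [h] at hy; exact hy
    refine ⟨u, hu, fun x hx hne => ?_, Or.inl ⟨rfl, ?_, h⟩⟩
    · rw [hup]
      ext y
      simp [hnp x hx, hT x hx, h, hx, hne]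
    · rw [hup]
      ext y
      simp [hnp u hu, hT u hu, h, hu]
  · obtain ⟨v, hv⟩ := Set.nonempty_iff_ne_empty.2 h
    have hTv := hN.target_eq_singleton hv
    obtain ⟨_, ⟨z, hz, y, hzy, hyb, hvy, hlt⟩, _⟩ := hN.mem_know_target.1 hv
    -- The port is the greatest node of the committee with a neighbour in the target, and it uses
    -- the greatest such neighbour; thus all nodes of the committee agree on it.
    obtain ⟨a, ha⟩ := exists_isGreatest (s := {a | N.ldr a = u ∧ ∃ y, G.Adj a y ∧ y ∉ N.busy ∧
        N.ldr y ∈ (N.plain G).target u}) (Set.nonempty_iff_ne_empty.1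
          ⟨z, hz.trans hu, y, hzy, hyb, hvy ▸ hv⟩)
    obtain ⟨y', hy'⟩ := exists_isGreatest (s := (N.selected G).gates a) (by
      rw [hgates a ha.1.1]
      exact Set.nonempty_iff_ne_empty.1 ha.1.2)
    have hy1 := hy'.1
    rw [hgates a ha.1.1] at hy1
    have hyv : N.ldr y' = v := by have := hy1.2.2; rw [hTv] at this; exact this
    refine ⟨a, ha.1.1, fun x hx hne => ?_, Or.inr ⟨y', by rw [hTv, hyv], ?_, hy1.1, hy1.2.1, ?_⟩⟩
    · have hnp : ¬ (N.selected G).IsPort x := fun hp => hne (((hport x hx).1 hp).unique ha)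
      rw [hup]
      ext y
      simp [hnp, hT x hx, h]
    · have hp := (hport a ha.1.1).2 ha
      rw [hup]
      ext y
      simp only [hp, true_and, not_true, false_and, or_false, Set.mem_ofPred_eq,
        Set.mem_singleton_iff]
      exact ⟨fun h => h.unique hy', fun h => h ▸ hy'⟩
    · rw [hyv]; rwa [hu] at hlt

lemma Valid.joined_busy_iff {x : V} : x ∈ (N.joined G).busy ↔ x ∈ N.busy ∨
    (x ∉ N.busy ∧ (((N.plain G).target x).Nonempty ∨ (N.selected G).Selected x)) := Iff.rfl

lemma Valid.joined : (N.joined G).Valid where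
  ldr_ldr := hN.ldr_ldr
  le_ldr := hN.le_ldr
  cycle := hN.cycle
  par_eq := hN.par_eq
  busy_ldr x := by
    have h := hN.ldr_ldr x
    rw [hN.joined_busy_iff, hN.joined_busy_iff]
    change N.ldr x ∈ N.busy ∨ N.ldr x ∉ N.busy ∧ (((N.plain G).target (N.ldr x)).Nonempty ∨
      (N.selected G).Selected (N.ldr x)) ↔ _
    rw [hN.busy_ldr, hN.target_congr h, hN.selected_congr h]

lemma Valid.upward_joined {x : V} (hx : x ∉ N.busy) :
    (N.selected G).upward x = {(N.joined G).up x} := by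
  obtain ⟨a, ha, h1, h2⟩ := hN.upward_cases (G := G) (hN.ldr_ldr x)
  have : ∃ y, (N.selected G).upward x = {y} := by
    by_cases hxa : x = a
    · rcases h2 with ⟨h2, h3, _⟩ | ⟨y, _, h3, _⟩
      · rw [hxa, h2]; exact ⟨_, h3⟩
      · rw [hxa]; exact ⟨_, h3⟩
    · exact ⟨_, h1 x rfl hxa⟩
  obtain ⟨y, hy⟩ := this
  rw [joined_up hx hy, hy]

/-- The port of a committee that has not been merging before. -/
lemma Valid.joined_cases {u : V} (hu : N.ldr u = u) (hb : u ∉ N.busy) : ∃ a, N.ldr a = u ∧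
    (∀ x, N.ldr x = u → x ≠ a → (N.joined G).up x = N.succ.symm x) ∧
    ((a = u ∧ (N.joined G).up u = u ∧ (N.plain G).target u = ∅) ∨
      (u ∈ (N.joined G).busy ∧ (N.plain G).target u = {N.ldr ((N.joined G).up a)} ∧
        G.Adj a ((N.joined G).up a) ∧ (N.joined G).up a ∉ N.busy ∧
        (N.joined G).up a ∈ (N.joined G).busy ∧ u < N.ldr ((N.joined G).up a))) := by
  obtain ⟨a, ha, h1, h2⟩ := hN.upward_cases (G := G) hu
  have hnb : ∀ x, N.ldr x = u → x ∉ N.busy := fun x hx =>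
    (hN.not_busy_of_ldr (hx.trans hu.symm)).2 hb
  refine ⟨a, ha, fun x hx hne => joined_up (hnb x hx) (h1 x hx hne), ?_⟩
  rcases h2 with ⟨h2, h3, h4⟩ | ⟨y, h2, h3, h4, h5, h6⟩
  · exact Or.inl ⟨h2, joined_up hb h3, h4⟩
  · rw [joined_up (hnb a ha) h3]
    refine Or.inr ⟨Or.inr ⟨hb, Or.inl ⟨_, by rw [h2]; rfl⟩⟩, h2, h4, h5, Or.inr ⟨h5, Or.inr ?_⟩, h6⟩
    rw [hN.selected_iff]
    refine ⟨y, a, rfl, h4.symm, ?_⟩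
    rw [hN.target_congr (ha.trans hu.symm), h2]
    rfl

/-- Committees that were merging keep their ports. The others attach to the committee that they
select, which starts merging too, or are roots; so the forest now covers all nodes. -/
lemma Valid.joined_hasForest (hF : N.HasForest G N.busy) :
    (N.joined G).HasForest G Set.univ := by
  intro u _ hu
  have hu : N.ldr u = u := hu
  by_cases hb : u ∈ N.busy
  · obtain ⟨a, ha, h1, h2⟩ := hF u hb hu
    have hbx : ∀ x, N.ldr x = u → x ∈ N.busy := fun x hx => by rwa [← hN.busy_ldr, hx]
    refine ⟨a, ha, fun x hx hne => ?_, ?_⟩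
    · rw [joined_up_of_busy (hbx x hx)]; exact h1 x hx hne
    · rcases h2 with h2 | h2
      · left; rw [joined_up_of_busy hb]; exact h2
      · right; rw [joined_up_of_busy (hbx a ha)]
        exact ⟨Or.inl hb, h2.2.1, h2.2.2.1, Or.inl h2.2.2.2⟩
  · obtain ⟨a, ha, h1, h2⟩ := hN.joined_cases (G := G) hu hb
    refine ⟨a, ha, h1, ?_⟩
    rcases h2 with h2 | h2
    · exact Or.inl ⟨h2.1, h2.2.1⟩
    · exact Or.inr ⟨h2.1, h2.2.2.1, h2.2.2.2.2.2, h2.2.2.2.2.1⟩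

/-- The selection of a committee that has not been merging before. -/
lemma Valid.joined_sel {u : V} (hu : N.ldr u = u) (hb : u ∉ N.busy) :
    ((N.joined G).sel u = none ∧ (N.plain G).target u = ∅) ∨
    ∃ v, (N.joined G).sel u = some v ∧ (N.plain G).target u = {v} ∧ v ∈ (N.joined G).busy := by
  obtain ⟨a, ha, h1, h2⟩ := hN.joined_cases (G := G) hu hb
  have h3 := sel_of_port (hN.joined (G := G)) hu ha h1
  rcases h2 with h2 | h2
  · exact Or.inl ⟨h3.1 h2.1 h2.2.1, h2.2.2⟩
  · exact Or.inr ⟨_, h3.2 h2.1 h2.2.2.2.2.2, h2.2.1, ((hN.joined (G := G)).busy_ldr _).2 h2.2.2.2.2.1⟩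

lemma Valid.joined_sel_of_busy (hF : N.HasForest G N.busy) {u : V} (hu : N.ldr u = u)
    (hb : u ∈ N.busy) : (N.joined G).sel u = N.sel u := by
  obtain ⟨a, ha, h1, h2⟩ := hF u hb hu
  have hbx : ∀ x, N.ldr x = u → x ∈ N.busy := fun x hx => by rwa [← hN.busy_ldr, hx]
  have h3 := sel_of_port hN hu ha h1
  have h4 := sel_of_port (hN.joined (G := G)) hu ha (fun x hx hne => by
    rw [joined_up_of_busy (hbx x hx)]; exact h1 x hx hne)
  rw [joined_up_of_busy (hbx a ha), joined_up_of_busy hb] at h4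
  rcases h2 with h2 | h2
  · rw [h3.1 h2.1 h2.2, h4.1 h2.1 h2.2]
  · exact (h4.2 (Or.inl h2.1) h2.2.2.1).trans (h3.2 h2.1 h2.2.2.1).symm

omit [Finite V] in
lemma Valid.candidate_iff {ι : V ↪o ℕ} {u z : V} (hu : N.ldr u = u) :
    N.committees.Candidate G ι u z ↔ ∃ x, N.ldr x = N.ldr u ∧ ∃ y, G.Adj x y ∧ y ∉ N.busy ∧
      z = N.ldr y ∧ N.ldr u < z := by
  have hm : (N.committees.mode z ≠ .ringMerging ∧ N.committees.mode z ≠ .treeMerging) ↔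
      z ∉ N.busy := by
    simp only [committees]
    split_ifs with h <;> simp [h]
  simp only [Committees.Candidate, Committees.Neighbouring, hm, ι.lt_iff_lt]
  constructor
  · rintro ⟨⟨_, x, hx, y, hy, hxy⟩, hlt, hz⟩
    have hy : N.ldr y = z := hy
    refine ⟨x, Eq.trans hx hu.symm, y, hxy, ?_, hy.symm, by rwa [hu]⟩
    rw [← hN.busy_ldr, hy]; exact hz
  · rintro ⟨x, hx, y, hxy, hyb, rfl, hlt⟩
    rw [hu] at hlt hx
    exact ⟨⟨hlt.ne, x, hx, y, rfl, hxy⟩, hlt, by rwa [hN.busy_ldr]⟩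

/-- A free committee enters ring merging mode either with its greatest candidate as selection, or
without candidates because some free committee has selected it. -/
lemma Valid.evolves_joined (hF : N.HasForest G N.busy) (ι : V ↪o ℕ) (u : V) (hu : N.ldr u = u) :
    N.committees.Evolves G ι (N.joined G).committees u := by
  by_cases hb : u ∈ N.busy
  · have hb' : u ∈ (N.joined G).busy := Or.inl hb
    have : N.committees.mode u = .ringMerging := if_pos hb
    simp only [Committees.Evolves, this]
    exact ⟨hN.joined_sel_of_busy hF hu hb, Or.inl ⟨if_pos hb', fun x hx => ⟨hx, rfl, rfl⟩⟩⟩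
  have hm : N.committees.mode u = .selection := if_neg hb
  simp only [Committees.Evolves, hm]
  by_cases hb' : u ∈ (N.joined G).busy
  swap
  · exact Or.inl ⟨if_neg hb', fun x hx => ⟨hx, rfl, rfl⟩⟩
  refine Or.inr (Or.inl ⟨if_pos hb', fun x hx => ⟨hx, rfl, rfl⟩, ?_⟩)
  have hcand : ∀ z, N.committees.Candidate G ι u z ↔ z ∈ {z | ∃ x, N.ldr x = N.ldr u ∧
      ∃ y, G.Adj x y ∧ y ∉ N.busy ∧ z = N.ldr y ∧ N.ldr u < z} := fun z => hN.candidate_iff hu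
  rcases hN.joined_sel (G := G) hu hb with ⟨h1, h2⟩ | ⟨v, h1, h2, h3⟩
  · refine Or.inr ⟨h1, fun z hz => ?_, ?_⟩
    · obtain ⟨w, hw⟩ := exists_isGreatest (Set.nonempty_iff_ne_empty.1 ⟨z, (hcand z).1 hz⟩)
      exact Set.eq_empty_iff_forall_notMem.1 h2 w (hN.mem_know_target.2 ⟨hb, hw⟩)
    · rcases hb' with h | ⟨_, h | h⟩
      · exact absurd h hb
      · rw [h2] at h; exact absurd h Set.not_nonempty_empty
      -- The committee of the neighbour `y` is the selecting committee required by
      -- `EntersRingMerging`.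
      · obtain ⟨z, y, hz, hzy, hy⟩ := hN.selected_iff.1 h
        have hyb : y ∉ N.busy := (hN.mem_know_target.1 hy).1
        have hkb : N.ldr y ∉ N.busy := by rwa [hN.busy_ldr]
        refine ⟨N.ldr y, hN.ldr_ldr y, if_neg hkb, ?_⟩
        rw [← hN.target_congr (hN.ldr_ldr y), hu] at hy
        rcases hN.joined_sel (G := G) (hN.ldr_ldr y) hkb with ⟨_, h4⟩ | ⟨v, h4, h5, _⟩
        · rw [h4] at hy; exact absurd hy (Set.notMem_empty _)
        · rw [h5] at hy
          rw [Set.mem_singleton_iff.1 hy]; exact h4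
  · have hv : v ∈ (N.plain G).target u := by rw [h2]; rfl
    have := (hN.mem_know_target.1 hv).2
    exact Or.inl ⟨v, h1, (hcand v).2 this.1, fun z hz => ι.le_iff_le.2 (this.2 ((hcand z).1 hz)),
      if_pos h3⟩

/-- A committee that begins to merge does not merge alone. -/
lemma Valid.joined_root (hF : N.HasForest G N.busy) {x : V} (hb : x ∉ N.busy)
    (hx : x ∈ (N.joined G).busy) : ∃ y, N.ldr y ≠ N.ldr x ∧
      treeRoot (N.joined G).up y = treeRoot (N.joined G).up x := by
  have hN' := hN.joined (G := G)
  have hF' := hN.joined_hasForest hF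
  -- A committee and its target have different leaders and lie in the same tree; the lemma follows
  -- whether `x` selects or is selected.
  have key : ∀ x v, v ∈ (N.plain G).target x → ∃ y, N.ldr y = v ∧ N.ldr x < v ∧
      treeRoot (N.joined G).up y = treeRoot (N.joined G).up x := by
    intro x v hv
    have hxb := (hN.mem_know_target.1 hv).1
    obtain ⟨a, ha, h1, h2 | h2⟩ := hN.joined_cases (G := G) (hN.ldr_ldr x) (by rwa [hN.busy_ldr])
    · rw [hN.target_congr (hN.ldr_ldr x)] at h2
      rw [h2.2.2] at hv; exact absurd hv (Set.notMem_empty _)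
    · rw [hN.target_congr (hN.ldr_ldr x)] at h2
      rw [h2.2.1] at hv
      rw [Set.mem_singleton_iff.1 hv]
      exact ⟨_, rfl, h2.2.2.2.2.2, by
        rw [(hF'.isForest hN').root_parent]; exact hF'.root_eq_of_ldr hN' ha⟩
  rcases hx with h | ⟨_, ⟨v, hv⟩ | h⟩
  · exact absurd h hb
  · obtain ⟨y, h1, h2, h3⟩ := key x v hv
    exact ⟨y, by rw [h1]; exact h2.ne', h3⟩
  · obtain ⟨z, y, hz, hzy, hy⟩ := hN.selected_iff.1 h
    obtain ⟨w, h1, h2, h3⟩ := key y _ hy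
    exact ⟨y, h2.ne, h3.symm.trans (hF'.root_eq_of_ldr hN' h1)⟩

/-- The neighbours of a committee that does not begin to merge have lesser UIDs, and they merge into
committees with greater UIDs. -/
lemma Valid.joined_neighbour (hF : N.HasForest G N.busy) (hb : N.busy = ∅) {x z y : V}
    (hx : x ∉ (N.joined G).busy) (hz : N.ldr z = N.ldr x) (hzy : G.Adj z y)
    (hne : N.ldr y ≠ N.ldr x) : N.ldr y < N.ldr x ∧ y ∈ (N.joined G).busy ∧
      N.ldr x < treeRoot (N.joined G).up y := by
  have hN' := hN.joined (G := G)
  have hF' := hN.joined_hasForest hF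
  have hnb : ∀ x, x ∉ N.busy := by simp [hb]
  -- When nobody is merging, every neighbouring committee of greater UID is a candidate.
  have htgt : ∀ x z y, N.ldr z = N.ldr x → G.Adj z y → N.ldr x < N.ldr y →
      ∃ v, v ∈ (N.plain G).target x ∧ N.ldr y ≤ v := by
    intro x z y hz hzy hlt
    have hmem : N.ldr y ∈ {u | ∃ z, N.ldr z = N.ldr x ∧ ∃ y, G.Adj z y ∧ y ∉ N.busy ∧
      u = N.ldr y ∧ N.ldr x < u} := ⟨z, hz, y, hzy, hnb y, rfl, hlt⟩
    obtain ⟨v, hv⟩ := exists_isGreatest (Set.nonempty_iff_ne_empty.1 ⟨_, hmem⟩)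
    exact ⟨v, hN.mem_know_target.2 ⟨hnb x, hv⟩, hv.2 hmem⟩
  have hlt : N.ldr y < N.ldr x := by
    rcases lt_trichotomy (N.ldr y) (N.ldr x) with h | h | h
    · exact h
    · exact absurd h hne
    · obtain ⟨v, hv, _⟩ := htgt x z y hz hzy h
      exact absurd (Or.inr ⟨hnb x, Or.inl ⟨v, hv⟩⟩) hx
  obtain ⟨v, hv, hle⟩ := htgt y y z rfl hzy.symm (by rwa [hz])
  rw [hz] at hle
  refine ⟨hlt, Or.inr ⟨hnb y, Or.inl ⟨v, hv⟩⟩, ?_⟩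
  -- The committee of `y` could select that of `x`, but the latter is not selected; so the target of
  -- `y` is strictly greater.
  have hvx : N.ldr x < v := by
    refine lt_of_le_of_ne hle fun h => hx (Or.inr ⟨hnb x, Or.inr ?_⟩)
    rw [hN.selected_iff]
    exact ⟨z, y, hz, hzy, h ▸ hv⟩
  obtain ⟨a, ha, h1, h2 | h2⟩ := hN.joined_cases (G := G) (hN.ldr_ldr y) (hnb _)
  · rw [hN.target_congr (hN.ldr_ldr y)] at h2
    rw [h2.2.2] at hv; exact absurd hv (Set.notMem_empty _)
  · rw [hN.target_congr (hN.ldr_ldr y)] at h2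
    rw [h2.2.1, Set.mem_singleton_iff] at hv
    rw [← hF'.root_eq_of_ldr hN' ha, ← (hF'.isForest hN').root_parent]
    exact (hvx.trans_eq hv).trans_le (hF'.ldr_le_root hN' _)

end

end Net

namespace Ready

variable {V : Type} [LinearOrder V] [Finite V] {ι : V ↪o ℕ} {G : SimpleGraph V} {K t j : ℕ}
  {N : Net V}

/-- The target labels have to be flooded once more before a committee can know that it is selected
and where its port is. -/
theorem join (h : Ready ι G K t (.join j) N (N.plain G).target fun _ _ _ => ∅)
    (hsize : ∀ x ∉ N.busy, (N.comm (N.ldr x)).ncard ≤ 2 ^ j) (hK : 6 ≤ K) :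
    Ready ι G K (t + (2 * j + 2)) (.order j) (N.joined G) (fun _ => ∅) fun _ _ _ => ∅ := by
  have hN := h.valid
  have hN' := hN.joined (G := G)
  have hF' := hN.joined_hasForest h.forest
  have hgraph : ∀ τ, stageGraph (N.selected G) (.join j) (N.graph G) τ = N.graph G := by
    intro τ
    cases τ with
    | zero => rfl
    | succ τ => exact (N.graph_eq G _ _).symm
  obtain ⟨hA, hend⟩ := h.start.stage (fun _ => rfl)
    (by
      intro τ hτ x hτ' hb
      have hb' : x ∉ N.busy := fun hx =>
        Set.notMem_empty x (hb ▸ (⟨rfl, hx⟩ : x ∈ N.selected G x .busy))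
      simp only [Stage.len] at hτ'
      exact hN.commCovered (hsize x hb') (by omega) fun σ hσ => hgraph σ)
    (by
      intro τ hτ v w hw
      rw [hgraph τ]
      rcases base_adj hw with h | h
      · exact Or.inl h
      · exact Or.inr (Or.inl h))
  have hstay := h.stay hK (n := 2 * j + 2) (τ := 2 * j + 1)
    (fun τ hτ => by have := hA τ hτ; rwa [hgraph τ] at this) (by omega)
  have hlast := hA (2 * j + 1) (by simp [Stage.len])
  simp only [Stage.len] at hend
  have hlab : (N.selected G).label (.join j) = (N.joined G).plain G := by
    funext x tag
    by_cases hb : x ∈ N.busy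
    · have hb2 : (N.selected G x .busy) ≠ ∅ := Set.nonempty_iff_ne_empty.1 ⟨x, rfl, hb⟩
      cases tag <;> simp only [Know.label, if_neg hb2] <;> try rfl
      · ext y
        simp only [Set.mem_ofPred_eq, hb2, false_and, or_false]
        exact ⟨fun h => ⟨h.1, Or.inl h.2⟩, fun h => ⟨h.1, hb⟩⟩
      · exact congrArg (fun y : V => ({y} : Set V)) (Net.joined_up_of_busy hb).symm
    · have hb2 : (N.selected G x .busy) = ∅ := by
        ext y; exact ⟨fun h => hb h.2, fun h => absurd h (Set.notMem_empty y)⟩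
      cases tag <;> simp only [Know.label, if_pos hb2] <;> try rfl
      · ext y
        simp only [Set.mem_ofPred_eq, hb2, true_and, Set.mem_empty_iff_false, false_or]
        exact ⟨fun h => ⟨h.1, Or.inr ⟨hb, h.2⟩⟩, fun h => ⟨h.1, (h.2.resolve_left hb).2⟩⟩
      · exact hN.upward_joined hb
  rw [hgraph, hlab] at hend
  refine ⟨hend, ?_, hN', hF'.mono (Set.subset_univ _)⟩
  exact hstay.step hlast (mem_stageHeard _) (fun _ => rfl) hend.1
    (fun u hu => hN.evolves_joined h.forest ι u hu) (Net.realised hN' (hF'.mono (Set.subset_univ _)) ι)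
    (fun v => (hN.degree_graph_le v).trans hK)

/-- The next position on the Euler tour depends on the children of a node and of its parent. All of
these are within two edges, so two rounds suffice. -/
theorem order (h : Ready ι G K t (.order j) N (fun _ => ∅) fun _ _ _ => ∅)
    (hF : N.HasForest G Set.univ) (hK : 6 ≤ K) :
    Ready ι G K (t + 2) (.merge j) N (fun _ => ∅) (eulerNext N.up) := by
  have hN := h.valid
  have hgraph : ∀ τ, stageGraph (N.plain G) (.order j) (N.graph G) τ = N.graph G := by
    intro τ
    cases τ with
    | zero => rfl
    | succ τ => exact (N.graph_eq G _ _).symm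
  have hsucc : ∀ z y, y = N.succ z → y = z ∨ (N.graph G).Adj z y := by
    rintro z y rfl
    by_cases h : N.succ z = z
    · exact Or.inl h
    · exact Or.inr (Or.inl (Or.inr (by rw [graphOfMap_adj]; exact ⟨Ne.symm h, Or.inl rfl⟩)))
  have hnear : ∀ z y, G.Adj z y ∨ y = N.succ z → y = z ∨ (N.graph G).Adj z y := by
    rintro z y (h | h)
    · exact Or.inr (Or.inl (Or.inl h))
    · exact hsucc z y h
  have hheard : ∀ x z y, (z = x ∨ (N.graph G).Adj x z) → (y = z ∨ (N.graph G).Adj z y) →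
      y ∈ stageHeard (N.plain G) (.order j) (N.graph G) 2 x := by
    intro x z y hz hy
    have hD : ∀ σ < 2, stageGraph (N.plain G) (.order j) (N.graph G) σ = N.graph G :=
      fun σ _ => hgraph σ
    rcases hz with rfl | hz <;> rcases hy with rfl | hy
    · exact mem_stageHeard _ _
    · exact mem_stageHeard_of_walk hD (.cons hy .nil) (by simp)
    · exact mem_stageHeard_of_walk hD (.cons hz .nil) (by simp)
    · exact mem_stageHeard_of_walk hD (.cons hz (.cons hy .nil)) (by simp)
  obtain ⟨hA, hend⟩ := h.start.stage (fun _ => rfl)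
    (by
      intro τ hτ x hτ'
      simp only [Stage.len] at hτ'
      obtain rfl : τ = 1 := by omega
      refine ⟨⟨mem_stageHeard _ _, fun y hy => hheard x x y (Or.inl rfl) (hnear x y hy)⟩, ?_⟩
      rintro p rfl
      exact ⟨hheard x _ _ (hF.up_adj hN x) (Or.inl rfl),
        fun y hy => hheard x _ y (hF.up_adj hN x) (hnear _ y hy)⟩)
    (by
      intro τ hτ v w hw
      rw [hgraph τ]
      rcases base_adj hw with h | h
      · exact Or.inl h
      · exact Or.inr (Or.inl h))
  have hstay := h.stay hK (n := 2) (τ := 1)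
    (fun τ hτ => by have := hA τ hτ; rwa [hgraph τ] at this) (by omega)
  have hlast := hA 1 (by simp [Stage.len])
  simp only [Stage.len] at hend
  -- Forest edges are ring edges or initial edges, so every child is the ring successor or an
  -- initial neighbour, as the local definition of `kids` presumes.
  have hkids : ∀ x, (N.plain G).kids x = treeKids N.up x := by
    intro x
    ext c
    change (c ≠ x ∧ (G.Adj x c ∨ c = N.succ x) ∧ x = N.up c) ↔ (c ≠ x ∧ N.up c = x)
    constructor
    · rintro ⟨h1, _, h2⟩; exact ⟨h1, h2.symm⟩
    · rintro ⟨h1, rfl⟩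
      refine ⟨h1, ?_, rfl⟩
      rcases hF.up_cases hN c with h | h | h
      · exact absurd h.symm h1
      · rw [h]; simp
      · exact Or.inl h.symm
  have htour : ∀ x b b', (N.plain G).tourNext x b b' = eulerNext N.up x b b' := by
    intro x b b'
    cases b <;> cases b' <;> ext y <;> simp only [Know.tourNext, eulerNext, hkids, Net.know,
      Set.mem_singleton_iff, exists_eq_left, Set.mem_ofPred_eq, @eq_comm _ x (N.up x)]
    constructor
    · rintro ⟨rfl, h1, h2⟩; exact ⟨rfl, h1, h2⟩
    · rintro ⟨rfl, h1, h2⟩; exact ⟨rfl, h1, h2⟩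
  have hlab : (N.plain G).label (.order j) = N.know G (fun _ => ∅) (eulerNext N.up) := by
    funext x tag
    cases tag <;> simp only [Know.label] <;> try rfl
    exact htour x _ _
  rw [hgraph, hlab] at hend
  exact ⟨hend, hstay.step hlast (mem_stageHeard _) (fun _ => rfl) hend.1
    (fun u _ => hN.committees_evolves_self _ u) (Net.realised hN h.forest ι)
    (fun v => (hN.degree_graph_le v).trans hK), hN, h.forest⟩

end Ready

/-! ## Merging: tours -/

lemma List.finite_setOf_nodup (V : Type*) [Finite V] : {l : List V | l.Nodup}.Finite := by
  have := Fintype.ofFinite V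
  refine (List.finite_length_le V (Fintype.card V)).subset fun l hl => ?_
  exact List.Nodup.length_le_card hl

namespace Net

variable {V : Type} [LinearOrder V] (N : Net V) (G : SimpleGraph V)

/-- The labels when the Euler tours are known. -/
abbrev toured : Know V := N.know G (fun _ => ∅) (eulerNext N.up)

/-- The nodes of a tree of the forest. -/
def tree (r : V) : Set V := {y | treeRoot N.up y = r}

/-- The nodes of the trees that are merged in slot `j`. -/
def small (j : ℕ) : Set V := {x | x ∈ N.busy ∧ (N.tree (treeRoot N.up x)).ncard ≤ 2 ^ j}

open Classical in
/-- The least tour of a tree of the forest. -/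
noncomputable def tour (r : V) : List V :=
  if h : ∃ l, (N.toured G).LeastTour r l then h.choose else []

variable {N G}

omit [LinearOrder V] in
lemma small_congr {x y : V} (h : treeRoot N.up x = treeRoot N.up y) (hb : x ∈ N.busy ↔ y ∈ N.busy)
    {j : ℕ} : x ∈ N.small j ↔ y ∈ N.small j := by
  simp only [small, Set.mem_ofPred_eq, h, hb]

variable [Finite V]

lemma tourStep_iff {w w' : V × Bool} : (N.toured G).TourStep w w' ↔ eulerPerm N.up w = w' :=
  eulerStep_iff

lemma tourWalk_iff {n : ℕ} {w w' : V × Bool} :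
    (N.toured G).TourWalk n w w' ↔ (eulerPerm N.up ^ n) w = w' := by
  induction n generalizing w with
  | zero => exact Iff.rfl
  | succ n ih =>
    simp only [Know.TourWalk, tourStep_iff, ih, exists_eq_left', pow_succ, Equiv.Perm.mul_apply]

lemma mem_jumps {n : ℕ} {x y : V} : y ∈ (N.toured G).jumps n x ↔
    ∃ b b', (eulerPerm N.up ^ n) (x, b) = (y, b') := by
  simp only [Know.jumps, tourWalk_iff]; rfl

lemma eulerPerm_root (hp : IsForest N.up) (n : ℕ) (w : V × Bool) :
    treeRoot N.up ((eulerPerm N.up ^ n) w).1 = treeRoot N.up w.1 :=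
  ((hp.eulerPerm_isCycleOn (treeRoot N.up w.1)).1.perm_pow n).mapsTo (show w ∈ _ from rfl)

/-- The Euler tour of a tree with at most `m` nodes has length at most `2 * m`. -/
lemma exists_eulerPerm_pow (hp : IsForest N.up) {x y : V} (h : treeRoot N.up y = treeRoot N.up x) {m : ℕ}
    (hm : (N.tree (treeRoot N.up x)).ncard ≤ m) :
    ∃ k < 2 * m, ∃ b, (eulerPerm N.up ^ k) (x, false) = (y, b) := by
  set S : Set (V × Bool) := {w | treeRoot N.up w.1 = treeRoot N.up x}
  have hcyc := hp.eulerPerm_isCycleOn (treeRoot N.up x)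
  obtain ⟨k, hk, hk'⟩ := (hcyc.enumerates (r := (x, false)) rfl).surj (y, false) h
  have hcard : S.ncard ≤ 2 * (N.tree (treeRoot N.up x)).ncard := by
    have : S = (N.tree (treeRoot N.up x)) ×ˢ (Set.univ : Set Bool) := by
      ext w; simp [S, tree]
    rw [this, Set.ncard_prod, Set.ncard_univ, Nat.card_eq_fintype_card, Fintype.card_bool]
    omega
  exact ⟨k, by change k < S.ncard at hk; omega, false, hk'⟩

lemma group_eq (hp : IsForest N.up) (x : V) :
    (N.toured G).group x = N.tree (treeRoot N.up x) := by
  ext y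
  constructor
  · rintro ⟨b, h⟩
    have : ∀ w w', Relation.ReflTransGen (N.toured G).TourStep w w' →
        treeRoot N.up w'.1 = treeRoot N.up w.1 := by
      intro w w' h
      induction h with
      | refl => rfl
      | tail _ h ih =>
        rw [tourStep_iff] at h
        rw [← h, ← ih]
        simpa using eulerPerm_root hp 1 _
    exact this _ _ h
  · intro h
    obtain ⟨k, hlt, b, hk⟩ := exists_eulerPerm_pow hp h le_rfl
    refine ⟨b, ?_⟩
    rw [← hk]
    clear hk hlt
    induction k with
    | zero => exact .refl
    | succ k ih =>
      refine ih.tail (tourStep_iff.2 ?_)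
      rw [pow_succ', Equiv.Perm.mul_apply]

lemma know_small (hp : IsForest N.up) {j : ℕ} {x : V} :
    (N.toured G).Small j x ↔ x ∈ N.small j := by
  have h1 : ∀ y, (N.toured G) y .pres ≠ ∅ := fun y => Set.singleton_ne_empty y
  have h2 : (N.toured G) x .busy ≠ ∅ ↔ x ∈ N.busy := by
    rw [← Set.nonempty_iff_ne_empty]
    exact ⟨fun ⟨_, h⟩ => h.2, fun h => ⟨x, rfl, h⟩⟩
  simp only [Know.Small, h2, group_eq hp, small, Set.mem_ofPred_eq]
  exact ⟨fun h => ⟨h.1, h.2.2⟩, fun h => ⟨h.1, fun y _ => h1 y, h.2⟩⟩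

/-- All nodes of a tree compute the same tour: the conditions depend on `x` only through its tree.
-/
lemma isTour_congr (hp : IsForest N.up) {x : V} {l : List V} :
    (N.toured G).IsTour x l ↔ (N.toured G).IsTour (treeRoot N.up x) l := by
  simp only [Know.IsTour, group_eq hp, hp.root_root]

lemma leastTour_congr (hp : IsForest N.up) {x : V} {l : List V} :
    (N.toured G).LeastTour x l ↔ (N.toured G).LeastTour (treeRoot N.up x) l := by
  simp only [Know.LeastTour, isTour_congr hp (x := x)]

/-- A tree is connected by its own links, so `exists_tour` applies from the root; only finitely many
lists have no repetitions, so there is a least tour. -/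
lemma exists_leastTour (hp : IsForest N.up) (x : V) : ∃ l, (N.toured G).LeastTour x l := by
  have hex : ∃ l, (N.toured G).IsTour x l := by
    have hreach : ∀ y, treeRoot N.up y = treeRoot N.up x → Relation.ReflTransGen
        (fun a b => (N.toured G).Link a b ∧ a ∈ (N.toured G).group x ∧ b ∈ (N.toured G).group x)
        (treeRoot N.up x) y := by
      intro y
      rw [group_eq hp]
      induction y using hp.induction with
      | h0 y h => intro hy; rw [← hy, treeRoot_of_fixed h]
      | h1 y h ih =>
        intro hy
        have hy' : treeRoot N.up (N.up y) = treeRoot N.up x := by rw [hp.root_parent, hy]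
        exact (ih hy').tail ⟨Or.inr rfl, hy', hy⟩
    obtain ⟨l, h1, h2, h3, h4⟩ := exists_tour (E := (N.toured G).Link) (S := (N.toured G).group x)
      (fun a b h => Or.symm h) (Set.toFinite _) (a := treeRoot N.up x)
      (by rw [group_eq hp]; exact hp.root_root x)
      (fun y hy => hreach y (by rw [group_eq hp] at hy; exact hy))
    exact ⟨l, h1, h2, ⟨_, h3, (hp.parent_root x).symm⟩, h4⟩
  have hfin : {l | (N.toured G).IsTour x l}.Finite :=
    (List.finite_setOf_nodup V).subset fun l hl => hl.1
  obtain ⟨l, hl⟩ := hfin.exists_minimal hex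
  exact ⟨l, hl.1, fun l' hl' hlt => (hl.2 hl' hlt.le).not_gt hlt⟩

omit [Finite V] in
lemma leastTour_unique {M : Know V} {x : V} {l l' : List V} (h : M.LeastTour x l)
    (h' : M.LeastTour x l') : l = l' :=
  le_antisymm (not_lt.1 (h.2 l' h'.1)) (not_lt.1 (h'.2 l h.1))

lemma leastTour_iff (hp : IsForest N.up) {x : V} {l : List V} :
    (N.toured G).LeastTour x l ↔ l = N.tour G (treeRoot N.up x) := by
  have h := exists_leastTour (G := G) hp (treeRoot N.up x)
  rw [leastTour_congr hp, tour, dif_pos h]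
  exact ⟨fun h' => leastTour_unique h' h.choose_spec, fun h' => h' ▸ h.choose_spec⟩

section Tour

variable (hp : IsForest N.up) {r : V} (hr : treeRoot N.up r = r)
include hp hr

lemma isTour_tour : (N.toured G).IsTour r (N.tour G r) :=
  ((leastTour_iff hp).2 (by rw [hr])).1

lemma nodup_tour : (N.tour G r).Nodup := (isTour_tour hp hr).1

lemma mem_tour {y : V} : y ∈ N.tour G r ↔ treeRoot N.up y = r := by
  rw [(isTour_tour hp hr).2.1, group_eq hp, hr]; rfl

lemma head_tour : (N.tour G r)[0]? = some r := by
  obtain ⟨s, h1, h2⟩ := (isTour_tour (G := G) hp hr).2.2.1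
  rw [List.head?_eq_getElem?] at h1
  have h3 : treeRoot N.up s = r := (mem_tour (G := G) hp hr).1 (List.mem_of_getElem? h1)
  rw [treeRoot_of_fixed (show N.up s = s from h2.symm)] at h3
  rw [h1, h3]

lemma near3_tour {x y : V} (h : listNext (N.tour G r) x y) :
    Near3 (N.toured G).Link (N.tree r) x y := by
  have := (isTour_tour hp hr).2.2.2 x y h
  rwa [group_eq hp, hr] at this

end Tour

/-! ### The new rings and the lines cut from them -/

open Classical in
/-- The ring after slot `j`. -/
noncomputable def ringFun (N : Net V) (G : SimpleGraph V) (j : ℕ) (x : V) : V :=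
  if x ∈ N.small j then (N.tour G (treeRoot N.up x)).formPerm x else N.succ x

section Ring

variable (hN : N.Valid) (hF : N.HasForest G Set.univ) {j : ℕ}
include hN hF

lemma small_iff_of_root {x y : V} (h : treeRoot N.up x = treeRoot N.up y) :
    x ∈ N.small j ↔ y ∈ N.small j :=
  small_congr h (by rw [← (hF.root_ldr hN x).2.2, ← (hF.root_ldr hN y).2.2, h])

lemma small_iff_of_ldr {x y : V} (h : N.ldr x = N.ldr y) : x ∈ N.small j ↔ y ∈ N.small j :=
  small_iff_of_root hN hF (hF.root_eq_of_ldr hN h)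

lemma small_root (x : V) : treeRoot N.up x ∈ N.small j ↔ x ∈ N.small j :=
  small_iff_of_root hN hF ((hF.isForest hN).root_root x)

lemma root_ringFun (x : V) : treeRoot N.up (N.ringFun G j x) = treeRoot N.up x := by
  have hp := hF.isForest hN
  unfold ringFun
  split_ifs with h
  · have hx := (mem_tour (G := G) hp (hp.root_root x) (y := x)).2 rfl
    exact (mem_tour (G := G) hp (hp.root_root x)).1 (List.formPerm_apply_mem_of_mem hx)
  · exact hF.root_eq_of_ldr hN (hN.ldr_succ x)

/-- The new successor stays in its tree, and a tree is merged as a whole or not at all. On each tree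
the map is therefore the restriction of one permutation. -/
lemma ringFun_injective : Function.Injective (N.ringFun G j) := by
  intro x y h
  have hr : treeRoot N.up x = treeRoot N.up y := by
    rw [← root_ringFun hN hF (j := j) x, h, root_ringFun hN hF]
  have hs := small_iff_of_root hN hF (j := j) hr
  unfold ringFun at h
  by_cases hy : y ∈ N.small j
  · rw [if_pos hy, if_pos (hs.2 hy), hr] at h
    exact Equiv.injective _ h
  · rw [if_neg hy, if_neg (hs.not.2 hy)] at h
    exact N.succ.injective h

end Ring

open Classical in
/-- The ring after slot `j`, as a permutation. -/
noncomputable def ring (N : Net V) (G : SimpleGraph V) (j : ℕ) : Equiv.Perm V :=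
  if h : Function.Injective (N.ringFun G j) then
    Equiv.ofBijective _ (Finite.injective_iff_bijective.1 h) else 1

open Classical in
/-- The parents after `t` rounds of LineToCompleteBinaryTree in slot `j`. -/
noncomputable def line (N : Net V) (G : SimpleGraph V) (j t : ℕ) (x : V) : V :=
  if x ∈ N.small j then lineToTree (treeRoot N.up x) (N.ring G j) t x else N.par x

open Classical in
/-- The committees after slot `j`. -/
noncomputable def merge (N : Net V) (G : SimpleGraph V) (j : ℕ) : Net V where
  ldr x := if x ∈ N.small j then treeRoot N.up x else N.ldr x
  par := N.line G j (j + 1)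
  up x := if x ∈ N.small j then x else N.up x
  succ := N.ring G j
  busy := N.busy \ N.small j

section Ring

variable (hN : N.Valid) (hF : N.HasForest G Set.univ) {j : ℕ}
include hN hF

lemma ring_apply (x : V) : N.ring G j x = N.ringFun G j x := by
  rw [ring, dif_pos (ringFun_injective hN hF)]; rfl

lemma ring_of_small {x : V} (h : x ∈ N.small j) :
    N.ring G j x = (N.tour G (treeRoot N.up x)).formPerm x := by
  rw [ring_apply hN hF, ringFun, if_pos h]

lemma ring_of_not_small {x : V} (h : x ∉ N.small j) : N.ring G j x = N.succ x := by
  rw [ring_apply hN hF, ringFun, if_neg h]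

lemma root_ring (x : V) : treeRoot N.up (N.ring G j x) = treeRoot N.up x := by
  rw [ring_apply hN hF, root_ringFun hN hF]

lemma root_ring_symm (x : V) : treeRoot N.up ((N.ring G j).symm x) = treeRoot N.up x := by
  conv_rhs => rw [← (N.ring G j).apply_symm_apply x, root_ring hN hF]

lemma ring_symm_of_not_small {x : V} (h : x ∉ N.small j) :
    (N.ring G j).symm x = N.succ.symm x := by
  rw [Equiv.symm_apply_eq, ring_of_not_small hN hF, Equiv.apply_symm_apply]
  rwa [small_iff_of_ldr hN hF (hN.ldr_succ_symm x)]

variable {r : V} (hr : treeRoot N.up r = r) (hs : r ∈ N.small j)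
include hr hs

lemma ring_isCycleOn : (N.ring G j).IsCycleOn (N.tree r) := by
  have hp := hF.isForest hN
  have h := (nodup_tour (G := G) hp hr).isCycleOn_formPerm
  have : {a | a ∈ N.tour G r} = N.tree r := Set.ext fun y => mem_tour hp hr
  rw [this] at h
  refine h.congr_of_eq fun x hx => ?_
  have hx : treeRoot N.up x = r := hx
  rw [ring_of_small hN hF ((small_iff_of_root hN hF (hx.trans hr.symm)).2 hs), hx]

lemma ring_enumerates : Enumerates (fun i => (N.ring G j ^ i) r) (N.tree r).ncard (N.tree r) :=
  (ring_isCycleOn hN hF hr hs).enumerates hr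

lemma length_tour : (N.tour G r).length = (N.tree r).ncard := by
  classical
  have hp := hF.isForest hN
  rw [← List.toFinset_card_of_nodup (nodup_tour (G := G) hp hr), ← Set.ncard_coe_finset]
  congr 1
  ext y
  rw [List.coe_toFinset]
  exact mem_tour hp hr

lemma getElem_tour {i : ℕ} (hi : i < (N.tree r).ncard) :
    (N.tour G r)[i]? = some ((N.ring G j ^ i) r) := by
  have hp := hF.isForest hN
  have hlen := length_tour hN hF hr hs
  induction i with
  | zero => exact head_tour hp hr
  | succ i ih =>
    have h1 := ih (by omega)
    have hi' : i < (N.tour G r).length := by omega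
    rw [List.getElem?_eq_getElem hi', Option.some.injEq] at h1
    have hmem : treeRoot N.up ((N.ring G j ^ i) r) = r := by
      rw [← h1]; exact (mem_tour (G := G) hp hr).1 (List.getElem_mem _)
    rw [pow_succ', Equiv.Perm.mul_apply,
      ring_of_small hN hF ((small_iff_of_root hN hF (hmem.trans hr.symm)).2 hs), hmem, ← h1,
      List.formPerm_apply_getElem _ (nodup_tour hp hr),
      List.getElem?_eq_getElem (by omega : i + 1 < (N.tour G r).length)]
    simp only [Nat.mod_eq_of_lt (by omega : i + 1 < (N.tour G r).length)]

lemma listNext_tour {x y : V} (hx : treeRoot N.up x = r) :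
    listNext (N.tour G r) x y ↔ N.ring G j x = y := by
  have hp := hF.isForest hN
  have hxs := (small_iff_of_root hN hF (hx.trans hr.symm)).2 hs
  rw [ring_of_small hN hF hxs, hx]
  have hnd := nodup_tour (G := G) hp hr
  constructor
  · rintro ⟨i, h1, h2⟩
    obtain ⟨hi, rfl⟩ := List.getElem?_eq_some_iff.1 h1
    obtain ⟨hi', rfl⟩ := List.getElem?_eq_some_iff.1 h2
    exact List.formPerm_apply_getElem _ hnd i hi
  · rintro rfl
    obtain ⟨i, hi, rfl⟩ := List.getElem_of_mem ((mem_tour (G := G) hp hr).2 hx)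
    refine ⟨i, List.getElem?_eq_getElem hi, ?_⟩
    rw [List.formPerm_apply_getElem _ hnd i hi,
      List.getElem?_eq_getElem (Nat.mod_lt _ (by omega))]

lemma lineToTree_ring (t : ℕ) {i : ℕ} (hi : i < (N.tree r).ncard) :
    lineToTree r (N.ring G j) t ((N.ring G j ^ i) r) = (N.ring G j ^ heapParent t i) r := by
  have := (lineToTree_eq (ring_enumerates hN hF hr hs) (σ := N.ring G j)
    (fun i _ => by rw [pow_succ']; rfl)
    (fun x hx h => hx ((root_ring_symm hN hF x).symm.trans h)) t).1 i hi
  exact this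

lemma lineToTree_mem (t : ℕ) {x : V} (hx : treeRoot N.up x = r) :
    treeRoot N.up (lineToTree r (N.ring G j) t x) = r := by
  obtain ⟨i, hi, rfl⟩ := (ring_enumerates hN hF hr hs).surj x hx
  rw [lineToTree_ring hN hF hr hs t hi]
  exact (ring_enumerates hN hF hr hs).mem _ ((heapParent_le t i).trans_lt hi)

lemma lineToTree_ne (t : ℕ) {x : V} (hx : treeRoot N.up x = r) (hne : x ≠ r) :
    lineToTree r (N.ring G j) t x ≠ x := by
  have he := ring_enumerates hN hF hr hs
  obtain ⟨i, hi, rfl⟩ := he.surj x hx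
  rw [lineToTree_ring hN hF hr hs t hi]
  intro h
  have := he.inj _ ((heapParent_le t i).trans_lt hi) _ hi h
  rcases Nat.eq_zero_or_pos i with rfl | h0
  · exact hne rfl
  · exact absurd this (heapParent_lt h0).ne

/-- On at most `2 ^ j` nodes nobody makes more than `j` moves. -/
lemma lineToTree_stable {t t' : ℕ} (ht : j ≤ t) (ht' : j ≤ t') {x : V} (hx : treeRoot N.up x = r) :
    lineToTree r (N.ring G j) t x = lineToTree r (N.ring G j) t' x := by
  have he := ring_enumerates hN hF hr hs
  obtain ⟨i, hi, rfl⟩ := he.surj x hx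
  have hsz : (N.tree r).ncard ≤ 2 ^ j := by have := hs.2; rwa [hr] at this
  have hj : heapExp i ≤ j := heapExp_le (hi.trans_le hsz)
  rw [lineToTree_ring hN hF hr hs t hi, lineToTree_ring hN hF hr hs t' hi,
    heapParent_eq_of_le (hj.trans ht), heapParent_eq_of_le (hj.trans ht')]

lemma listParent_tour {t : ℕ} {x y : V} (hx : treeRoot N.up x = r) :
    listParent t (N.tour G r) x y ↔ lineToTree r (N.ring G j) t x = y := by
  have he := ring_enumerates hN hF hr hs
  have hlen := length_tour hN hF hr hs
  obtain ⟨i, hi, rfl⟩ := he.surj x hx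
  rw [lineToTree_ring hN hF hr hs t hi]
  have hp := (heapParent_le t i).trans_lt hi
  constructor
  · rintro ⟨k, h1, h2⟩
    have hk : k < (N.tree r).ncard := by
      obtain ⟨hk, _⟩ := List.getElem?_eq_some_iff.1 h1
      omega
    rw [getElem_tour hN hF hr hs hk] at h1
    have hki := he.inj k hk i hi (Option.some.inj h1)
    subst hki
    rw [getElem_tour hN hF hr hs hp] at h2
    exact Option.some.inj h2
  · rintro rfl
    exact ⟨i, getElem_tour hN hF hr hs hi, getElem_tour hN hF hr hs hp⟩

end Ring

end Net

/-! ## Merging: the committees after a slot -/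

namespace Net

variable {V : Type} [LinearOrder V] [Finite V] {N : Net V} {G : SimpleGraph V} {j : ℕ}

lemma merge_ldr_of_small {x : V} (h : x ∈ N.small j) :
    (N.merge G j).ldr x = treeRoot N.up x := if_pos h

lemma merge_ldr_of_not_small {x : V} (h : x ∉ N.small j) : (N.merge G j).ldr x = N.ldr x := if_neg h

lemma line_of_small {t : ℕ} {x : V} (h : x ∈ N.small j) :
    N.line G j t x = lineToTree (treeRoot N.up x) (N.ring G j) t x := if_pos h

lemma line_of_not_small {t : ℕ} {x : V} (h : x ∉ N.small j) : N.line G j t x = N.par x := if_neg h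

variable (hN : N.Valid) (hF : N.HasForest G Set.univ)
include hN hF

lemma merge_comm_of_small {u : V} (hu : treeRoot N.up u = u) (hs : u ∈ N.small j) :
    (N.merge G j).comm u = N.tree u := by
  ext x
  change (N.merge G j).ldr x = u ↔ treeRoot N.up x = u
  by_cases hx : x ∈ N.small j
  · rw [merge_ldr_of_small hx]
  · rw [merge_ldr_of_not_small hx]
    refine iff_of_false ?_ ?_
    · rintro rfl
      exact hx ((small_iff_of_ldr hN hF (hN.ldr_ldr x)).1 hs)
    · intro h
      exact hx ((small_iff_of_root hN hF (h.trans hu.symm)).2 hs)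

lemma merge_comm_of_not_small {u : V} (hu : N.ldr u = u) (hs : u ∉ N.small j) :
    (N.merge G j).comm u = N.comm u := by
  ext x
  change (N.merge G j).ldr x = u ↔ N.ldr x = u
  by_cases hx : x ∈ N.small j
  · rw [merge_ldr_of_small hx]
    refine iff_of_false ?_ ?_
    · rintro rfl
      exact hs ((small_root hN hF x).2 hx)
    · intro h
      exact hs ((small_iff_of_ldr hN hF (h.trans hu.symm)).1 hx)
  · rw [merge_ldr_of_not_small hx]

/-- For a merged tree the ring is the tour and the parents come from the closed form of the line
after it has become stationary. Other committees are untouched. -/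
lemma merge_valid : (N.merge G j).Valid where
  ldr_ldr x := by
    by_cases hx : x ∈ N.small j
    · rw [merge_ldr_of_small hx, merge_ldr_of_small ((small_root hN hF x).2 hx),
        (hF.isForest hN).root_root]
    · rw [merge_ldr_of_not_small hx, merge_ldr_of_not_small, hN.ldr_ldr]
      rwa [small_iff_of_ldr hN hF (hN.ldr_ldr x)]
  le_ldr x := by
    by_cases hx : x ∈ N.small j
    · rw [merge_ldr_of_small hx]
      exact (hN.le_ldr x).trans (hF.ldr_le_root hN x)
    · rw [merge_ldr_of_not_small hx]; exact hN.le_ldr x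
  cycle u hu := by
    by_cases hs : u ∈ N.small j
    · rw [merge_ldr_of_small hs] at hu
      rw [merge_comm_of_small hN hF hu hs]
      exact ring_isCycleOn hN hF hu hs
    · rw [merge_ldr_of_not_small hs] at hu
      rw [merge_comm_of_not_small hN hF hu hs]
      refine (hN.cycle u hu).congr_of_eq fun x hx => (ring_of_not_small hN hF ?_).symm
      rwa [small_iff_of_ldr hN hF ((show N.ldr x = u from hx).trans hu.symm)]
  par_eq u hu i hi := by
    by_cases hs : u ∈ N.small j
    · rw [merge_ldr_of_small hs] at hu
      rw [merge_comm_of_small hN hF hu hs] at hi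
      have he := ring_enumerates hN hF hu hs
      have hm : treeRoot N.up ((N.ring G j ^ i) u) = u := he.mem i hi
      have hms := (small_iff_of_root hN hF (hm.trans hu.symm)).2 hs
      change N.line G j (j + 1) ((N.ring G j ^ i) u) = (N.ring G j ^ (i - 2 ^ heapExp i)) u
      have hsz : (N.tree u).ncard ≤ 2 ^ j := by have := hs.2; rwa [hu] at this
      rw [line_of_small hms, hm, lineToTree_ring hN hF hu hs _ hi,
        heapParent_eq_of_le ((heapExp_le (hi.trans_le hsz)).trans (Nat.le_succ j))]
    · rw [merge_ldr_of_not_small hs] at hu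
      rw [merge_comm_of_not_small hN hF hu hs] at hi
      have hpow : ∀ i, N.ldr ((N.succ ^ i) u) = u ∧ (N.ring G j ^ i) u = (N.succ ^ i) u := by
        intro i
        induction i with
        | zero => exact ⟨hu, rfl⟩
        | succ i ih =>
          rw [pow_succ', pow_succ', Equiv.Perm.mul_apply, Equiv.Perm.mul_apply, ih.2,
            hN.ldr_succ]
          refine ⟨ih.1, ring_of_not_small hN hF ?_⟩
          rwa [small_iff_of_ldr hN hF (ih.1.trans hu.symm)]
      change N.line G j (j + 1) ((N.ring G j ^ i) u) = (N.ring G j ^ (i - 2 ^ heapExp i)) u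
      rw [(hpow _).2, (hpow _).2, line_of_not_small, hN.par_eq u hu i hi]
      rwa [small_iff_of_ldr hN hF ((hpow i).1.trans hu.symm)]
  busy_ldr x := by
    change _ ∈ N.busy ∧ _ ∉ N.small j ↔ _ ∈ N.busy ∧ _ ∉ N.small j
    by_cases hx : x ∈ N.small j
    · rw [merge_ldr_of_small hx]
      exact iff_of_false (fun h => h.2 ((small_root hN hF x).2 hx)) fun h => h.2 hx
    · rw [merge_ldr_of_not_small hx, hN.busy_ldr, small_iff_of_ldr hN hF (hN.ldr_ldr x)]

/-- The committee selected by a waiting committee lies in the same tree and waits as well, so the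
ports of waiting committees stay valid. -/
lemma merge_hasForest : (N.merge G j).HasForest G (N.merge G j).busy := by
  rintro u ⟨hub, hus⟩ hu
  rw [merge_ldr_of_not_small hus] at hu
  obtain ⟨a, ha, h1, h2⟩ := hF u trivial hu
  have hx : ∀ x, N.ldr x = u → x ∉ N.small j := fun x hx => by
    rwa [small_iff_of_ldr hN hF (hx.trans hu.symm)]
  have hiff : ∀ x, (N.merge G j).ldr x = u ↔ N.ldr x = u := fun x => by
    have := Set.ext_iff.1 (merge_comm_of_not_small hN hF hu hus (G := G)) x
    exact this
  have hup : ∀ x, x ∉ N.small j → (N.merge G j).up x = N.up x := fun x hx => if_neg hx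
  refine ⟨a, (hiff a).2 ha, fun x hx' hne => ?_, ?_⟩
  · have hx' := (hiff x).1 hx'
    rw [hup x (hx x hx'), h1 x hx' hne]
    exact (ring_symm_of_not_small hN hF (hx x hx')).symm
  · rw [hup a (hx a ha), hup u hus]
    refine h2.imp id fun h => ?_
    have hus' : N.up a ∉ N.small j := by
      rw [small_iff_of_root hN hF ((hF.isForest hN).root_parent a)]
      exact hx a ha
    exact ⟨⟨hub, hus⟩, h.2.1, by rw [merge_ldr_of_not_small hus']; exact h.2.2.1,
      h.2.2.2, hus'⟩

/-- The size bound carried to the next slot: new committees have at most `2 ^ j` nodes because only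
small trees are merged, and older free ones obeyed the bound before. -/
lemma merge_comm_ncard_le (hsize : ∀ x ∉ N.busy, (N.comm (N.ldr x)).ncard ≤ 2 ^ j) {x : V}
    (hx : x ∉ (N.merge G j).busy) :
    ((N.merge G j).comm ((N.merge G j).ldr x)).ncard ≤ 2 ^ (j + 1) := by
  have hle : 2 ^ j ≤ 2 ^ (j + 1) := Nat.pow_le_pow_right (by norm_num) (Nat.le_succ j)
  by_cases hs : x ∈ N.small j
  · rw [merge_ldr_of_small hs, merge_comm_of_small hN hF ((hF.isForest hN).root_root x)
      ((small_root hN hF x).2 hs)]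
    exact hs.2.trans hle
  · rw [merge_ldr_of_not_small hs, merge_comm_of_not_small hN hF (hN.ldr_ldr x)
      (by rwa [small_iff_of_ldr hN hF (hN.ldr_ldr x)])]
    exact (hsize x fun hb => hx ⟨hb, hs⟩).trans hle

lemma merge_sel {u : V} (hu : N.ldr u = u) (hub : u ∈ N.busy) (hus : u ∉ N.small j) :
    (N.merge G j).sel u = N.sel u := by
  obtain ⟨a, ha, h1, h2⟩ := hF u trivial hu
  have hx : ∀ x, N.ldr x = u → x ∉ N.small j := fun x hx => by
    rwa [small_iff_of_ldr hN hF (hx.trans hu.symm)]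
  have hiff : ∀ x, (N.merge G j).ldr x = u ↔ N.ldr x = u := fun x => by
    have := Set.ext_iff.1 (merge_comm_of_not_small hN hF hu hus (G := G)) x
    exact this
  have hup : ∀ x, x ∉ N.small j → (N.merge G j).up x = N.up x := fun x hx => if_neg hx
  have h3 := sel_of_port hN hu ha h1
  have h4 := sel_of_port (merge_valid hN hF (G := G) (j := j)) ((hiff u).2 hu) ((hiff a).2 ha)
    (fun x hx' hne => by
      have hx' := (hiff x).1 hx'
      rw [hup x (hx x hx'), h1 x hx' hne]
      exact (ring_symm_of_not_small hN hF (hx x hx')).symm)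
  rw [hup a (hx a ha), hup u hus] at h4
  rcases h2 with h2 | h2
  · rw [h3.1 h2.1 h2.2, h4.1 h2.1 h2.2]
  · have hus' : N.up a ∉ N.small j := by
      rw [small_iff_of_root hN hF ((hF.isForest hN).root_parent a)]
      exact hx a ha
    rw [merge_ldr_of_not_small hus'] at h4
    rw [h3.2 h2.1 h2.2.2.1, h4.2 ⟨hub, hus⟩ h2.2.2.1]

lemma exists_leastTour_and {x : V} {P : List V → Prop} :
    (∃ l, (N.toured G).LeastTour x l ∧ P l) ↔ P (N.tour G (treeRoot N.up x)) := by
  simp only [leastTour_iff (hF.isForest hN), exists_eq_left]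

/-- The labels that the nodes compute from the tour lists are those of the abstract merger, defined
by the permutation `ring` and the iteration `lineToTree`. -/
lemma label_merge : (N.toured G).label (.merge j) = (N.merge G j).plain G := by
  have hp := hF.isForest hN
  funext x tag
  have hsm := know_small (G := G) hp (j := j) (x := x)
  by_cases hs : x ∈ N.small j
  · have hs' := hsm.2 hs
    have hr := hp.root_root x
    have hrs := (small_root hN hF x).2 hs
    cases tag <;> simp only [Know.label, if_pos hs', exists_leastTour_and hN hF] <;> try rfl
    all_goals ext y
    · rw [List.head?_eq_getElem?, head_tour hp hr]
      simp only [Set.mem_ofPred_eq, Option.some.injEq, plain, know, merge_ldr_of_small hs,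
        Set.mem_singleton_iff, @eq_comm _ y]
    · rw [Set.mem_ofPred_eq, listNext_tour hN hF hr hrs rfl]
      exact eq_comm
    · by_cases hy : treeRoot N.up y = treeRoot N.up x
      · rw [Set.mem_ofPred_eq, listNext_tour hN hF hr hrs hy]
        exact (Equiv.eq_symm_apply _).symm
      · refine iff_of_false ?_ ?_
        · rintro ⟨i, h1, _⟩
          exact hy ((mem_tour (G := G) hp hr).1 (List.mem_of_getElem? h1))
        · intro h
          have h : y = (N.ring G j).symm x := h
          rw [h, root_ring_symm hN hF] at hy
          exact hy rfl
    · rw [Set.mem_ofPred_eq, listParent_tour hN hF hr hrs rfl]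
      change _ ↔ y = N.line G j (j + 1) x
      rw [line_of_small hs]
      exact eq_comm
    · exact iff_of_false (Set.notMem_empty y) fun h => h.2.2 hs
    · change y = x ↔ y = (N.merge G j).up x
      rw [show (N.merge G j).up x = x from if_pos hs]
  · have hs' := hsm.not.2 hs
    cases tag <;> simp only [Know.label, if_neg hs'] <;> try rfl
    all_goals ext y
    · simp only [plain, know, merge_ldr_of_not_small hs]
    · change y = N.succ x ↔ y = N.ring G j x
      rw [ring_of_not_small hN hF hs]
    · change y = N.succ.symm x ↔ y = (N.ring G j).symm x
      rw [ring_symm_of_not_small hN hF hs]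
    · change y = N.par x ↔ y = N.line G j (j + 1) x
      rw [line_of_not_small hs]
    · exact ⟨fun h => ⟨h.1, h.2, hs⟩, fun h => ⟨h.1, h.2.1⟩⟩
    · change y = N.up x ↔ y = (N.merge G j).up x
      rw [show (N.merge G j).up x = N.up x from if_neg hs]

/-! ### The edges in the rounds of the stage -/

lemma want_jump {τ : ℕ} (hτ : τ < j + 1) {x y : V} : y ∈ (N.toured G).want (.merge j) τ x ↔
    y ∈ (N.toured G).base x ∨ (x ∈ N.busy ∧ ∃ b b', (eulerPerm N.up ^ 2 ^ τ) (x, b) = (y, b')) := by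
  by_cases hb : x ∈ N.busy
  · have : (N.toured G) x .busy ≠ ∅ := Set.nonempty_iff_ne_empty.1 ⟨x, rfl, hb⟩
    simp only [Know.want, if_pos hτ, if_neg this, Set.mem_union, mem_jumps, hb, true_and]
  · have : (N.toured G) x .busy = ∅ := Set.eq_empty_iff_forall_notMem.2 fun y h => hb h.2
    simp only [Know.want, if_pos hτ, if_pos this, hb, false_and, or_false]

lemma want_of_not_small {τ : ℕ} (hτ : j + 1 ≤ τ) {x : V} (hx : x ∉ N.small j) :
    (N.toured G).want (.merge j) τ x = (N.toured G).base x := by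
  have := (know_small (G := G) (hF.isForest hN) (j := j) (x := x)).not.2 hx
  simp only [Know.want, if_neg (show ¬ τ < j + 1 by omega), if_pos this]

lemma want_near {x y : V} (hx : x ∈ N.small j) : y ∈ (N.toured G).want (.merge j) (j + 1) x ↔
    y ∈ (N.toured G).base x ∨ (treeRoot N.up y = treeRoot N.up x ∧
      Near2 (N.toured G).Link (N.tree (treeRoot N.up x)) x y) := by
  have hp := hF.isForest hN
  have := (know_small (G := G) hp (j := j) (x := x)).2 hx
  simp only [Know.want, lt_irrefl, if_false, if_neg (not_not.2 this), if_true, Set.mem_union,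
    group_eq hp]
  rfl

lemma want_line {t : ℕ} {x y : V} (hx : x ∈ N.small j) :
    y ∈ (N.toured G).want (.merge j) (j + 2 + t) x ↔
    G.Adj x y ∨ N.ring G j x = y ∨ N.line G j t x = y := by
  have hp := hF.isForest hN
  have := (know_small (G := G) hp (j := j) (x := x)).2 hx
  have hr := hp.root_root x
  have hrs := (small_root hN hF x).2 hx
  simp only [Know.want, if_neg (not_not.2 this), if_neg (show ¬ j + 2 + t < j + 1 by omega),
    if_neg (show ¬ j + 2 + t = j + 1 by omega), exists_leastTour_and hN hF, Set.mem_union,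
    Set.mem_ofPred_eq, listNext_tour hN hF hr hrs rfl, listParent_tour hN hF hr hrs rfl,
    line_of_small hx, Nat.add_sub_cancel_left]
  rfl

lemma want_of_not_busy {τ : ℕ} {x : V} (hx : x ∉ N.busy) :
    (N.toured G).want (.merge j) τ x = (N.toured G).base x := by
  by_cases hτ : τ < j + 1
  · ext y
    simp only [want_jump hN hF hτ, hx, false_and, or_false]
  · exact want_of_not_small hN hF (by omega) fun h => hx h.1

/-- Edges of the initial graph are wanted throughout. -/
lemma adj_want {τ : ℕ} {x y : V} (h : G.Adj x y) : y ∈ (N.toured G).want (.merge j) τ x := by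
  have hb : y ∈ (N.toured G).base x := Or.inl (Or.inl h)
  by_cases hs : x ∈ N.small j
  · rcases lt_trichotomy τ (j + 1) with hτ | rfl | hτ
    · exact (want_jump hN hF hτ).2 (Or.inl hb)
    · exact (want_near hN hF hs).2 (Or.inl hb)
    · obtain ⟨t, rfl⟩ : ∃ t, τ = j + 2 + t := ⟨τ - (j + 2), by omega⟩
      exact (want_line hN hF hs).2 (Or.inl h)
  · by_cases hτ : τ < j + 1
    · exact (want_jump hN hF hτ).2 (Or.inl hb)
    · rwa [want_of_not_small hN hF (by omega) hs]

lemma base_subset_want {τ : ℕ} {x : V} (h : τ ≤ j + 1 ∨ x ∉ N.small j) :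
    (N.toured G).base x ⊆ (N.toured G).want (.merge j) τ x := by
  intro y hy
  by_cases hτ : τ < j + 1
  · exact (want_jump hN hF hτ).2 (Or.inl hy)
  · by_cases hs : x ∈ N.small j
    · obtain rfl : τ = j + 1 := by have := h.resolve_right (not_not.2 hs); omega
      exact (want_near hN hF hs).2 (Or.inl hy)
    · rwa [want_of_not_small hN hF (by omega) hs]

end Net

/-! ## Merging: the rounds of the stage -/

lemma dist_two {V : Type} {D : SimpleGraph V} {x y z : V} (h1 : z = x ∨ D.Adj x z)
    (h2 : y = z ∨ D.Adj z y) : y = x ∨ D.Adj x y ∨ ∃ u, D.Adj x u ∧ D.Adj u y := by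
  rcases h1 with rfl | h1 <;> rcases h2 with rfl | h2
  · exact Or.inl rfl
  · exact Or.inr (Or.inl h2)
  · exact Or.inr (Or.inl h1)
  · exact Or.inr (Or.inr ⟨z, h1, h2⟩)

lemma Near2.symm {V : Type*} {E : V → V → Prop} {S : Set V} (hE : ∀ x y, E x y → E y x) {x y : V}
    (h : Near2 E S x y) : Near2 E S y x := by
  obtain ⟨w, hw, h1, h2⟩ := h
  exact ⟨w, hw, h2.imp Eq.symm (hE _ _), h1.imp Eq.symm (hE _ _)⟩

namespace Net

variable {V : Type} [LinearOrder V] {N : Net V} {G : SimpleGraph V} {j : ℕ}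

/-- The graph of active edges in the rounds of a merging stage. -/
abbrev mergeGraph (N : Net V) (G : SimpleGraph V) (j τ : ℕ) : SimpleGraph V :=
  stageGraph (N.toured G) (.merge j) (N.graph G) τ

lemma mergeGraph_of_want {τ : ℕ} {x y : V} (h : y ∈ (N.toured G).want (.merge j) τ x) :
    y = x ∨ (N.mergeGraph G j (τ + 1)).Adj x y := by
  by_cases hyx : y = x
  · exact Or.inl hyx
  · exact Or.inr ((SimpleGraph.fromRel_adj _ _ _).2 ⟨Ne.symm hyx, Or.inl h⟩)

/-- A step of the tour crosses at most two forest edges, the worst case being up to the parent and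
down to the next sibling. So the first doubling round may activate it. -/
lemma EulerStep_link {x y : V} {b b' : Bool} (h : EulerStep N.up (x, b) (y, b')) :
    ∃ z, (z = x ∨ (N.toured G).Link x z) ∧ (y = z ∨ (N.toured G).Link z y) := by
  cases b <;> cases b'
  · exact ⟨x, Or.inl rfl, Or.inr (Or.inr h.1.2.symm)⟩
  · exact ⟨x, Or.inl rfl, Or.inl h.1⟩
  · rcases h with h | h
    · exact ⟨N.up x, Or.inr (Or.inl rfl), Or.inr (Or.inr h.2.1.1.2.symm)⟩
    · exact ⟨x, Or.inl rfl, Or.inl h.1⟩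
  · exact ⟨x, Or.inl rfl, Or.inr (Or.inl h.1)⟩

variable [Finite V] (hN : N.Valid) (hF : N.HasForest G Set.univ)
include hN hF

lemma mergeGraph_of_base {τ : ℕ} {x y : V} (hτ : τ ≤ j + 2 ∨ x ∉ N.small j)
    (h : y ∈ (N.toured G).base x) : y = x ∨ (N.mergeGraph G j τ).Adj x y := by
  cases τ with
  | zero => exact Ready.base_adj h
  | succ τ => exact mergeGraph_of_want (base_subset_want hN hF (hτ.imp (by omega) id) h)

lemma le_mergeGraph (τ : ℕ) : G ≤ N.mergeGraph G j τ := by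
  intro x y h
  cases τ with
  | zero => exact Or.inl (Or.inl h)
  | succ τ =>
    exact (mergeGraph_of_want (adj_want hN hF h)).resolve_left h.ne'

lemma mergeGraph_of_graph {τ : ℕ} (hτ : τ ≤ j + 2) {x y : V} (h : (N.graph G).Adj x y) :
    (N.mergeGraph G j τ).Adj x y := by
  have h' := h
  rw [N.graph_eq G (fun _ => ∅) (eulerNext N.up), SimpleGraph.fromRel_adj] at h'
  rcases h'.2 with h' | h'
  · exact (mergeGraph_of_base hN hF (Or.inl hτ) h').resolve_left h.ne'
  · exact ((mergeGraph_of_base hN hF (Or.inl hτ) h').resolve_left h.ne).symm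

lemma mergeGraph_of_link {τ : ℕ} (hτ : τ ≤ j + 2) {x y : V} (h : (N.toured G).Link x y) :
    y = x ∨ (N.mergeGraph G j τ).Adj x y := by
  rcases h with h | h
  · rw [show y = N.up x from h]
    exact (hF.up_adj hN x).imp id (mergeGraph_of_graph hN hF hτ)
  · rw [show x = N.up y from h]
    exact (hF.up_adj hN y).imp Eq.symm fun h => (mergeGraph_of_graph hN hF hτ h).symm

lemma busy_eulerPerm {n : ℕ} {x y : V} {b b' : Bool}
    (h : (eulerPerm N.up ^ n) (x, b) = (y, b')) : y ∈ N.busy ↔ x ∈ N.busy := by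
  have := eulerPerm_root (hF.isForest hN) n (x, b)
  rw [h] at this
  rw [← (hF.root_ldr hN y).2.2, ← (hF.root_ldr hN x).2.2]
  simp only at this
  rw [this]

lemma line_succ (t : ℕ) (x : V) : N.line G j (t + 1) x = N.line G j t x ∨
    N.line G j (t + 1) x = N.line G j t (N.line G j t x) ∨ x ∉ N.small j := by
  by_cases hs : x ∈ N.small j
  swap
  · exact Or.inr (Or.inr hs)
  have hr := (hF.isForest hN).root_root x
  have hm := lineToTree_mem hN hF hr ((small_root hN hF x).2 hs) (G := G) t rfl
  have hms : lineToTree (treeRoot N.up x) (N.ring G j) t x ∈ N.small j :=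
    (small_iff_of_root hN hF hm).2 hs
  rw [line_of_small hs, line_of_small hs, line_of_small hms, hm]
  simp only [lineToTree, Function.iterate_succ_apply', lineToTreeStep]
  split_ifs
  · exact Or.inl rfl
  · exact Or.inr (Or.inl rfl)

/-- The wanted edges join nodes at distance at most two. -/
lemma merge_dist_two {τ : ℕ} {x y : V} (h : y ∈ (N.toured G).want (.merge j) τ x) :
    y = x ∨ (N.mergeGraph G j τ).Adj x y ∨
      ∃ u, (N.mergeGraph G j τ).Adj x u ∧ (N.mergeGraph G j τ).Adj u y := by
  have hp := hF.isForest hN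
  have hbase : (τ ≤ j + 2 ∨ x ∉ N.small j) → y ∈ (N.toured G).base x →
      y = x ∨ (N.mergeGraph G j τ).Adj x y ∨
      ∃ u, (N.mergeGraph G j τ).Adj x u ∧ (N.mergeGraph G j τ).Adj u y := fun h1 h2 =>
    (mergeGraph_of_base hN hF h1 h2).imp id Or.inl
  by_cases hτ : τ < j + 1
  · rcases (want_jump hN hF hτ).1 h with h | ⟨hb, b, b', h⟩
    · exact hbase (Or.inl (by omega)) h
    · cases τ with
      | zero =>
        rw [pow_zero, pow_one, ← eulerStep_iff] at h
        obtain ⟨z, h1, h2⟩ := EulerStep_link (G := G) h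
        exact dist_two (h1.elim Or.inl (mergeGraph_of_link hN hF (by omega)))
          (h2.elim Or.inl (mergeGraph_of_link hN hF (by omega)))
      | succ τ =>
        -- A jump of `2 ^ (τ + 1)` is two jumps of `2 ^ τ`, whose edges were made in the previous
        -- round.
        rw [pow_succ 2, mul_two, pow_add, Equiv.Perm.mul_apply] at h
        rcases hz : (eulerPerm N.up ^ 2 ^ τ) (x, b) with ⟨z, c⟩
        rw [hz] at h
        exact dist_two (mergeGraph_of_want ((want_jump hN hF (by omega)).2 (Or.inr ⟨hb, b, c, hz⟩)))
          (mergeGraph_of_want ((want_jump hN hF (by omega)).2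
            (Or.inr ⟨(busy_eulerPerm hN hF hz).2 hb, c, b', h⟩)))
  by_cases hs : x ∈ N.small j
  swap
  · rw [want_of_not_small hN hF (by omega) hs] at h
    exact hbase (Or.inr hs) h
  rcases Nat.eq_or_lt_of_le (not_lt.1 hτ) with rfl | hlt
  · rcases (want_near hN hF hs).1 h with h | ⟨_, w, _, h1, h2⟩
    · exact hbase (Or.inl (by omega)) h
    · exact dist_two (h1.elim (fun h => Or.inl h.symm) (mergeGraph_of_link hN hF (by omega)))
        (h2.elim (fun h => Or.inl h.symm) (mergeGraph_of_link hN hF (by omega)))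
  obtain ⟨t, rfl⟩ : ∃ t, τ = j + 2 + t := ⟨τ - (j + 2), by omega⟩
  have hr := hp.root_root x
  have hrs := (small_root hN hF x).2 hs
  -- Successive nodes of the tour are three links apart: the first two are spanned by a shortcut of
  -- round `j + 1`, the third is an old edge.
  have hring : ∀ z, treeRoot N.up z = treeRoot N.up x →
      N.ring G j z = z ∨ (N.mergeGraph G j (j + 2)).Adj z (N.ring G j z) ∨
      ∃ u, (N.mergeGraph G j (j + 2)).Adj z u ∧ (N.mergeGraph G j (j + 2)).Adj u (N.ring G j z) := by
    intro z hz
    have hzs := (small_iff_of_root hN hF hz).2 hs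
    obtain ⟨w, hw, h1, h2⟩ := near3_tour hp hr ((listNext_tour hN hF hr hrs hz).2 rfl)
    refine dist_two (z := w) (mergeGraph_of_want ((want_near hN hF hzs).2 (Or.inr ⟨?_, ?_⟩)))
      (h2.elim (fun h => Or.inl h.symm) (mergeGraph_of_link hN hF (by omega)))
    · rw [hz]; exact hw
    · rw [hz]; exact h1
  rcases (want_line hN hF hs).1 h with h | rfl | rfl
  · exact Or.inr (Or.inl (le_mergeGraph hN hF _ h))
  · cases t with
    | zero => exact hring x rfl
    | succ t =>
      exact (mergeGraph_of_want ((want_line hN hF hs).2 (Or.inr (Or.inl rfl)))).imp id Or.inl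
  · cases t with
    | zero =>
      by_cases hxr : x = treeRoot N.up x
      · left
        rw [line_of_small hs]
        simp only [lineToTree, Function.iterate_zero, id, if_pos hxr]
        exact hxr.symm
      · rw [line_of_small hs]
        simp only [lineToTree, Function.iterate_zero, id, if_neg hxr]
        -- The line at `t = 0` consists of ring edges, seen from the successor.
        have := hring ((N.ring G j).symm x) (root_ring_symm hN hF x)
        rw [Equiv.apply_symm_apply] at this
        rcases this with h | h | ⟨u, h1, h2⟩
        · exact Or.inl h.symm
        · exact Or.inr (Or.inl h.symm)
        · exact Or.inr (Or.inr ⟨u, h2.symm, h1.symm⟩)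
    | succ t =>
      have h1 : ∀ z, z ∈ N.small j → N.line G j t z = z ∨
          (N.mergeGraph G j (j + 2 + (t + 1))).Adj z (N.line G j t z) := fun z hz =>
        mergeGraph_of_want (τ := j + 2 + t) ((want_line hN hF hz).2 (Or.inr (Or.inr rfl)))
      have hms : N.line G j t x ∈ N.small j := by
        rw [line_of_small hs]
        exact (small_iff_of_root hN hF (lineToTree_mem hN hF hr hrs t rfl)).2 hs
      -- The new parent is the old parent or the old grandparent, so old parent edges provide the
      -- path.
      rcases line_succ hN hF t x with h | h | h
      · rw [h]; exact (h1 x hs).imp id Or.inl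
      · rw [h]; exact dist_two (h1 x hs) (h1 _ hms)
      · exact absurd hs h

/-- The nodes learn their trees by doubling. -/
lemma eulerPerm_mem_heard {τ : ℕ} (hτ : τ ≤ j + 1) {m : ℕ} (hm : m < 2 ^ τ) {x : V}
    (hx : x ∈ N.busy) (b : Bool) : ((eulerPerm N.up ^ m) (x, b)).1 ∈
      stageHeard (N.toured G) (.merge j) (N.graph G) (τ + 1) x := by
  induction τ generalizing m x b with
  | zero =>
    obtain rfl : m = 0 := by simpa using hm
    exact mem_stageHeard _ _
  | succ τ ih =>
    rcases lt_or_ge m (2 ^ τ) with hlt | hge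
    · exact Or.inl (ih (by omega) hlt hx b)
    · obtain ⟨k, rfl⟩ : ∃ k, m = k + 2 ^ τ := ⟨m - 2 ^ τ, by omega⟩
      rw [pow_add, Equiv.Perm.mul_apply]
      -- The node `z` lies `2 ^ τ` positions ahead and is now a neighbour; what it has heard covers
      -- the next `2 ^ τ` positions.
      rcases hz : (eulerPerm N.up ^ 2 ^ τ) (x, b) with ⟨z, c⟩
      have h1 := ih (by omega) (m := k) (by rw [pow_succ] at hm; omega)
        ((busy_eulerPerm hN hF hz).2 hx) c
      rcases mergeGraph_of_want (j := j) (G := G)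
        ((want_jump hN hF (by omega)).2 (Or.inr ⟨hx, b, c, hz⟩)) with h | h
      · subst h
        exact Or.inl h1
      · exact Or.inr ⟨z, h, h1⟩

lemma merge_covered (τ : ℕ) (x : V) : (N.toured G).Covered
    (stageHeard (N.toured G) (.merge j) (N.graph G) (τ + 1) x) x (.merge j) τ := by
  have hp := hF.isForest hN
  intro hb
  have hx : x ∈ N.busy := by
    obtain ⟨y, hy⟩ := Set.nonempty_iff_ne_empty.2 hb
    exact hy.2
  refine ⟨fun hτ m hm b w hw => ?_, fun hτ => Or.inr ⟨fun y => Set.singleton_ne_empty y,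
    fun hcard y hy => ?_⟩⟩
  · rw [tourWalk_iff] at hw
    rw [← hw]
    exact eulerPerm_mem_heard hN hF (by omega) hm hx b
  · rw [group_eq hp] at hy hcard
    -- The tour of at most `2 ^ j` nodes has at most `2 ^ (j + 1)` positions, all of which have been
    -- heard of after the doublings.
    obtain ⟨k, hk, b, hkb⟩ := exists_eulerPerm_pow hp hy hcard
    have h1 := eulerPerm_mem_heard hN hF (G := G) (le_refl (j + 1)) (m := k)
      (by rw [pow_succ]; omega) hx false
    rw [hkb] at h1
    obtain ⟨d, rfl⟩ : ∃ d, τ = j + 1 + d := ⟨τ - (j + 1), by omega⟩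
    clear hτ
    induction d with
    | zero => exact h1
    | succ d ih => exact Or.inl ih

/-! ### Degrees -/

omit hN hF in
omit [Finite V] in
lemma not_base_of {x y : V} (hne : x ≠ y) (hadj : ¬ G.Adj x y)
    (h : y ∈ (N.toured G).base x ∨ x ∈ (N.toured G).base y) :
    y ∈ {w | x ≠ w ∧ (N.succ x = w ∨ N.succ w = x ∨ N.par x = w ∨ N.par w = x)} := by
  refine ⟨hne, ?_⟩
  rcases h with (((h : G.Adj x y) | h) | h) | (((h : G.Adj y x) | h) | h)
  · exact absurd h hadj
  · exact Or.inl (Eq.symm h)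
  · exact Or.inr (Or.inr (Or.inl (Eq.symm h)))
  · exact absurd h.symm hadj
  · exact Or.inr (Or.inl (Eq.symm h))
  · exact Or.inr (Or.inr (Or.inr (Eq.symm h)))

/-- Forest neighbours are the parent and the children, and a child is the ring successor or an
initial neighbour; with `v` itself this gives `Δ + 3`. -/
lemma ncard_link_le {Δ : ℕ} (hΔ : ∀ v, (G.neighborSet v).ncard ≤ Δ) (v : V) :
    {w | w = v ∨ (N.toured G).Link v w}.ncard ≤ Δ + 3 := by
  refine le_trans (Set.ncard_le_ncard (t := {v, N.up v, N.succ v} ∪ G.neighborSet v) ?_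
    (Set.toFinite _)) ((Set.ncard_union_le _ _).trans (by
      have := Set.ncard_triple_le v (N.up v) (N.succ v)
      have := hΔ v
      omega))
  rintro w (rfl | h | h)
  · simp
  · rw [show w = N.up v from h]; simp
  · have h : v = N.up w := h
    rcases hF.up_cases hN w with h' | h' | h'
    · rw [h, h']; simp
    · rw [h, h']; simp
    · rw [← h] at h'
      exact Or.inr h'.symm

lemma ncard_near2_le {Δ : ℕ} (hΔ : ∀ v, (G.neighborSet v).ncard ≤ Δ) (v : V) :
    {w | Near2 (N.toured G).Link Set.univ v w}.ncard ≤ (Δ + 3) ^ 2 := by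
  classical
  have := Fintype.ofFinite V
  let A : V → Finset V := fun v => {w | w = v ∨ (N.toured G).Link v w}.toFinset
  have hA : ∀ v, (A v).card ≤ Δ + 3 := fun v => by
    rw [← Set.ncard_eq_toFinset_card']
    exact ncard_link_le hN hF hΔ v
  have h1 : ((A v).biUnion A).card ≤ (Δ + 3) ^ 2 := by
    rw [sq]
    exact (Finset.card_biUnion_le_card_mul _ _ _ fun u _ => hA u).trans
      (Nat.mul_le_mul_right _ (hA v))
  refine le_trans ?_ h1
  rw [← Set.ncard_coe_finset]
  refine Set.ncard_le_ncard ?_ (Set.toFinite _)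
  rintro w ⟨u, _, h2, h3⟩
  simp only [Finset.mem_coe, Finset.mem_biUnion, A, Set.mem_toFinset, Set.mem_ofPred_eq]
  exact ⟨u, h2.imp Eq.symm id, h3.imp Eq.symm id⟩

lemma ncard_line_le (t : ℕ) (v : V) :
    {w | v ∈ N.small j ∧ treeRoot N.up w = treeRoot N.up v ∧ w ≠ v ∧ N.line G j t w = v}.ncard ≤ 3 := by
  by_cases hs : v ∈ N.small j
  swap
  · simp [hs]
  have hr := (hF.isForest hN).root_root v
  have hrs := (small_root hN hF v).2 hs
  refine le_trans (Set.ncard_le_ncard ?_ (Set.toFinite _))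
    ((ring_enumerates hN hF hr hrs (G := G)).ncard_children_le (P := lineToTree (treeRoot N.up v)
      (N.ring G j) t) (t := t) (fun i hi => lineToTree_ring hN hF hr hrs t hi) (v := v) rfl)
  rintro w ⟨_, h1, h2, h3⟩
  refine ⟨h1, h2, ?_⟩
  rw [line_of_small ((small_iff_of_root hN hF h1).2 hs), h1] at h3
  exact h3

/-- At most six old edges at a node, plus those of the current phase: four for jumps, `(Δ + 3) ^ 2`
for shortcuts, six for ring and line. -/
lemma degree_mergeGraph_le {Δ : ℕ} (hΔ : ∀ v, (G.neighborSet v).ncard ≤ Δ) (τ : ℕ) (v : V) :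
    ((N.mergeGraph G j τ \ G).neighborSet v).ncard ≤ (Δ + 3) ^ 2 + 12 := by
  cases τ with
  | zero => exact (hN.degree_graph_le v).trans (by omega)
  | succ τ =>
  have hp := hF.isForest hN
  have hB := hN.ncard_base_le v
  set B := {w | v ≠ w ∧ (N.succ v = w ∨ N.succ w = v ∨ N.par v = w ∨ N.par w = v)}
  have hadj : ∀ w, (N.mergeGraph G j (τ + 1) \ G).Adj v w → v ≠ w ∧ ¬ G.Adj v w ∧
      (w ∈ (N.toured G).want (.merge j) τ v ∨ v ∈ (N.toured G).want (.merge j) τ w) := by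
    rintro w ⟨h1, h2⟩
    have h1 := (SimpleGraph.fromRel_adj _ _ _).1 h1
    exact ⟨h1.1, h2, h1.2⟩
  suffices h : ∃ S : Set V, S.ncard ≤ (Δ + 3) ^ 2 + 6 ∧
      (N.mergeGraph G j (τ + 1) \ G).neighborSet v ⊆ B ∪ S by
    obtain ⟨S, h1, h2⟩ := h
    refine (Set.ncard_le_ncard h2 (Set.toFinite _)).trans ((Set.ncard_union_le _ _).trans ?_)
    omega
  rcases lt_trichotomy τ (j + 1) with hτ | rfl | hτ
  -- A node has two positions on the tour, so at most two jumps start and at most two end at it.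
  · set π := eulerPerm N.up ^ 2 ^ τ
    refine ⟨{(π (v, false)).1, (π (v, true)).1} ∪ {(π.symm (v, false)).1, (π.symm (v, true)).1},
      (Set.ncard_union_le _ _).trans ?_, fun w hw => ?_⟩
    · have h1 := Set.ncard_pair_le' (π (v, false)).1 (π (v, true)).1
      have h2 := Set.ncard_pair_le' (π.symm (v, false)).1 (π.symm (v, true)).1
      omega
    · obtain ⟨hne, hG, h⟩ := hadj w hw
      rw [want_jump hN hF hτ, want_jump hN hF hτ] at h
      rcases h with (h | ⟨_, b, b', h⟩) | (h | ⟨_, b, b', h⟩)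
      · exact Or.inl (not_base_of hne hG (Or.inl h))
      · right; left
        change π (v, b) = (w, b') at h
        cases b
        · left; rw [h]
        · right; rw [h]; rfl
      · exact Or.inl (not_base_of hne hG (Or.inr h))
      · right; right
        change π (w, b) = (v, b') at h
        rw [← Equiv.eq_symm_apply] at h
        cases b'
        · left; rw [← h]
        · right; rw [← h]; rfl
  · refine ⟨_, (ncard_near2_le hN hF hΔ v).trans (Nat.le_add_right _ 6), fun w hw => ?_⟩
    obtain ⟨hne, hG, h⟩ := hadj w hw
    have key : ∀ x y, y ∈ (N.toured G).want (.merge j) (j + 1) x →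
        y ∈ (N.toured G).base x ∨ Near2 (N.toured G).Link Set.univ x y := by
      intro x y h
      by_cases hs : x ∈ N.small j
      · rcases (want_near hN hF hs).1 h with h | ⟨_, u, _, h⟩
        · exact Or.inl h
        · exact Or.inr ⟨u, trivial, h⟩
      · rw [want_of_not_small hN hF le_rfl hs] at h
        exact Or.inl h
    rcases h with h | h <;> rcases key _ _ h with h | h
    · exact Or.inl (not_base_of hne hG (Or.inl h))
    · exact Or.inr h
    · exact Or.inl (not_base_of hne hG (Or.inr h))
    · exact Or.inr (h.symm fun x y h => Or.symm h)
  · obtain ⟨t, rfl⟩ : ∃ t, τ = j + 2 + t := ⟨τ - (j + 2), by omega⟩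
    -- Two ring neighbours, the parent, and at most three children.
    refine ⟨{N.ring G j v, (N.ring G j).symm v, N.line G j t v} ∪ {w | v ∈ N.small j ∧
      treeRoot N.up w = treeRoot N.up v ∧ w ≠ v ∧ N.line G j t w = v},
      (Set.ncard_union_le _ _).trans ?_, fun w hw => ?_⟩
    · have h1 := Set.ncard_triple_le (N.ring G j v) ((N.ring G j).symm v) (N.line G j t v)
      have h2 := ncard_line_le hN hF (G := G) (j := j) t v
      omega
    · obtain ⟨hne, hG, h⟩ := hadj w hw
      rcases h with h | h
      · by_cases hs : v ∈ N.small j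
        · rcases (want_line hN hF hs).1 h with h | h | h
          · exact absurd h hG
          · right; left; left; exact h.symm
          · right; left; right; right; exact h.symm
        · rw [want_of_not_small hN hF (by omega) hs] at h
          exact Or.inl (not_base_of hne hG (Or.inl h))
      · by_cases hs : w ∈ N.small j
        · rcases (want_line hN hF hs).1 h with h | h | h
          · exact absurd h.symm hG
          · right; left; right; left; exact ((N.ring G j).symm_apply_eq.2 h.symm).symm
          · right; right
            have hroot : treeRoot N.up v = treeRoot N.up w := by
              rw [← h, line_of_small hs]
              exact lineToTree_mem hN hF (hp.root_root w) ((small_root hN hF w).2 hs) t rfl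
            exact ⟨(small_iff_of_root hN hF hroot).2 hs, hroot.symm, hne.symm, h⟩
        · rw [want_of_not_small hN hF (by omega) hs] at h
          exact Or.inl (not_base_of hne hG (Or.inr h))

end Net

/-! ## Merging: the committees during the stage -/

namespace Net

variable {V : Type} [LinearOrder V] [Finite V] {N : Net V} {G : SimpleGraph V} {j : ℕ}

open Classical in
/-- The committees after `t` rounds of LineToCompleteBinaryTree in slot `j`. -/
noncomputable def running (N : Net V) (G : SimpleGraph V) (j t : ℕ) : Committees V where
  leader := N.ldr
  mode u := if u ∈ N.small j then .treeMerging else if u ∈ N.busy then .ringMerging else .selection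
  sel := N.sel
  succ := N.ring G j
  parent := N.line G j t
  moves _ := t

lemma running_mode_of_small {t : ℕ} {u : V} (h : u ∈ N.small j) :
    (N.running G j t).mode u = .treeMerging := if_pos h

lemma running_mode_of_busy {t : ℕ} {u : V} (h : u ∉ N.small j) (hb : u ∈ N.busy) :
    (N.running G j t).mode u = .ringMerging := (if_neg h).trans (if_pos hb)

lemma running_mode_of_not_busy {t : ℕ} {u : V} (hb : u ∉ N.busy) :
    (N.running G j t).mode u = .selection := (if_neg fun h => hb h.1).trans (if_neg hb)

variable (hN : N.Valid) (hF : N.HasForest G Set.univ)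
include hN hF

lemma mergeGraph_adj_of_not_busy (τ : ℕ) {x y : V} (hx : x ∉ N.busy) (hy : y ∉ N.busy) :
    (N.mergeGraph G j τ).Adj x y ↔ (N.graph G).Adj x y := by
  cases τ with
  | zero => exact Iff.rfl
  | succ τ =>
    rw [N.graph_eq G (fun _ => ∅) (eulerNext N.up)]
    simp only [mergeGraph, stageGraph, SimpleGraph.fromRel_adj, want_of_not_busy hN hF hx,
      want_of_not_busy hN hF hy]

lemma mergeGraph_isWreath {s : Committees V} (τ : ℕ) {u : V} (hu : N.ldr u = u) (hb : u ∉ N.busy)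
    (hl : s.leader = N.ldr) (hs : ∀ x ∉ N.busy, s.succ x = N.succ x ∧ s.parent x = N.par x) :
    s.IsWreath G (N.mergeGraph G j τ) u := by
  have hbx : ∀ x ∈ N.comm u, x ∉ N.busy := fun x hx =>
    (hN.not_busy_of_ldr ((show N.ldr x = u from hx).trans hu.symm)).2 hb
  exact hN.isWreath hu hl (fun x hx => hs x (hbx x hx)) fun x hx y hy =>
    mergeGraph_adj_of_not_busy hN hF τ (hbx x hx) (hbx y hy)

lemma sel_some_congr {u v : V} (hu : N.ldr u = u) (hs : N.sel u = some v) :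
    N.ldr v = v ∧ u < v ∧ u ∈ N.busy ∧ v ∈ N.busy ∧ (u ∈ N.small j ↔ v ∈ N.small j) := by
  obtain ⟨h1, h2, h3, h4⟩ := hF.sel_some hN trivial hu hs
  refine ⟨h1, h2, h3, h4, ?_⟩
  rcases hF.root_cases hN u hu with h | ⟨a, h⟩
  · rw [h.2.2] at hs; cases hs
  · rw [h.2.2.2.2.2.1] at hs
    cases hs
    apply small_iff_of_root hN hF
    rw [h.2.2.2.2.2.2 u hu]
    exact hF.root_eq_of_ldr hN (hN.ldr_ldr _).symm

/-- In ring merging mode the auxiliary edges are unconstrained. Only the wreaths of free committees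
must be intact, and edges between free nodes do not change. -/
lemma realised_mergeGraph (ι : V ↪o ℕ) (τ : ℕ) :
    N.committees.Realised G (N.mergeGraph G j τ) ι := by
  have h := realised hN (hF.mono (Set.subset_univ _)) ι
  refine ⟨h.leader_leader, h.uid_le_leader, fun _ => le_mergeGraph hN hF τ, h.sel_selection,
    fun u hu hm => ?_, h.sel_merging, fun r _ hm => ?_, fun r _ hm => ?_⟩
  · refine mergeGraph_isWreath hN hF τ hu (fun hb => ?_) rfl fun x _ => ⟨rfl, rfl⟩
    simp [committees, hb] at hm
  · simp only [committees] at hm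
    split_ifs at hm
  · simp only [committees] at hm
    split_ifs at hm

lemma group_running {t : ℕ} (r : V) : (N.running G j t).group r = N.tree r := by
  ext x
  exact hF.hasRoot_iff hN (s := N.running G j t) rfl x r

/-- State `t` of the line is wanted in round `j + 2 + t` of the stage, so it is present one round
later; hence the index `j + 3 + t`. -/
lemma realised_running (ι : V ↪o ℕ) (t : ℕ) :
    (N.running G j t).Realised G (N.mergeGraph G j (j + 3 + t)) ι where
  leader_leader := hN.ldr_ldr
  uid_le_leader x := ι.le_iff_le.2 (hN.le_ldr x)
  keeps_initial _ := le_mergeGraph hN hF _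
  sel_selection u hu hm := by
    apply sel_eq_none_of_not_busy
    intro hb
    by_cases hs : u ∈ N.small j
    · rw [running_mode_of_small hs] at hm; simp at hm
    · rw [running_mode_of_busy hs hb] at hm; simp at hm
  wreath u hu hm := by
    refine mergeGraph_isWreath hN hF _ hu (fun hb => ?_) rfl fun x hx =>
      ⟨ring_of_not_small hN hF fun h => hx h.1, line_of_not_small fun h => hx h.1⟩
    by_cases hs : u ∈ N.small j
    · rw [running_mode_of_small hs] at hm; simp at hm
    · rw [running_mode_of_busy hs hb] at hm; simp at hm
  sel_merging u v hu hs := by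
    obtain ⟨h1, h2, h3, h4, h5⟩ := sel_some_congr hN hF (j := j) hu hs
    refine ⟨h1, ι.lt_iff_lt.2 h2, ?_⟩
    by_cases hs : u ∈ N.small j
    · rw [running_mode_of_small hs, running_mode_of_small (h5.1 hs)]
    · rw [running_mode_of_busy hs h3, running_mode_of_busy (h5.not.1 hs) h4]
  treeMerging r hr hm hsel := by
    have hs : r ∈ N.small j := by
      by_contra hs
      by_cases hb : r ∈ N.busy
      · rw [running_mode_of_busy hs hb] at hm; simp at hm
      · rw [running_mode_of_not_busy hb] at hm; simp at hm
    have hroot : treeRoot N.up r = r := by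
      rcases hF.root_cases hN r hr with h | ⟨a, h⟩
      · exact h.1 r hr
      · rw [show (N.running G j t).sel r = N.sel r from rfl, h.2.2.2.2.2.1] at hsel
        cases hsel
    rw [group_running hN hF]
    refine ⟨ring_isCycleOn hN hF hroot hs, fun x hx => ?_⟩
    have hx : treeRoot N.up x = r := hx
    have hxs := (small_iff_of_root hN hF (hx.trans hroot.symm)).2 hs
    have hgraph : j + 3 + t = j + 2 + t + 1 := by omega
    have hline : N.line G j t x = lineToTree r (N.ring G j) t x := by rw [line_of_small hxs, hx]
    refine ⟨fun hne => ?_, hline, fun hne => ?_⟩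
    · rw [hgraph]
      exact (mergeGraph_of_want ((want_line hN hF hxs).2 (Or.inr (Or.inl rfl)))).resolve_left hne
    · rw [hgraph]
      refine (mergeGraph_of_want ((want_line hN hF hxs).2 (Or.inr (Or.inr rfl)))).resolve_left ?_
      rw [hline]
      exact lineToTree_ne hN hF hroot hs t hx hne
  termination u hu hm := by
    simp only [running] at hm
    split_ifs at hm

lemma evolves_running_zero (ι : V ↪o ℕ) (u : V) :
    N.committees.Evolves G ι (N.running G j 0) u := by
  by_cases hb : u ∈ N.busy
  · have hm : N.committees.mode u = .ringMerging := if_pos hb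
    simp only [Committees.Evolves, hm]
    refine ⟨rfl, ?_⟩
    by_cases hs : u ∈ N.small j
    · exact Or.inr ⟨running_mode_of_small hs, fun x hx => ⟨hx, rfl⟩⟩
    · refine Or.inl ⟨running_mode_of_busy hs hb, fun x hx => ⟨hx, ?_⟩⟩
      have hxs : x ∉ N.small j := by
        rw [← small_iff_of_ldr hN hF (hN.ldr_ldr x), show N.ldr x = u from hx]; exact hs
      exact ⟨ring_of_not_small hN hF hxs, line_of_not_small hxs⟩
  · have hm : N.committees.mode u = .selection := if_neg hb
    simp only [Committees.Evolves, hm]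
    refine Or.inl ⟨running_mode_of_not_busy hb, fun x hx => ⟨hx, ?_⟩⟩
    have hxs : x ∉ N.small j := by
      rw [← small_iff_of_ldr hN hF (hN.ldr_ldr x), show N.ldr x = u from hx]
      exact fun h => hb h.1
    exact ⟨ring_of_not_small hN hF hxs, line_of_not_small hxs⟩

lemma evolves_running_succ (ι : V ↪o ℕ) (t : ℕ) (u : V) :
    (N.running G j t).Evolves G ι (N.running G j (t + 1)) u := by
  have hunch : u ∉ N.small j → (N.running G j t).Unchanged (N.running G j (t + 1)) u := by
    intro hs x hx
    have hxs : x ∉ N.small j := by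
      rw [← small_iff_of_ldr hN hF (hN.ldr_ldr x), show N.ldr x = u from hx]; exact hs
    exact ⟨hx, rfl, (line_of_not_small hxs).trans (line_of_not_small hxs).symm⟩
  by_cases hs : u ∈ N.small j
  · simp only [Committees.Evolves, running_mode_of_small hs]
    exact Or.inl ⟨trivial, rfl, fun x hx => ⟨hx, rfl, Or.inr rfl⟩⟩
  by_cases hb : u ∈ N.busy
  · simp only [Committees.Evolves, running_mode_of_busy hs hb]
    exact ⟨rfl, Or.inl ⟨trivial, hunch hs⟩⟩
  · simp only [Committees.Evolves, running_mode_of_not_busy hb]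
    exact Or.inl ⟨trivial, hunch hs⟩

/-- The state `t = j` is already stationary, so the last round of the stage changes no parent and
serves to unite the committees. -/
lemma evolves_merge (ι : V ↪o ℕ) (u : V) (hu : N.ldr u = u) :
    (N.running G j j).Evolves G ι (N.merge G j).committees u := by
  have hunch : u ∉ N.small j → (N.running G j j).Unchanged (N.merge G j).committees u := by
    intro hs x hx
    have hx : N.ldr x = u := hx
    have hxs : x ∉ N.small j := by
      rw [← small_iff_of_ldr hN hF (hN.ldr_ldr x), hx]; exact hs
    exact ⟨(merge_ldr_of_not_small (G := G) hxs).trans hx, rfl,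
      (line_of_not_small hxs).trans (line_of_not_small hxs).symm⟩
  by_cases hs : u ∈ N.small j
  · simp only [Committees.Evolves, running_mode_of_small hs]
    have hr := (hF.isForest hN).root_root u
    have hrs := (small_root hN hF u).2 hs
    refine Or.inr ⟨treeRoot N.up u, ?_, ?_, ?_, ?_⟩
    · have := (hF.hasRoot_iff hN (s := N.running G j j) rfl u _).2 rfl
      rwa [hu] at this
    · exact if_neg fun h => h.2 hrs
    · rw [group_running hN hF]
      intro x hx t ht
      have hx : treeRoot N.up x = treeRoot N.up u := hx
      change _ = N.line G j j x
      rw [line_of_small ((small_iff_of_root hN hF hx).2 hs), hx]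
      exact lineToTree_stable hN hF hr hrs ht le_rfl hx
    · intro x hx
      have hx : N.ldr x = u := hx
      have hxr : treeRoot N.up x = treeRoot N.up u := hF.root_eq_of_ldr hN (hx.trans hu.symm)
      have hxs := (small_iff_of_root hN hF hxr).2 hs
      refine ⟨(merge_ldr_of_small (G := G) hxs).trans hxr, rfl, ?_⟩
      change N.line G j (j + 1) x = N.line G j j x
      rw [line_of_small hxs, line_of_small hxs, hxr]
      exact lineToTree_stable hN hF hr hrs (Nat.le_succ j) le_rfl hxr
  by_cases hb : u ∈ N.busy
  · simp only [Committees.Evolves, running_mode_of_busy hs hb]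
    exact ⟨merge_sel hN hF hu hb hs, Or.inl ⟨if_pos ⟨hb, hs⟩, hunch hs⟩⟩
  · simp only [Committees.Evolves, running_mode_of_not_busy hb]
    exact Or.inl ⟨if_neg fun h => hb h.1, hunch hs⟩

lemma mergeGraph_end : N.mergeGraph G j (2 * j + 4) = (N.merge G j).graph G := by
  rw [(N.merge G j).graph_eq G (fun _ => ∅) fun _ _ _ => ∅, show 2 * j + 4 = j + 2 + (j + 1) + 1 by omega]
  simp only [mergeGraph, stageGraph]
  congr! 4 with x y
  by_cases hs : x ∈ N.small j
  · ext z
    rw [want_line hN hF hs]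
    change _ ↔ (G.Adj x z ∨ z = N.ring G j x) ∨ z = N.line G j (j + 1) x
    rw [or_assoc, @eq_comm _ z, @eq_comm _ z]
  · rw [want_of_not_small hN hF (by omega) hs]
    change G.neighborSet x ∪ {N.succ x} ∪ {N.par x} = G.neighborSet x ∪ {N.ring G j x} ∪
      {N.line G j (j + 1) x}
    rw [ring_of_not_small hN hF hs, line_of_not_small hs]

end Net

/-- Up to round `j + 2` of the stage the committees are in ring merging mode; then those of small
trees run through the states `0, …, j` of the line; the last round forms the new committees. -/
theorem Ready.merge {V : Type} [LinearOrder V] [Finite V] {ι : V ↪o ℕ} {G : SimpleGraph V}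
    {K t j Δ : ℕ} {N : Net V} (h : Ready ι G K t (.merge j) N (fun _ => ∅) (eulerNext N.up))
    (hF : N.HasForest G Set.univ) (hΔ : ∀ v, (G.neighborSet v).ncard ≤ Δ)
    (hK : (Δ + 3) ^ 2 + 12 ≤ K) :
    Ready ι G K (t + (2 * j + 4)) (.select (j + 1)) (N.merge G j) (fun _ => ∅)
      fun _ _ _ => ∅ := by
  have hN := h.valid
  obtain ⟨hA, hend⟩ := h.start.stage (fun _ => rfl)
    (fun τ _ x => Net.merge_covered hN hF τ x)
    (fun τ _ v w hw => Net.merge_dist_two hN hF hw)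
  have hdeg : ∀ τ v, ((N.mergeGraph G j τ \ G).neighborSet v).ncard ≤ K := fun τ v =>
    (Net.degree_mergeGraph_le hN hF hΔ τ v).trans hK
  have hlen : (Stage.merge j).len = 2 * j + 4 := rfl
  rw [Net.label_merge hN hF, hlen] at hend
  have hgr : stageGraph (N.know G (fun _ => ∅) (eulerNext N.up)) (.merge j) (N.graph G) (2 * j + 4) =
    (N.merge G j).graph G := Net.mergeGraph_end hN hF
  rw [hgr] at hend
  have hstep : ∀ τ, τ + 1 < 2 * j + 4 → ∀ s s' : Committees V, Reach ι G K (t + τ) s →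
      (∀ u, s.leader u = u → s.Evolves G ι s' u) → s'.Realised G (N.mergeGraph G j (τ + 1)) ι →
      Reach ι G K (t + (τ + 1)) s' := fun τ hτ s s' hs hE hR =>
    hs.step (hA τ (by omega)) (mem_stageHeard _) (fun _ => rfl) (hA (τ + 1) (by omega)).1 hE hR
      (hdeg _)
  have h1 : ∀ τ ≤ j + 2, Reach ι G K (t + τ) N.committees := by
    intro τ
    induction τ with
    | zero => exact fun _ => h.reach
    | succ τ ih =>
      exact fun hτ => hstep τ (by omega) _ _ (ih (by omega))
        (fun u _ => hN.committees_evolves_self _ u) (Net.realised_mergeGraph hN hF ι _)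
  have h2 : ∀ k ≤ j, Reach ι G K (t + (j + 3 + k)) (N.running G j k) := by
    intro k
    induction k with
    | zero =>
      exact fun _ => hstep (j + 2) (by omega) _ _ (h1 _ le_rfl)
        (fun u _ => Net.evolves_running_zero hN hF ι u) (Net.realised_running hN hF ι 0)
    | succ k ih =>
      exact fun hk => hstep (j + 3 + k) (by omega) _ _ (ih (by omega))
        (fun u _ => Net.evolves_running_succ hN hF ι k u) (Net.realised_running hN hF ι (k + 1))
  have hV := Net.merge_valid hN hF (j := j)
  have hVF := Net.merge_hasForest hN hF (j := j)
  refine ⟨hend, ?_, hV, hVF⟩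
  have h3 := h2 j le_rfl
  have hlast := hA (j + 3 + j) (by rw [hlen]; omega)
  have he : t + (2 * j + 4) = t + (j + 3 + j) + 1 := by omega
  rw [he] at hend ⊢
  refine h3.step hlast (mem_stageHeard _) (fun _ => rfl) hend.1
    (fun u hu => Net.evolves_merge hN hF ι u hu) (Net.realised hV hVF ι) fun v => ?_
  rw [← Net.mergeGraph_end hN hF]
  exact hdeg _ v

/-! ## Progress -/

section Slots

variable {V : Type} [LinearOrder V] [Finite V] {ι : V ↪o ℕ} {G : SimpleGraph V} {K t j Δ : ℕ}
  {N : Net V}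

/-- At the beginning of a slot, the committees that are not merging are small. -/
structure SlotStart (ι : V ↪o ℕ) (G : SimpleGraph V) (K t j : ℕ) (N : Net V) : Prop where
  ready : Ready ι G K t (.select j) N (fun _ => ∅) fun _ _ _ => ∅
  ncard_le : ∀ x ∉ N.busy, (N.comm (N.ldr x)).ncard ≤ 2 ^ j

/-- The committees after slot `j`. -/
noncomputable def Net.next (N : Net V) (G : SimpleGraph V) (j : ℕ) : Net V := (N.joined G).merge G j

theorem SlotStart.slot (h : SlotStart ι G K t j N) (hG : G.Connected)
    (hΔ : ∀ v, (G.neighborSet v).ncard ≤ Δ) (hK : (Δ + 3) ^ 2 + 12 ≤ K) :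
    Finished ι G K (t + (2 * j + 2)) ∨
    (¬ (N.busy = ∅ ∧ ∀ x y, N.ldr x = N.ldr y)) ∧
      SlotStart ι G K (t + (6 * j + 10)) (j + 1) (N.next G j) := by
  have hK6 : 6 ≤ K := by omega
  refine (h.ready.select hG h.ncard_le hK6).imp id fun ⟨h1, h2⟩ => ⟨h1, ?_⟩
  have hF := h2.valid.joined_hasForest h2.forest
  have h3 := ((h2.join h.ncard_le hK6).order hF hK6).merge hF hΔ hK
  have ht : t + (2 * j + 2) + (2 * j + 2) + 2 + (2 * j + 4) = t + (6 * j + 10) := by omega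
  rw [ht] at h3
  exact ⟨h3, fun x hx => Net.merge_comm_ncard_le h2.valid.joined hF
    (fun x hx => h.ncard_le x fun hb => hx (Or.inl hb)) hx⟩

/-- Once `2 ^ j` reaches the number of nodes, every tree is small and no merger is left over. -/
lemma Net.next_busy (hj : Nat.card V ≤ 2 ^ j) : (N.next G j).busy = ∅ := by
  refine Set.eq_empty_iff_forall_notMem.2 fun x hx => hx.2 ⟨hx.1, ?_⟩
  exact (Set.ncard_le_card _).trans hj

/-- Every committee has at least `m` nodes. -/
def Net.AtLeast (N : Net V) (m : ℕ) : Prop := ∀ x, m ≤ (N.comm (N.ldr x)).ncard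

/-- Every committee has at least `m` nodes, and those with fewer than `2 * m` nodes have a
neighbouring committee with a greater UID. -/
def Net.AlmostTwice (N : Net V) (G : SimpleGraph V) (m : ℕ) : Prop := N.AtLeast m ∧
  ∀ x, 2 * m ≤ (N.comm (N.ldr x)).ncard ∨ ∃ z y, N.ldr z = N.ldr x ∧ G.Adj z y ∧ N.ldr x < N.ldr y

/-! ### Two slots double the least size of a committee -/

section Doubling

variable (hN : N.Valid) (hb : N.busy = ∅) (hj : Nat.card V ≤ 2 ^ j)
include hN hb hj

omit hb in
lemma Net.next_small {x : V} (hx : x ∈ (N.joined G).busy) : x ∈ (N.joined G).small j :=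
  ⟨hx, (Set.ncard_le_card _).trans hj⟩

omit hb in
lemma Net.next_ldr_of_busy {x : V} (hx : x ∈ (N.joined G).busy) :
    (N.next G j).ldr x = treeRoot (N.joined G).up x :=
  merge_ldr_of_small (Net.next_small hN hj hx)

omit hN hb hj in
lemma Net.next_ldr_of_not_busy {x : V} (hx : x ∉ (N.joined G).busy) :
    (N.next G j).ldr x = N.ldr x :=
  merge_ldr_of_not_small fun h => hx h.1

lemma Net.next_ldr_congr {x y : V} (h : N.ldr x = N.ldr y) :
    (N.next G j).ldr x = (N.next G j).ldr y := by
  have hN' := hN.joined (G := G)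
  have hF : N.HasForest G N.busy := fun u hu => by rw [hb] at hu; exact hu.elim
  have hF' := hN.joined_hasForest hF
  have hiff : x ∈ (N.joined G).busy ↔ y ∈ (N.joined G).busy := by
    rw [← hN'.busy_ldr x, ← hN'.busy_ldr y]
    exact Iff.of_eq (congrArg (· ∈ (N.joined G).busy) h)
  by_cases hx : x ∈ (N.joined G).busy
  · rw [next_ldr_of_busy hN hj hx, next_ldr_of_busy hN hj (hiff.1 hx)]
    exact hF'.root_eq_of_ldr hN' h
  · rw [next_ldr_of_not_busy hx, next_ldr_of_not_busy (hiff.not.1 hx), h]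

lemma Net.comm_subset_next (x : V) :
    N.comm (N.ldr x) ⊆ (N.next G j).comm ((N.next G j).ldr x) := fun _ hy =>
  next_ldr_congr hN hb hj hy

/-- A merging tree contains at least two committees, each of at least `m` nodes. -/
lemma Net.twice_le {m : ℕ} (hm : N.AtLeast m) {x : V} (hx : x ∈ (N.joined G).busy) :
    2 * m ≤ ((N.next G j).comm ((N.next G j).ldr x)).ncard := by
  have hN' := hN.joined (G := G)
  have hF : N.HasForest G N.busy := fun u hu => by rw [hb] at hu; exact hu.elim
  have hF' := hN.joined_hasForest hF
  obtain ⟨y, hne, hy⟩ := hN.joined_root hF (by simp [hb]) hx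
  have hyb : y ∈ (N.joined G).busy := by
    rw [← (hF'.root_ldr hN' y).2.2, hy, (hF'.root_ldr hN' x).2.2]; exact hx
  have hxy : (N.next G j).ldr y = (N.next G j).ldr x := by
    rw [next_ldr_of_busy hN hj hx, next_ldr_of_busy hN hj hyb, hy]
  have hdisj : Disjoint (N.comm (N.ldr x)) (N.comm (N.ldr y)) :=
    Set.disjoint_left.2 fun z (h1 : N.ldr z = _) (h2 : N.ldr z = _) => hne (h2.symm.trans h1)
  have hsub : N.comm (N.ldr x) ∪ N.comm (N.ldr y) ⊆ (N.next G j).comm ((N.next G j).ldr x) := by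
    refine Set.union_subset (comm_subset_next hN hb hj x) ?_
    rw [← hxy]
    exact comm_subset_next hN hb hj y
  have h1 := Set.ncard_le_ncard hsub (Set.toFinite _)
  rw [Set.ncard_union_eq hdisj (Set.toFinite _) (Set.toFinite _)] at h1
  have h2 := hm x
  have h3 := hm y
  omega

/-- A committee left out has a neighbour, as it is not alone. By `joined_neighbour` that neighbour
has selected a greater committee, so after the slot it belongs to a committee with a greater UID. -/
lemma Net.AtLeast.almostTwice (hG : G.Connected) (hne : ¬ ∀ x y, N.ldr x = N.ldr y) {m : ℕ}
    (hm : N.AtLeast m) : (N.next G j).AlmostTwice G m := by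
  have hF : N.HasForest G N.busy := fun u hu => by rw [hb] at hu; exact hu.elim
  refine ⟨fun x => (hm x).trans (Set.ncard_le_ncard (comm_subset_next hN hb hj x) (Set.toFinite _)),
    fun x => ?_⟩
  by_cases hx : x ∈ (N.joined G).busy
  · exact Or.inl (twice_le hN hb hj hm hx)
  · right
    have hal : ¬ (N.plain G).Alone x := fun hal => hne fun a b => by
      rw [(hN.alone_univ hG hal).2 a, (hN.alone_univ hG hal).2 b]
    rw [hN.know_alone] at hal
    obtain ⟨z, hz, y, hzy, hy⟩ : ∃ z, N.ldr z = N.ldr x ∧ ∃ y, G.Adj z y ∧ N.ldr y ≠ N.ldr x := by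
      by_contra hcon
      refine hal ⟨by simp [hb], fun z hz y hzy => ?_⟩
      by_contra hy
      exact hcon ⟨z, hz, y, hzy, hy⟩
    obtain ⟨_, h2, h3⟩ := hN.joined_neighbour hF hb hx hz hzy hy
    refine ⟨z, y, next_ldr_congr hN hb hj hz, hzy, ?_⟩
    rw [next_ldr_of_not_busy hx, next_ldr_of_busy hN hj h2]
    exact h3

/-- By `joined_neighbour` a committee left out has only lesser neighbours, which rules out the
second alternative; so it was already large. -/
lemma Net.AlmostTwice.atLeast {m : ℕ} (hm : N.AlmostTwice G m) :
    (N.next G j).AtLeast (2 * m) := by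
  have hF : N.HasForest G N.busy := fun u hu => by rw [hb] at hu; exact hu.elim
  intro x
  by_cases hx : x ∈ (N.joined G).busy
  · exact twice_le hN hb hj hm.1 hx
  · rcases hm.2 x with h | ⟨z, y, hz, hzy, hlt⟩
    · exact h.trans (Set.ncard_le_ncard (comm_subset_next hN hb hj x) (Set.toFinite _))
    · exact absurd hlt (hN.joined_neighbour hF hb hx hz hzy hlt.ne').1.not_gt

end Doubling

/-- The number of rounds before slot `j`. -/
def slotTime (j : ℕ) : ℕ := 3 * j ^ 2 + 7 * j + 1

lemma slotTime_succ (j : ℕ) : slotTime (j + 1) = slotTime j + (6 * j + 10) := by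
  unfold slotTime; ring

section Termination

variable (hG : G.Connected) (hΔ : ∀ v, (G.neighborSet v).ncard ≤ Δ) (hK : (Δ + 3) ^ 2 + 12 ≤ K)
include hG hΔ hK

/-- One more slot. -/
lemma slot_step {P Q : Net V → Prop}
    (hPQ : ∀ N, N.Valid → P N → (¬ (N.busy = ∅ ∧ ∀ x y, N.ldr x = N.ldr y)) → Q (N.next G j))
    (h : (∃ T ≤ slotTime j, Finished ι G K T) ∨ ∃ N, SlotStart ι G K (slotTime j) j N ∧ P N) :
    (∃ T ≤ slotTime (j + 1), Finished ι G K T) ∨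
      ∃ N, SlotStart ι G K (slotTime (j + 1)) (j + 1) N ∧ Q N := by
  have hle := slotTime_succ j
  rcases h with ⟨T, hT, h⟩ | ⟨N, h1, h2⟩
  · exact Or.inl ⟨T, by omega, h⟩
  · rcases h1.slot hG hΔ hK with h | ⟨h3, h4⟩
    · exact Or.inl ⟨_, by omega, h⟩
    · rw [← hle] at h4
      exact Or.inr ⟨_, h4, hPQ N h1.ready.valid h2 h3⟩

/-- Slots `0, …, L` clear all waiting mergers, `2 * L` further slots double the least size `L`
times, and in one more slot the single remaining committee terminates. -/
theorem exists_finished (h : ∃ N, SlotStart ι G K (slotTime 0) 0 N) {L : ℕ}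
    (hL : Nat.card V ≤ 2 ^ L) : ∃ T ≤ slotTime (3 * L + 2), Finished ι G K T := by
  obtain ⟨v₀⟩ := hG.nonempty
  have hpow : ∀ j, L ≤ j → Nat.card V ≤ 2 ^ j := fun j hj =>
    hL.trans (Nat.pow_le_pow_right (by norm_num) hj)
  have h1 : ∀ j, (∃ T ≤ slotTime j, Finished ι G K T) ∨
      ∃ N, SlotStart ι G K (slotTime j) j N ∧ (L + 1 ≤ j → N.busy = ∅) := by
    intro j
    induction j with
    | zero =>
      obtain ⟨N, h⟩ := h
      exact Or.inr ⟨N, h, fun h => by omega⟩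
    | succ j ih =>
      exact slot_step hG hΔ hK (fun N _ _ _ hj => Net.next_busy (hpow j (by omega))) ih
  have h2 : ∀ k, (∃ T ≤ slotTime (L + 1 + 2 * k), Finished ι G K T) ∨
      ∃ N, SlotStart ι G K (slotTime (L + 1 + 2 * k)) (L + 1 + 2 * k) N ∧
        (N.busy = ∅ ∧ N.AtLeast (2 ^ k)) := by
    intro k
    induction k with
    | zero =>
      refine (h1 (L + 1)).imp id fun ⟨N, h, hb⟩ => ⟨N, h, hb le_rfl, fun x => ?_⟩
      rw [pow_zero, Nat.one_le_iff_ne_zero]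
      exact Set.ncard_ne_zero_of_mem (a := x) rfl
    | succ k ih =>
      refine slot_step hG hΔ hK (j := L + 1 + 2 * k + 1)
        (P := fun N => N.busy = ∅ ∧ N.AlmostTwice G (2 ^ k)) (fun N hN hP _ => ⟨?_, ?_⟩)
        (slot_step hG hΔ hK (fun N hN hP hne => ⟨?_, ?_⟩) ih)
      · exact Net.next_busy (hpow _ (by omega))
      · rw [pow_succ']
        exact hP.2.atLeast hN hP.1 (hpow _ (by omega))
      · exact Net.next_busy (hpow _ (by omega))
      · exact hP.2.almostTwice hN hP.1 (hpow _ (by omega)) hG fun h => hne ⟨hP.1, h⟩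
  -- With at least `2 ^ L ≥ n` nodes in each committee there is only one committee, so this slot
  -- cannot end without termination.
  have h3 := slot_step (Q := fun _ => False) hG hΔ hK (fun N hN hP hne => ?_) (h2 L)
  · rw [show 3 * L + 2 = L + 1 + 2 * L + 1 by omega]
    exact h3.resolve_right fun ⟨_, _, h⟩ => h
  · apply hne
    refine ⟨hP.1, ?_⟩
    have huniv : ∀ x, N.comm (N.ldr x) = Set.univ := by
      intro x
      refine Set.eq_of_subset_of_ncard_le (Set.subset_univ _) ?_ (Set.toFinite _)
      rw [Set.ncard_univ]
      exact hL.trans (hP.2 x)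
    intro x y
    have : x ∈ N.comm (N.ldr y) := by rw [huniv y]; trivial
    exact this

end Termination

end Slots

/-! ## The first round -/

section Setup

variable {V : Type} [LinearOrder V] [Finite V] (ι : V ↪o ℕ) (G : SimpleGraph V) (K : ℕ)

/-- Every node is a committee. -/
def Net.initial (V : Type) : Net V where
  ldr := id
  par := id
  up := id
  succ := 1
  busy := ∅

omit [Finite V] in
lemma Net.initial_valid : (Net.initial V).Valid where
  ldr_ldr _ := rfl
  le_ldr _ := le_rfl
  cycle u _ := by
    have : (Net.initial V).comm u = {u} := by ext x; exact Iff.rfl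
    rw [this]
    exact Equiv.Perm.isCycleOn_singleton.2 rfl
  par_eq u _ i _ := by simp [Net.initial]
  busy_ldr _ := Iff.rfl

omit [Finite V] in
lemma Net.initial_graph : (Net.initial V).graph G = G := by
  ext x y
  simp only [Net.graph, SimpleGraph.sup_adj, graphOfMap_adj, Net.initial, id, Equiv.Perm.coe_one]
  have : G.Adj x y → x ≠ y := fun h => h.ne
  by_cases h : x = y
  · subst h; simp
  · have h' : y ≠ x := Ne.symm h
    tauto

omit [LinearOrder V] [Finite V] in
lemma Net.initial_committees : (Net.initial V).committees = Committees.initial := by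
  have h1 : (Net.initial V).sel = fun _ => none :=
    funext fun u => Net.sel_eq_none_of_not_busy (Set.notMem_empty u)
  simp only [Net.committees, h1]
  simp [Net.initial, Committees.initial]

/-- What the nodes know at the beginning. -/
def initialKnow (V : Type) : Know V := fun x t => {y | t = .pres ∧ y = x}

omit [Finite V] in
lemma at_zero : At ι G 0 .setup 0 (initialKnow V) (fun v => {v}) G := by
  refine ⟨rfl, fun v => ?_⟩
  simp only [Algorithm.run, graphToWreath, NodeState.mk.injEq, true_and]
  funext z tag
  ext b
  constructor
  · rintro ⟨rfl, rfl, rfl⟩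
    exact ⟨v, rfl, v, ⟨rfl, rfl, rfl⟩, rfl⟩
  · rintro ⟨x, rfl, y, ⟨rfl, rfl, rfl⟩, rfl⟩
    exact ⟨rfl, rfl, rfl⟩

/-- The first round only teaches the nodes the UIDs of their neighbours; every node is then a ring
and a tree by itself. -/
theorem exists_slotStart : ∃ N, SlotStart ι G K (slotTime 0) 0 N := by
  have hN := Net.initial_valid (V := V)
  have hF : (Net.initial V).HasForest G (Net.initial V).busy := fun u hu => hu.elim
  have hmem : ∀ v b, b ≠ ι v ∧ b ∈ ((initialKnow V).restrict (heard (fun v => {v}) G v)).rename ι b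
      .pres ↔ b ∈ ι '' G.neighborSet v := by
    intro v b
    constructor
    · rintro ⟨hne, x, rfl, y, ⟨h, _, rfl⟩, hy⟩
      rcases h with h | ⟨w, hw, h⟩
      · exact absurd (congrArg ι h) hne
      · exact ⟨w, hw, congrArg ι h.symm⟩
    · rintro ⟨w, hw, rfl⟩
      exact ⟨fun h => hw.ne (ι.injective h).symm, w, rfl, w, ⟨Or.inr ⟨w, hw, rfl⟩, rfl, rfl⟩, rfl⟩
  have h1 := (at_zero ι G).step_end (fun _ => rfl) (fun v => by ext; simp [initialKnow])
    (W := fun v => G.neighborSet v) (fun v => Set.ext fun b => hmem v b)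
    (fun v w hw => Or.inr (Or.inl hw)) rfl (N := (Net.initial V).plain G) (fun v tag => by
      cases tag
      case nbr => exact Set.ext fun b => hmem v b
      case busy => exact (Set.image_eq_empty.2 (Set.eq_empty_iff_forall_notMem.2
        fun y hy => hy.2)).symm
      case tgt => exact (Set.image_empty _).symm
      case halt => exact (Set.image_empty _).symm
      case next => exact (Set.image_empty _).symm
      all_goals exact Set.image_singleton.symm)
  have hg : (SimpleGraph.fromRel fun v w => w ∈ G.neighborSet v) = (Net.initial V).graph G := by
    rw [Net.initial_graph]
    ext x y
    simp only [SimpleGraph.fromRel_adj, SimpleGraph.mem_neighborSet, G.adj_comm y x, or_self]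
    exact ⟨fun h => h.2, fun h => ⟨h.ne, h⟩⟩
  rw [hg] at h1
  refine ⟨Net.initial V, ⟨h1, ?_, hN, hF⟩, fun x _ => ?_⟩
  · have hR := Net.realised hN hF ι (G := G)
    have h0 : Reach ι G K 0 .initial := by
      refine .zero ?_
      rw [Net.initial_graph, Net.initial_committees] at hR
      exact hR
    rw [← Net.initial_committees] at h0
    refine h0.step (at_zero ι G) (fun _ => rfl) (fun v => by ext; simp [initialKnow]) h1.1
      (fun u _ => hN.committees_evolves_self _ u) hR fun v => ?_
    rw [Net.initial_graph]
    simp [SimpleGraph.neighborSet]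
  · have : (Net.initial V).comm ((Net.initial V).ldr x) = {x} := by ext y; exact Iff.rfl
    rw [this, Set.ncard_singleton, pow_zero]

end Setup

/-! ## The theorem -/

lemma SimpleGraph.ncard_edgeSet_le {V : Type} [Finite V] (H : SimpleGraph V) {d : ℕ}
    (h : ∀ v, (H.neighborSet v).ncard ≤ d) : H.edgeSet.ncard ≤ Nat.card V * d := by
  classical
  have := Fintype.ofFinite V
  have h1 := H.sum_degrees_eq_twice_card_edges
  have h2 : ∑ v, H.degree v ≤ ∑ _v : V, d := by
    refine Finset.sum_le_sum fun v _ => ?_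
    have := h v
    rwa [Set.ncard_eq_toFinset_card', Set.toFinset_card, SimpleGraph.card_neighborSet_eq_degree] at this
  rw [Finset.sum_const, Finset.card_univ, smul_eq_mul] at h2
  have h3 : H.edgeSet.ncard = H.edgeFinset.card := by
    rw [Set.ncard_eq_toFinset_card']; rfl
  rw [h3, Nat.card_eq_fintype_card]
  omega

/-- Only edges that were present can be deactivated, so newly activated ones survive the round. This
bounds the activations of a round by the number of edges after it. -/
lemma Algorithm.activated_le {A : Algorithm} {V : Type} (uid : V → ℕ) (G : SimpleGraph V) (i : ℕ) :
    A.activated uid (A.run uid G i) ≤ (A.run uid G (i + 1)).graph := fun _ _ h =>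
  ⟨Or.inr h, fun h' => h.2.1 h'.1⟩

theorem mainTheorem3 :
    ∃ A : Algorithm, A.IsComparisonBased ∧
      ∀ Δ : ℕ, ∃ C : ℝ, ∀ (V : Type) [Finite V] (G : SimpleGraph V), G.Connected →
        (∀ v, (G.neighborSet v).ncard ≤ Δ) → ∀ uid : V → ℕ, Function.Injective uid →
        ∃ T : ℕ, A.HasRunningTime uid G T ∧
          A.ExecutesGraphToWreath uid G T ∧
          (∃ r, A.ElectsLeader uid G T r ∧ (∀ v, uid v ≤ uid r) ∧
            IsRootedTreeOfDepth (A.run uid G T).graph r (Nat.log 2 (Nat.card V)) ∧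
            IsCompleteBinaryTree (A.run uid G T).graph r) ∧
          (2 ≤ Nat.card V →
            (T : ℝ) ≤ C * Real.logb 2 (Nat.card V) ^ 2 ∧
            (A.totalActivations uid G T : ℝ) ≤ C * (Nat.card V * Real.logb 2 (Nat.card V) ^ 2) ∧
            (∀ i ≤ T, ((A.run uid G i).graph.edgeSet.ncard : ℝ) ≤ C * Nat.card V) ∧
            (∀ i ≤ T, ∀ v, ((((A.run uid G i).graph \ G).neighborSet v).ncard : ℝ) ≤ C)) := by
  refine ⟨graphToWreath, graphToWreath_isComparisonBased, fun Δ => ?_⟩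
  set K : ℕ := (Δ + 3) ^ 2 + 12 with hK
  -- `slotTime (3 * L + 2) = 27 * L ^ 2 + 57 * L + 27 ≤ 111 * L ^ 2`, and `L` is at most twice the
  -- binary logarithm of `n`; this gives `444`. The factor `Δ + K + 1` absorbs the degree bounds.
  refine ⟨444 * (Δ + K + 1), fun V _ G hG hΔ uid huid => ?_⟩
  -- Ordering the nodes by their UIDs turns the assignment into an order embedding, the setting of
  -- the locality lemmas.
  let _ : LinearOrder V := LinearOrder.lift' uid huid
  let ι : V ↪o ℕ := ⟨⟨uid, huid⟩, Iff.rfl⟩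
  change ∃ T, graphToWreath.HasRunningTime ι G T ∧ _
  have hn : Nat.card V ≠ 0 := by
    have := hG.nonempty
    exact Nat.card_pos.ne'
  set L := Nat.log 2 (Nat.card V) + 1 with hL
  obtain ⟨T, hT, s, r, hs, hl, hm, hgr, hel, hhalt, hmax, hd, hc⟩ := exists_finished (K := K) hG hΔ le_rfl
    (exists_slotStart ι G K) (L := L) (Nat.lt_pow_succ_log_self (by norm_num) _).le
  obtain ⟨c, h0, h1, h2, h3, h4, h5⟩ := hs.exists_seq
  subst h1
  refine ⟨T, ⟨hhalt, fun i hi => ?_⟩, ⟨c, h0, h2, h3, r, hl, hm, hgr, hel⟩,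
    ⟨r, hel, fun v => hmax v, hd, hc⟩, fun hn2 => ?_⟩
  -- Before round `T` nobody has terminated, so `T` is the first time at which all have.
  · by_contra hlt
    exact h4 i (not_le.1 hlt) r (hi r)
  have hdeg : ∀ i ≤ T, ∀ v, ((graphToWreath.run ι G i).graph.neighborSet v).ncard ≤ Δ + K := by
    intro i hi v
    have h6 := h5 i hi v
    have h7 := hΔ v
    refine le_trans (Set.ncard_le_ncard (t := G.neighborSet v ∪
      ((graphToWreath.run ι G i).graph \ G).neighborSet v) (fun w hw => ?_) (Set.toFinite _))
      ((Set.ncard_union_le _ _).trans (by omega))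
    by_cases h : G.Adj v w
    · exact Or.inl h
    · exact Or.inr ⟨hw, h⟩
  have hedge : ∀ i ≤ T, (graphToWreath.run ι G i).graph.edgeSet.ncard ≤ Nat.card V * (Δ + K) :=
    fun i hi => SimpleGraph.ncard_edgeSet_le _ (hdeg i hi)
  have hact : graphToWreath.totalActivations ι G T ≤ T * (Nat.card V * (Δ + K)) := by
    unfold Algorithm.totalActivations
    refine (Finset.sum_le_sum fun i hi => ?_).trans_eq (by
      rw [Finset.sum_const, Finset.card_range, smul_eq_mul])
    exact (Set.ncard_le_ncard (SimpleGraph.edgeSet_subset_edgeSet.2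
      (Algorithm.activated_le ι G i)) (Set.toFinite _)).trans
      (hedge (i + 1) (Finset.mem_range.1 hi))
  set l := Real.logb 2 (Nat.card V) with hl2
  have hlog : ((Nat.log 2 (Nat.card V) : ℕ) : ℝ) ≤ l := by
    rw [hl2, Real.le_logb_iff_rpow_le (by norm_num) (by positivity), Real.rpow_natCast]
    exact_mod_cast Nat.pow_log_le_self 2 hn
  have hone : (1 : ℝ) ≤ l := by
    refine le_trans ?_ hlog
    exact_mod_cast Nat.log_pos (by norm_num) hn2
  have hLl : (L : ℝ) ≤ 2 * l := by rw [hL]; push_cast; linarith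
  have hTl : (T : ℝ) ≤ 444 * l ^ 2 := by
    have h6 : (T : ℝ) ≤ 3 * (3 * L + 2) ^ 2 + 7 * (3 * L + 2) + 1 := by
      have := hT
      unfold slotTime at this
      exact_mod_cast this
    have hL0 : (0 : ℝ) ≤ L := Nat.cast_nonneg L
    nlinarith [mul_self_le_mul_self hL0 hLl]
  have hKΔ : (0 : ℝ) ≤ Δ + K := by positivity
  have hn0 : (0 : ℝ) ≤ Nat.card V := by positivity
  refine ⟨hTl.trans ?_, ?_, fun i hi => ?_, fun i hi v => ?_⟩
  · nlinarith [sq_nonneg l, mul_nonneg hKΔ (sq_nonneg l)]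
  · have h6 : (graphToWreath.totalActivations ι G T : ℝ) ≤ T * (Nat.card V * (Δ + K)) := by
      exact_mod_cast hact
    refine h6.trans ((mul_le_mul_of_nonneg_right hTl (by positivity)).trans ?_)
    have : 0 ≤ (Nat.card V : ℝ) * l ^ 2 := by positivity
    nlinarith
  · have h6 : ((graphToWreath.run ι G i).graph.edgeSet.ncard : ℝ) ≤ Nat.card V * (Δ + K) := by
      exact_mod_cast hedge i hi
    refine h6.trans ?_
    nlinarith [mul_nonneg hn0 hKΔ]
  · have h6 : ((((graphToWreath.run ι G i).graph \ G).neighborSet v).ncard : ℝ) ≤ K := by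
      exact_mod_cast h5 i hi v
    refine h6.trans ?_
    have : (0 : ℝ) ≤ Δ := by positivity
    have : (0 : ℝ) ≤ K := by positivity
    linarith
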